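/- Theorem 2.1. A system $\{v_n\}$ in a Hilbert space $\mathcal H$ is called *complete and minimal* if its closed linear span is $\mathcal H$ while, for every $m$, the closed linear span of $\{v_n\}_{n\neq m}$ is not $\mathcal H$; it then has a unique biorthogonal system $\{w_n\}$, $(v_n,w_m)=\delta_{nm}$. A complete and minimal system is called *hereditarily complete* if for every partition $A\sqcup B$ of the index set the system $\{v_n\}_{n\in A}\cup\{w_n\}_{n\in B}$ has dense linear span in $\mathcal H$. Let $\Lambda\subset\mathbb C$ be such that the system $\{e^{i\lambda t}\}_{\lambda\in\Lambda}$ is complete and minimal in $L^2(-\pi,\pi)$, and let $$G(z)=\lim_{R\to\infty}\prod_{\lambda\in\Lambda,\ |\lambda|<R}\Bigl(1-\frac z\lambda\Bigr),\qquad z\in\mathbb C,$$ be its generating function. Assume that (a) $\Lambda\subset\mathbb R$ and $G(\mathbb R)\subset\mathbb R$; (b) $\operatorname{dist}(\mathbb Z,\Lambda)>0$; (c) $\Lambda$ is locally dense: there is $C>0$ such that every interval $I\subset\mathbb R$ with $|I|\ge C$ contains at least one element of $\Lambda$; (d) $|G(iy)|=o(e^{\pi|y|})$ as $|y|\to\infty$.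 Let $I_k=[\rho_k-d_k,\rho_k+d_k]$, $k\ge1$, be an infinite sequence of intervals with $d_k\ge0$, $2\rho_k\le\rho_{k+1}$, $d_k\le 0.1\,\rho_k$, $\operatorname{dist}(\rho_k,\mathbb Z)\ge\frac13$ and $G(\rho_k)\ne0$ for every $k$. Put $$g_k=\sum_{n\in I_k\cap\mathbb Z}G(n)^2,\qquad s_k=\sqrt{d_kg_k\rho_k},$$ $$J_k=[\rho_k-d_k-2s_k,\ \rho_k-d_k-s_k]\cup[\rho_k+d_k+s_k,\ \rho_k+d_k+2s_k].$$ Assume that (i) $\displaystyle\sum_{n\in\mathbb Z\setminus\bigcup_kI_k}G(n)^2<\infty$; (ii) $\displaystyle\sum_k s_k\sum_{n\in J_k\cap\mathbb Z}G(n)^2<\infty$; (iii) $s_k\le 0.1\,\rho_k$ for every $k$; (iv) $\displaystyle\sum_k\frac{d_k}{\rho_k}<\infty$. Then the system $\{e^{i\lambda t}\}_{\lambda\in\Lambda}$ is not hereditarily complete. -/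

import Mathlib

open Filter Topology MeasureTheory Asymptotics

noncomputable section

/-! ### Complete, minimal and hereditarily complete systems in a Hilbert space -/

section Systems

variable {ι H : Type*} [NormedAddCommGroup H] [InnerProductSpace ℂ H]

/-- A set of vectors is complete if its closed linear span is the whole space. -/
def SpansDensely (S : Set H) : Prop :=
  (Submodule.span ℂ S).topologicalClosure = ⊤

/-- The system `v` is complete and minimal: its closed span is the whole space, but the closed
span of the system with any one vector removed is not. -/
def IsCompleteMinimal (v : ι → H) : Prop :=
  SpansDensely (Set.range v) ∧ ∀ m : ι, ¬ SpansDensely (v '' {n | n ≠ m})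

/-- `w` is biorthogonal to `v`: `(v n, w m) = δ_{nm}`. -/
def IsBiorthogonal (v w : ι → H) : Prop :=
  (∀ n, inner ℂ (v n) (w n) = 1) ∧ ∀ n m, n ≠ m → inner ℂ (v n) (w m) = 0

/-- A complete and minimal system `v` (whose biorthogonal system `w` is then unique) is
hereditarily complete if for every partition of the index set into `A` and `Aᶜ` the mixed system
`{v n : n ∈ A} ∪ {w n : n ∈ Aᶜ}` is complete. -/
def IsHereditarilyComplete (v : ι → H) : Prop :=
  IsCompleteMinimal v ∧
    ∀ w : ι → H, IsBiorthogonal v w → ∀ A : Set ι, SpansDensely (v '' A ∪ w '' Aᶜ)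

end Systems

/-! ### Exponential systems in `L²(-π, π)` -/

/-- The Hilbert space `L²(-π, π)` of complex-valued functions. -/
abbrev L2Interval : Type :=
  Lp ℂ 2 ((volume : Measure ℝ).restrict (Set.Ioo (-Real.pi) Real.pi))

theorem memLp_exponential (l : ℂ) :
    MemLp (fun t : ℝ => Complex.exp (Complex.I * l * t)) 2
      ((volume : Measure ℝ).restrict (Set.Ioo (-Real.pi) Real.pi)) := by
  have hc : Continuous (fun t : ℝ => Complex.exp (Complex.I * l * t)) := by fun_prop
  obtain ⟨C, hC⟩ := (isCompact_Icc (a := -Real.pi) (b := Real.pi)).exists_bound_of_continuousOn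
    hc.continuousOn
  refine MemLp.of_bound hc.aestronglyMeasurable C ?_
  refine (ae_restrict_mem measurableSet_Ioo).mono fun t ht => hC t (Set.Ioo_subset_Icc_self ht)

/-- The exponential `t ↦ e^{i l t}` as an element of `L²(-π, π)`. -/
def exponential (l : ℂ) : L2Interval := (memLp_exponential l).toLp _

/-- The exponential system `{e^{i l t}}` with `l ∈ Λ`, indexed by `Λ`. -/
def exponentialSystem (Λ : Set ℂ) : Λ → L2Interval := fun l => exponential (l : ℂ)

/-- `G` is the generating function of the exponential system with frequency set `Λ`
(`0 ∉ Λ`): the principal value product `G(z) = lim_{R → ∞} ∏_{l ∈ Λ, |l| < R} (1 - z / l)`.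
The products are finite, as the frequency set of a complete and minimal exponential system has
no finite accumulation point. -/
def IsGeneratingFunction (Λ : Set ℂ) (G : ℂ → ℂ) : Prop :=
  ∀ z : ℂ, Tendsto (fun R : ℝ => ∏ᶠ (l : ℂ) (_ : l ∈ Λ ∧ ‖l‖ < R), (1 - z / l))
    atTop (𝓝 (G z))

/-! ### The intervals -/

/-- The interval `I = [ρ - d, ρ + d]`. -/
def coreInterval (ρ d : ℝ) : Set ℝ := Set.Icc (ρ - d) (ρ + d)

/-- The flanking set `J = [ρ - d - 2s, ρ - d - s] ∪ [ρ + d + s, ρ + d + 2s]`. -/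
def flankSet (ρ d s : ℝ) : Set ℝ :=
  Set.Icc (ρ - d - 2 * s) (ρ - d - s) ∪ Set.Icc (ρ + d + s) (ρ + d + 2 * s)

/-- The sum of `|G(n)|²` (equal to `G(n)²` where `G` is real on the real line) over the integers
`n` in the set `S`. It is used for bounded `S` only, so that the sum is finite. -/
def sumSq (G : ℂ → ℂ) (S : Set ℝ) : ℝ := ∑ᶠ (n : ℤ) (_ : (n : ℝ) ∈ S), ‖G n‖ ^ 2

/-- The scale `s = √(d g ρ)`, where `g` is the sum of `G(n)²` over the integers in
`I = [ρ - d, ρ + d]`. -/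
def flankScale (G : ℂ → ℂ) (ρ d : ℝ) : ℝ := √(d * sumSq G (coreInterval ρ d) * ρ)

end

noncomputable section

open scoped ComplexConjugate

/-! Elements of L²(-π, π) are studied through the Paley–Wiener functions `pw f`. The values of `pw
f` on ℤ are the Fourier coefficients of f, hence an arbitrary square-summable sequence that
determines f, and orthogonality to a real exponential e^{ilt} means `pw f l = 0`. Up to a scalar the
biorthogonal element at l is F(z)/(z - l), with F entire, F(0) = 1, and simple zeros exactly at Λ.
Comparison with truncated products gives F = G e^{iαz} with α real
(`IsSineLike.exists_eq_mul_exp_I`), so γ_n = F(n) satisfies |γ_n| = |G(n)|. The sampling formula and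
the growth hypothesis on the imaginary axis then give Σ (-1)^n γ_n/(n - l) = 0 for all l ∈ Λ
(`exists_integer_values`).

The incomplete mixed system takes biorthogonal elements at a lacunary set of frequencies λ_k, k ∈ S,
and exponentials at all others. Here S consists of the large k whose core mass g_k is not
negligible, and λ_k lies in the flanking set of I_k. Put Q(x) = ∏ (1 - x/ρ_k)/(1 - x/λ_k). Partial
fractions carry the vanishing series from γ_n to γ_n Q(n), so the function g with g(n) = γ_n Q(n)
vanishes on Λ apart from the λ_k, while g(0) = 1 (`PoleChoice.exists_pw_eq_mul_quotient`). It lies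
in L² for three reasons. On a core |Q| is at most a constant times d_k/s_k, which costs (d_k/s_k)²
g_k = d_k/ρ_k. Near the poles an averaging choice of λ_k costs at most a multiple of s_k times the
mass of the flanking set (`exists_good_frequency`). Elsewhere Q is bounded, because the sequence is
lacunary and λ_k is taken left or right of ρ_k so as to keep ∏ λ_k/ρ_k bounded
(`exists_balanced_choice`, `exists_prod_ratioFactor_le`).

If the mixed system were complete, g would be a limit of combinations f of the biorthogonal elements
at the λ_k (`mem_closure_span_of_spansDensely`). Such an f has f(n) = γ_n R(n) with R(x) = Σ c_k/(x
- λ_k), and Lagrange interpolation recovers R(0) from the values of R at one integer y_k of each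
core, with coefficients O(s_k/ρ_k). Since (s_k/ρ_k)² = g_k d_k/ρ_k, choosing y_k where |R| is
smallest bounds |R(0)| by the energy of f on the cores plus Σ d_k/ρ_k
(`PoleChoice.norm_fraction_zero_le`). That energy is O(Σ d_k/ρ_k + ‖f - g‖²). Discarding finitely
many k makes the sum over S small, so f(0) cannot tend to g(0) = 1. -/

theorem HasSum.of_eq {ι α : Type*} [AddCommMonoid α] [TopologicalSpace α] {f g : ι → α} {a : α}
    (h : HasSum f a) (hfg : ∀ i, f i = g i) : HasSum g a :=
  funext hfg ▸ h

/-! ### The Paley–Wiener transform -/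

/-- The reference measure of `L2Interval`. -/
abbrev intervalMeasure : Measure ℝ := (volume : Measure ℝ).restrict (Set.Ioo (-Real.pi) Real.pi)

/-- The Paley–Wiener transform `z ↦ ∫ e^{-izt} f(t) dt` of `f ∈ L²(-π, π)`. -/
def pw (f : L2Interval) (z : ℂ) : ℂ := inner ℂ (exponential (conj z)) f

theorem coeFn_exponential (l : ℂ) :
    (exponential l : ℝ → ℂ) =ᵐ[intervalMeasure] fun t => Complex.exp (Complex.I * l * t) :=
  MemLp.coeFn_toLp _

theorem inner_exponential_eq_integral (l : ℂ) (f : L2Interval) :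
    inner ℂ (exponential l) f
      = ∫ t, Complex.exp (-(Complex.I * conj l * t)) * f t ∂intervalMeasure := by
  rw [MeasureTheory.L2.inner_def]
  refine integral_congr_ae ?_
  filter_upwards [coeFn_exponential l] with t ht
  rw [ht, RCLike.inner_apply, mul_comm, ← Complex.exp_conj]
  simp

theorem pw_eq_integral (f : L2Interval) (z : ℂ) :
    pw f z = ∫ t, Complex.exp (-(Complex.I * z * t)) * f t ∂intervalMeasure := by
  rw [pw, inner_exponential_eq_integral, Complex.conj_conj]

theorem pw_add (f g : L2Interval) (z : ℂ) : pw (f + g) z = pw f z + pw g z := inner_add_right _ _ _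

theorem pw_sub (f g : L2Interval) (z : ℂ) : pw (f - g) z = pw f z - pw g z := inner_sub_right _ _ _

theorem pw_smul (c : ℂ) (f : L2Interval) (z : ℂ) : pw (c • f) z = c * pw f z :=
  inner_smul_right _ _ _

theorem pw_zero (z : ℂ) : pw 0 z = 0 := inner_zero_right _

theorem inner_exponential_eq_pw {l : ℂ} (hl : l.im = 0) (f : L2Interval) :
    inner ℂ (exponential l) f = pw f l := by
  rw [pw, Complex.conj_eq_iff_im.2 hl]

theorem integrable_coeFn_L2Interval (f : L2Interval) : Integrable f intervalMeasure :=
  (Lp.memLp f).integrable (by norm_num)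

theorem norm_exp_neg_I_mul_le {z : ℂ} {t : ℝ} (ht : t ∈ Set.Ioo (-Real.pi) Real.pi) :
    ‖Complex.exp (-(Complex.I * z * t))‖ ≤ Real.exp (Real.pi * |z.im|) := by
  rw [Complex.norm_exp]
  apply Real.exp_le_exp.2
  have : (-(Complex.I * z * t)).re = z.im * t := by simp
  rw [this]
  calc z.im * t ≤ |z.im * t| := le_abs_self _
    _ = |t| * |z.im| := by rw [abs_mul, mul_comm]
    _ ≤ _ := by gcongr; exact abs_le.2 ⟨ht.1.le, ht.2.le⟩

theorem exists_norm_pw_le (f : L2Interval) :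
    ∃ C : ℝ, 0 < C ∧ ∀ z, ‖pw f z‖ ≤ C * Real.exp (Real.pi * |z.im|) := by
  refine ⟨(∫ t, ‖f t‖ ∂intervalMeasure) + 1, by positivity, fun z => ?_⟩
  rw [pw_eq_integral]
  calc _ ≤ ∫ t, Real.exp (Real.pi * |z.im|) * ‖f t‖ ∂intervalMeasure := by
        refine norm_integral_le_of_norm_le ((integrable_coeFn_L2Interval f).norm.const_mul _) ?_
        filter_upwards [ae_restrict_mem measurableSet_Ioo] with t ht
        rw [norm_mul]
        gcongr
        exact norm_exp_neg_I_mul_le ht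
    _ = (∫ t, ‖f t‖ ∂intervalMeasure) * Real.exp (Real.pi * |z.im|) := by
        rw [integral_const_mul, mul_comm]
    _ ≤ _ := by gcongr; linarith

theorem integrable_exp_mul (f : L2Interval) (z : ℂ) :
    Integrable (fun t : ℝ => Complex.exp (-(Complex.I * z * t)) * f t) intervalMeasure := by
  refine (integrable_coeFn_L2Interval f).bdd_mul (c := Real.exp (Real.pi * |z.im|))
    (Continuous.aestronglyMeasurable (by fun_prop)) ?_
  filter_upwards [ae_restrict_mem measurableSet_Ioo] with t ht using norm_exp_neg_I_mul_le ht

theorem differentiable_pw (f : L2Interval) : Differentiable ℂ (pw f) := by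
  intro z₀
  have hfun : pw f = fun z => ∫ t, Complex.exp (-(Complex.I * z * t)) * f t ∂intervalMeasure :=
    funext (pw_eq_integral f)
  rw [hfun]
  have key := hasDerivAt_integral_of_dominated_loc_of_deriv_le (μ := intervalMeasure)
    (F := fun z t => Complex.exp (-(Complex.I * z * t)) * f t)
    (F' := fun z t => Complex.exp (-(Complex.I * z * t)) * (-(Complex.I * t)) * f t)
    (bound := fun t => Real.exp (Real.pi * (|z₀.im| + 1)) * Real.pi * ‖f t‖)
    (x₀ := z₀) (Metric.ball_mem_nhds z₀ one_pos)
    (Eventually.of_forall fun z => (integrable_exp_mul f z).aestronglyMeasurable)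
    (integrable_exp_mul f z₀)
    ((Continuous.aestronglyMeasurable (by fun_prop)).mul
      (integrable_coeFn_L2Interval f).aestronglyMeasurable)
    ?_ ((integrable_coeFn_L2Interval f).norm.const_mul _) ?_
  · exact key.2.differentiableAt
  · filter_upwards [ae_restrict_mem measurableSet_Ioo] with t ht z hz
    rw [norm_mul, norm_mul]
    have h1 : ‖-(Complex.I * (t : ℂ))‖ ≤ Real.pi := by
      simpa using abs_le.2 ⟨ht.1.le, ht.2.le⟩
    have h2 : |z.im| ≤ |z₀.im| + 1 := by
      have : |(z - z₀).im| ≤ 1 := (Complex.abs_im_le_norm _).trans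
        (by simpa [dist_eq_norm] using (Metric.mem_ball.1 hz).le)
      rw [Complex.sub_im] at this
      linarith [abs_sub_abs_le_abs_sub z.im z₀.im]
    gcongr
    exact (norm_exp_neg_I_mul_le ht).trans (by gcongr)
  · refine Eventually.of_forall fun t z _ => ?_
    have : HasDerivAt (fun z : ℂ => -(Complex.I * z * t)) (-(Complex.I * t)) z := by
      have := (((hasDerivAt_id z).const_mul Complex.I).mul_const (t : ℂ)).fun_neg
      simpa using this
    exact (this.cexp).mul_const _

/-! ### Division of a zero -/

/-- Integration by parts against the primitive of `k`, obtained from Fubini on the triangle s < t;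
integrability of `k` is enough. -/
theorem integral_deriv_mul_primitive {k : ℝ → ℂ} (hk : Integrable k intervalMeasure)
    {φ φ' : ℝ → ℂ} (hφ : ∀ t, HasDerivAt φ (φ' t) t) (hφ' : Continuous φ') :
    ∫ t, φ' t * (∫ s, (Set.Iio t).indicator k s ∂intervalMeasure) ∂intervalMeasure
      = φ Real.pi * (∫ s, k s ∂intervalMeasure) - ∫ s, φ s * k s ∂intervalMeasure := by
  have hφ'i : Integrable φ' intervalMeasure :=
    (hφ'.integrableOn_Icc (a := -Real.pi) (b := Real.pi)).mono_set Set.Ioo_subset_Icc_self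
  have hφc : Continuous φ := continuous_iff_continuousAt.2 fun t => (hφ t).continuousAt
  have hint : Integrable (Function.uncurry fun t s => φ' t * (Set.Iio t).indicator k s)
      (intervalMeasure.prod intervalMeasure) := by
    have h1 := (hφ'i.mul_prod hk).indicator
      (measurableSet_lt measurable_snd measurable_fst : MeasurableSet {p : ℝ × ℝ | p.2 < p.1})
    refine h1.congr (Eventually.of_forall fun p => ?_)
    by_cases h : p.2 < p.1 <;> simp [Function.uncurry, Set.indicator, h]
  have step1 : ∀ t, φ' t * (∫ s, (Set.Iio t).indicator k s ∂intervalMeasure)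
      = ∫ s, φ' t * (Set.Iio t).indicator k s ∂intervalMeasure := fun t =>
    (integral_const_mul _ _).symm
  simp_rw [step1]
  rw [integral_integral_swap hint]
  have step2 : ∀ s ∈ Set.Ioo (-Real.pi) Real.pi,
      ∫ t, φ' t * (Set.Iio t).indicator k s ∂intervalMeasure = φ Real.pi * k s - φ s * k s := by
    intro s hs
    have : ∀ t, φ' t * (Set.Iio t).indicator k s = (Set.Ioi s).indicator φ' t * k s := by
      intro t
      by_cases h : s < t <;> simp [Set.indicator, h]
    simp_rw [this]
    rw [integral_mul_const, ← sub_mul]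
    congr 1
    rw [integral_indicator measurableSet_Ioi, Measure.restrict_restrict measurableSet_Ioi]
    have hset : Set.Ioi s ∩ Set.Ioo (-Real.pi) Real.pi = Set.Ioo s Real.pi := by
      ext x
      simp only [Set.mem_inter_iff, Set.mem_Ioi, Set.mem_Ioo]
      constructor
      · rintro ⟨h1, h2, h3⟩; exact ⟨h1, h3⟩
      · rintro ⟨h1, h3⟩; exact ⟨h1, hs.1.trans h1, h3⟩
    rw [hset, ← integral_Ioc_eq_integral_Ioo, ← intervalIntegral.integral_of_le hs.2.le]
    exact intervalIntegral.integral_eq_sub_of_hasDerivAt (fun x _ => hφ x)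
      (hφ'.intervalIntegrable _ _)
  rw [setIntegral_congr_fun measurableSet_Ioo step2, integral_sub, integral_const_mul]
  · exact hk.const_mul _
  · obtain ⟨C, hC⟩ := (isCompact_Icc (a := -Real.pi) (b := Real.pi)).exists_bound_of_continuousOn
      hφc.continuousOn
    refine hk.bdd_mul (c := C) hφc.aestronglyMeasurable ?_
    filter_upwards [ae_restrict_mem measurableSet_Ioo] with t ht using
      hC t (Set.Ioo_subset_Icc_self ht)

/-- A zero of a Paley–Wiener function can be divided out. -/
theorem exists_pw_div {f : L2Interval} {m : ℂ} (hm : pw f m = 0) :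
    ∃ g : L2Interval, ∀ z, (z - m) * pw g z = pw f z := by
  set k : ℝ → ℂ := fun s => Complex.exp (-(Complex.I * m * s)) * f s with hkdef
  have hk : Integrable k intervalMeasure := integrable_exp_mul f m
  set K : ℝ → ℂ := fun t => ∫ s, (Set.Iio t).indicator k s ∂intervalMeasure with hK
  have hKm : AEStronglyMeasurable K intervalMeasure := by
    have hint : Integrable (Function.uncurry fun t s => (Set.Iio t).indicator k s)
        (intervalMeasure.prod intervalMeasure) := by
      have h1 := ((integrable_const (1 : ℂ)).mul_prod hk (μ := intervalMeasure)).indicator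
        (measurableSet_lt measurable_snd measurable_fst : MeasurableSet {p : ℝ × ℝ | p.2 < p.1})
      refine h1.congr (Eventually.of_forall fun p => ?_)
      by_cases h : p.2 < p.1 <;> simp [Function.uncurry, Set.indicator, h]
    exact hint.integral_prod_left.aestronglyMeasurable
  have hKb : ∀ t, ‖K t‖ ≤ ∫ s, ‖k s‖ ∂intervalMeasure := by
    intro t
    refine norm_integral_le_of_norm_le hk.norm (Eventually.of_forall fun s => ?_)
    exact norm_indicator_le_norm_self _ _
  -- Division by z - m amounts to solving a first order linear equation on the interval. Integration
  -- by parts shows that this solution works: its boundary term at π is a multiple of `pw f m`,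
  -- which is zero.
  set G : ℝ → ℂ := fun t => Complex.I * (Complex.exp (Complex.I * m * t) * K t) with hG
  have hGmem : MemLp G 2 intervalMeasure := by
    refine MemLp.of_bound (C := Real.exp (Real.pi * |(-m).im|) * ∫ s, ‖k s‖ ∂intervalMeasure) ?_ ?_
    · exact (((Continuous.aestronglyMeasurable (by fun_prop)).mul hKm).const_mul _)
    · filter_upwards [ae_restrict_mem measurableSet_Ioo] with t ht
      rw [hG]
      simp only [norm_mul, Complex.norm_I, one_mul]
      gcongr
      · have := norm_exp_neg_I_mul_le (z := -m) ht
        simpa using this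
      · exact hKb t
  refine ⟨hGmem.toLp G, fun z => ?_⟩
  have e1 : pw (hGmem.toLp G) z
      = ∫ t, Complex.exp (-(Complex.I * z * t)) * G t ∂intervalMeasure := by
    rw [pw_eq_integral]
    refine integral_congr_ae ?_
    filter_upwards [hGmem.coeFn_toLp] with t ht
    rw [ht]
  rw [e1, ← integral_const_mul]
  set φ : ℝ → ℂ := fun t => Complex.exp (-(Complex.I * (z - m) * t)) with hφ
  set φ' : ℝ → ℂ := fun t => Complex.exp (-(Complex.I * (z - m) * t)) * (-(Complex.I * (z - m)))
    with hφ'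
  have hder : ∀ t, HasDerivAt φ (φ' t) t := by
    intro t
    have h0 : HasDerivAt (fun t : ℝ => -(Complex.I * (z - m) * (t : ℂ)))
        (-(Complex.I * (z - m))) t := by
      have := ((Complex.ofRealCLM.hasDerivAt (x := t)).const_mul (Complex.I * (z - m))).fun_neg
      simpa using this
    exact h0.cexp
  have hmain := integral_deriv_mul_primitive hk hder (by fun_prop)
  have hk0 : ∫ s, k s ∂intervalMeasure = 0 := by rw [← hm, pw_eq_integral]
  rw [hk0, mul_zero, zero_sub] at hmain
  have e2 : ∀ t : ℝ, (z - m) * (Complex.exp (-(Complex.I * z * t)) * G t) = -(φ' t * K t) := by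
    intro t
    have : Complex.exp (-(Complex.I * (z - m) * t))
        = Complex.exp (-(Complex.I * z * t)) * Complex.exp (Complex.I * m * t) := by
      rw [← Complex.exp_add]; congr 1; ring
    simp only [hφ', hG, this]
    ring
  have e3 : ∀ t : ℝ, φ t * k t = Complex.exp (-(Complex.I * z * t)) * f t := by
    intro t
    have : Complex.exp (-(Complex.I * z * t))
        = Complex.exp (-(Complex.I * (z - m) * t)) * Complex.exp (-(Complex.I * m * t)) := by
      rw [← Complex.exp_add]; congr 1; ring
    simp only [hφ, hkdef, this]
    ring
  simp_rw [e2]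
  rw [integral_neg, hmain, neg_neg, pw_eq_integral]
  simp_rw [e3]

/-! ### The integer exponentials -/

theorem inner_exponential_int (m : ℂ) (n : ℤ) :
    inner ℂ (exponential m) (exponential (n : ℂ))
      = ∫ t in (-Real.pi)..Real.pi, Complex.exp ((n - conj m) * Complex.I * t) := by
  rw [inner_exponential_eq_integral, intervalIntegral.integral_of_le (by linarith [Real.pi_pos]),
    integral_Ioc_eq_integral_Ioo]
  refine integral_congr_ae ?_
  filter_upwards [coeFn_exponential (n : ℂ)] with t ht
  rw [ht, ← Complex.exp_add]
  congr 1
  ring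

theorem integral_exp_mul_I {c : ℂ} (hc : c ≠ 0) :
    ∫ t in (-Real.pi)..Real.pi, Complex.exp (c * Complex.I * t)
      = 2 * Complex.sin (Real.pi * c) / c := by
  rw [integral_exp_mul_complex (mul_ne_zero hc Complex.I_ne_zero), Complex.sin]
  have : Complex.I ≠ 0 := Complex.I_ne_zero
  field_simp
  rw [Complex.I_sq]
  push_cast
  ring_nf

/-- The cardinal sine values `∫ e^{i(n-z)t} dt` over `(-π, π)`. -/
theorem pw_exponential_int_of_ne {z : ℂ} {n : ℤ} (h : z ≠ n) :
    pw (exponential (n : ℂ)) z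
      = 2 * (-1) ^ n * Complex.sin (Real.pi * z) / (z - n) := by
  have hne : (n : ℂ) - z ≠ 0 := sub_ne_zero.2 h.symm
  have hne' : z - (n : ℂ) ≠ 0 := sub_ne_zero.2 h
  rw [pw, inner_exponential_int, Complex.conj_conj, integral_exp_mul_I hne]
  have : Complex.sin (Real.pi * ((n : ℂ) - z)) = -((-1) ^ n * Complex.sin (Real.pi * z)) := by
    have := Complex.sin_antiperiodic.sub_int_mul_eq (x := Real.pi * z) n
    rw [← neg_eq_iff_eq_neg, ← Complex.sin_neg]
    rw [show -((Real.pi : ℂ) * (n - z)) = Real.pi * z - n * Real.pi by ring, this,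
      Int.cast_negOnePow]
  rw [this]
  rw [div_eq_div_iff hne hne']
  ring

theorem pw_exponential_int (m n : ℤ) :
    pw (exponential (n : ℂ)) m = if m = n then 2 * (Real.pi : ℂ) else 0 := by
  split_ifs with h
  · subst h
    rw [pw, inner_exponential_int]
    simp
    ring
  · rw [pw_exponential_int_of_ne (by exact_mod_cast h)]
    rw [show (Real.pi : ℂ) * (m : ℂ) = m * Real.pi by ring, Complex.sin_int_mul_pi]
    simp

/-- The integer values are, up to a constant, the Fourier coefficients, so Parseval applies. -/
theorem eq_zero_of_pw_int_eq_zero {f : L2Interval} (h : ∀ n : ℤ, pw f n = 0) : f = 0 := by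
  have hab : -Real.pi < Real.pi := by linarith [Real.pi_pos]
  have hmem : MemLp f 2 (volume.restrict (Set.Ioc (-Real.pi) Real.pi)) := by
    rw [Measure.restrict_congr_set (Ioo_ae_eq_Ioc).symm]
    exact Lp.memLp f
  have hsum := hasSum_sq_fourierCoeffOn hab hmem
  have hzero : ∀ n : ℤ, fourierCoeffOn hab f n = 0 := by
    intro n
    rw [fourierCoeffOn_eq_integral]
    have h2 := h n
    rw [pw_eq_integral] at h2
    rw [intervalIntegral.integral_of_le hab.le, integral_Ioc_eq_integral_Ioo]
    have : ∫ x in Set.Ioo (-Real.pi) Real.pi,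
        (fourier (-n) : AddCircle (Real.pi - -Real.pi) → ℂ)
          (x : AddCircle (Real.pi - -Real.pi)) • f x
        = ∫ t, Complex.exp (-(Complex.I * n * t)) * f t ∂intervalMeasure := by
      refine integral_congr_ae (Eventually.of_forall fun t => ?_)
      simp only [fourier_coe_apply, smul_eq_mul]
      congr 2
      have : (Real.pi : ℂ) ≠ 0 := by exact_mod_cast Real.pi_ne_zero
      push_cast
      field_simp
      ring
    rw [this, h2, smul_zero]
  simp only [hzero, norm_zero, ne_eq, OfNat.ofNat_ne_zero, not_false_eq_true, zero_pow] at hsum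
  have h0 := hsum.unique hasSum_zero
  rw [smul_eq_mul, mul_eq_zero, or_iff_right (by
    apply inv_ne_zero; linarith [Real.pi_pos]),
    intervalIntegral.integral_of_le hab.le, integral_Ioc_eq_integral_Ioo] at h0
  have hint : Integrable (fun x => ‖f x‖ ^ 2) intervalMeasure :=
    (memLp_two_iff_integrable_sq_norm (Lp.memLp f).aestronglyMeasurable).1 (Lp.memLp f)
  rw [integral_eq_zero_iff_of_nonneg (fun _ => by positivity) hint] at h0
  rw [Lp.eq_zero_iff_ae_eq_zero]
  filter_upwards [h0] with t ht
  simpa using ht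

theorem sqrt_two_pi_sq : ((√(2 * Real.pi) : ℝ) : ℂ) * (√(2 * Real.pi) : ℝ) = 2 * Real.pi := by
  rw [← Complex.ofReal_mul, Real.mul_self_sqrt (by positivity)]
  push_cast
  rfl

theorem sqrt_two_pi_ne_zero : ((√(2 * Real.pi) : ℝ) : ℂ) ≠ 0 := by
  have : 0 < √(2 * Real.pi) := Real.sqrt_pos.2 (by positivity)
  exact_mod_cast this.ne'

theorem inner_exponential_int_left (n : ℤ) (f : L2Interval) :
    inner ℂ (exponential (n : ℂ)) f = pw f n := inner_exponential_eq_pw (by simp) f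

theorem orthonormal_exponential_int :
    Orthonormal ℂ fun n : ℤ => ((√(2 * Real.pi) : ℝ) : ℂ)⁻¹ • exponential (n : ℂ) := by
  rw [orthonormal_iff_ite]
  intro i j
  rw [inner_smul_left, inner_smul_right, inner_exponential_int_left, pw_exponential_int]
  have h1 := sqrt_two_pi_sq
  have h2 := sqrt_two_pi_ne_zero
  split_ifs with h
  · rw [← h1, map_inv₀, Complex.conj_ofReal]
    field_simp
  · simp

/-- The normalized integer exponentials as a Hilbert basis of `L²(-π, π)`. -/
def exponentialBasis : HilbertBasis ℤ ℂ L2Interval :=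
  HilbertBasis.mkOfOrthogonalEqBot orthonormal_exponential_int (by
    rw [Submodule.eq_bot_iff]
    intro f hf
    refine eq_zero_of_pw_int_eq_zero fun n => ?_
    have := (Submodule.mem_orthogonal _ f).1 hf _ (Submodule.subset_span (Set.mem_range_self n))
    rw [inner_smul_left, inner_exponential_int_left] at this
    simpa [Real.pi_ne_zero, Real.sqrt_eq_zero', Real.pi_pos.not_ge] using this)

theorem exponentialBasis_apply (n : ℤ) :
    exponentialBasis n = ((√(2 * Real.pi) : ℝ) : ℂ)⁻¹ • exponential (n : ℂ) := by
  simp [exponentialBasis]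

theorem inner_exponentialBasis (n : ℤ) (f : L2Interval) :
    inner ℂ (exponentialBasis n) f = ((√(2 * Real.pi) : ℝ) : ℂ)⁻¹ * pw f n := by
  rw [exponentialBasis_apply, inner_smul_left, inner_exponential_int_left, map_inv₀,
    Complex.conj_ofReal]

/-- Expansion of Paley–Wiener functions along the integers. -/
theorem hasSum_pw (f : L2Interval) (z : ℂ) :
    HasSum (fun n : ℤ => pw f n * pw (exponential (n : ℂ)) z) (2 * Real.pi * pw f z) := by
  have h := (exponentialBasis.hasSum_inner_mul_inner (exponential (conj z)) f).mul_left
    (2 * (Real.pi : ℂ))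
  refine h.of_eq fun n => ?_
  rw [inner_exponentialBasis, exponentialBasis_apply, inner_smul_right, ← sqrt_two_pi_sq, pw, pw]
  have h2 := sqrt_two_pi_ne_zero
  field_simp

/-- The sampling formula off the integers. -/
theorem hasSum_sampling (f : L2Interval) {z : ℂ} (hz : ∀ n : ℤ, z ≠ n) :
    HasSum (fun n : ℤ => (-1) ^ n * pw f n / (z - n))
      (Real.pi * pw f z / Complex.sin (Real.pi * z)) := by
  have hs : Complex.sin (Real.pi * z) ≠ 0 := by
    rw [Complex.sin_ne_zero_iff]
    intro k hk
    have : (Real.pi : ℂ) ≠ 0 := by exact_mod_cast Real.pi_ne_zero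
    exact hz k (mul_left_cancel₀ this (hk.trans (mul_comm _ _)))
  have h := (hasSum_pw f z).mul_left ((2 * Complex.sin (Real.pi * z))⁻¹)
  have e : (Real.pi : ℂ) * pw f z / Complex.sin (Real.pi * z)
      = (2 * Complex.sin (Real.pi * z))⁻¹ * (2 * Real.pi * pw f z) := by
    rw [mul_inv]
    ring
  rw [e]
  refine h.of_eq fun n => ?_
  rw [pw_exponential_int_of_ne (hz n)]
  have := sub_ne_zero.2 (hz n)
  generalize Complex.sin (Real.pi * z) = S at *
  field_simp

theorem hasSum_norm_sq_pw (f : L2Interval) :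
    HasSum (fun n : ℤ => ‖pw f n‖ ^ 2) (2 * Real.pi * ‖f‖ ^ 2) := by
  have h := exponentialBasis.hasSum_inner_mul_inner f f
  have h1 : ∀ n : ℤ, inner ℂ f (exponentialBasis n) * inner ℂ (exponentialBasis n) f
      = (((2 * Real.pi)⁻¹ * ‖pw f n‖ ^ 2 : ℝ) : ℂ) := by
    intro n
    rw [← inner_conj_symm, inner_exponentialBasis, Complex.conj_mul', norm_mul, norm_inv,
      Complex.norm_real, Real.norm_eq_abs, abs_of_nonneg (Real.sqrt_nonneg _), ← Complex.ofReal_pow,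
      mul_pow, inv_pow, Real.sq_sqrt (by positivity)]
  simp_rw [h1] at h
  rw [inner_self_eq_norm_sq_to_K] at h
  have h2 : HasSum (fun n : ℤ => (2 * Real.pi)⁻¹ * ‖pw f n‖ ^ 2) (‖f‖ ^ 2) := by
    have h' : HasSum (fun n : ℤ => (((2 * Real.pi)⁻¹ * ‖pw f n‖ ^ 2 : ℝ) : ℂ))
        ((‖f‖ ^ 2 : ℝ) : ℂ) := by
      rw [Complex.ofReal_pow]
      exact h
    exact Complex.hasSum_ofReal.1 h'
  have h3 := h2.mul_left (2 * Real.pi)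
  refine h3.of_eq fun n => ?_
  rw [mul_inv_cancel_left₀ (by positivity)]

/-- Riesz–Fischer for the integer exponentials; this is how the function orthogonal to most
exponentials is constructed. -/
theorem exists_pw_int_eq {a : ℤ → ℂ} (ha : Summable fun n => ‖a n‖ ^ 2) :
    ∃ f : L2Interval, ∀ n : ℤ, pw f n = a n := by
  have hmem : Memℓp (fun n => ((√(2 * Real.pi) : ℝ) : ℂ)⁻¹ * a n) 2 := by
    rw [memℓp_gen_iff (by norm_num)]
    have := ha.mul_left (‖((√(2 * Real.pi) : ℝ) : ℂ)⁻¹‖ ^ 2)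
    refine (summable_congr fun n => ?_).mp this
    rw [norm_mul]
    simp [mul_pow]
  refine ⟨exponentialBasis.repr.symm ⟨_, hmem⟩, fun n => ?_⟩
  have h1 := exponentialBasis.repr_apply_apply (exponentialBasis.repr.symm ⟨_, hmem⟩) n
  rw [LinearIsometryEquiv.apply_symm_apply, inner_exponentialBasis] at h1
  exact (mul_left_cancel₀ (inv_ne_zero sqrt_two_pi_ne_zero) h1).symm

/-! ### Biorthogonal systems -/

theorem SpansDensely.eq_zero_of_inner_eq_zero {H : Type*} [NormedAddCommGroup H]
    [InnerProductSpace ℂ H] [CompleteSpace H] {S : Set H} (h : SpansDensely S) {u : H}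
    (hu : ∀ s ∈ S, inner ℂ s u = 0) : u = 0 := by
  rw [SpansDensely, Submodule.topologicalClosure_eq_top_iff, Submodule.eq_bot_iff] at h
  refine h u ((Submodule.mem_orthogonal _ u).2 fun x hx => ?_)
  induction hx using Submodule.span_induction with
  | mem x hx => exact hu x hx
  | zero => exact inner_zero_left _
  | add x y _ _ hx hy => rw [inner_add_left, hx, hy, add_zero]
  | smul c x _ hx => rw [inner_smul_left, hx, mul_zero]

theorem IsCompleteMinimal.eq_zero_of_inner_eq_zero {ι H : Type*} [NormedAddCommGroup H]
    [InnerProductSpace ℂ H] [CompleteSpace H] {v : ι → H} (h : IsCompleteMinimal v) {u : H}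
    (hu : ∀ n, inner ℂ (v n) u = 0) : u = 0 :=
  h.1.eq_zero_of_inner_eq_zero (by rintro _ ⟨n, rfl⟩; exact hu n)

/-- By minimality some nonzero vector is orthogonal to every `v n` with n ≠ m. By completeness it is
not orthogonal to `v m`, so it can be normalized. -/
theorem IsCompleteMinimal.exists_isBiorthogonal {ι H : Type*} [NormedAddCommGroup H]
    [InnerProductSpace ℂ H] [CompleteSpace H] {v : ι → H} (h : IsCompleteMinimal v) :
    ∃ w : ι → H, IsBiorthogonal v w := by
  have key : ∀ m, ∃ u : H, inner ℂ (v m) u = 1 ∧ ∀ n, n ≠ m → inner ℂ (v n) u = 0 := by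
    intro m
    have hm := h.2 m
    rw [SpansDensely, Submodule.topologicalClosure_eq_top_iff, Submodule.eq_bot_iff] at hm
    push Not at hm
    obtain ⟨u, hu, hu0⟩ := hm
    have hun : ∀ n, n ≠ m → inner ℂ (v n) u = 0 := fun n hn =>
      (Submodule.mem_orthogonal _ u).1 hu _ (Submodule.subset_span ⟨n, hn, rfl⟩)
    have hne : inner ℂ (v m) u ≠ 0 := by
      intro h0
      refine hu0 (h.eq_zero_of_inner_eq_zero ?_)
      intro n
      by_cases hn : n = m
      · rw [hn, h0]
      · exact hun n hn
    refine ⟨(inner ℂ (v m) u)⁻¹ • u, ?_, fun n hn => ?_⟩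
    · rw [inner_smul_right, inv_mul_cancel₀ hne]
    · rw [inner_smul_right, hun n hn, mul_zero]
  choose w hw using key
  exact ⟨w, fun n => (hw n).1, fun n m hnm => (hw m).2 n hnm⟩


/-! ### Logarithms of zero-free functions on discs -/

theorem exists_log_on_ball {H : ℂ → ℂ} {R : ℝ} (hR : 0 < R)
    (hH : DifferentiableOn ℂ H (Metric.ball 0 R)) (hne : ∀ z ∈ Metric.ball (0 : ℂ) R, H z ≠ 0) :
    ∃ g : ℂ → ℂ, g 0 = Complex.log (H 0) ∧ ∀ z ∈ Metric.ball (0 : ℂ) R,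
      HasDerivAt g (deriv H z / H z) z ∧ Complex.exp (g z) = H z := by
  have hd : DifferentiableOn ℂ (fun z => deriv H z / H z) (Metric.ball 0 R) :=
    (hH.deriv Metric.isOpen_ball).div hH hne
  obtain ⟨g, hg0, hg⟩ := hd.isExactOn_ball.with_val_at 0 (Complex.log (H 0))
  refine ⟨g, hg0, fun z hz => ⟨hg z hz, ?_⟩⟩
  have hder : ∀ z ∈ Metric.ball (0 : ℂ) R,
      HasDerivAt (fun z => H z * Complex.exp (-g z)) 0 z := by
    intro z hz
    have h1 := (hH.differentiableAt (Metric.isOpen_ball.mem_nhds hz)).hasDerivAt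
    have h2 := (hg z hz).fun_neg.cexp
    refine (h1.fun_mul h2).congr_deriv ?_
    have := hne z hz
    field_simp
    ring
  have hconst := Metric.isOpen_ball.is_const_of_deriv_eq_zero (convex_ball (0 : ℂ) R).isPreconnected
    (fun z hz => (hder z hz).differentiableAt.differentiableWithinAt)
    (fun z hz => (hder z hz).deriv) hz (Metric.mem_ball_self hR)
  rw [hg0, Complex.exp_neg, Complex.exp_neg, Complex.exp_log (hne 0 (Metric.mem_ball_self hR)),
    mul_inv_cancel₀ (hne 0 (Metric.mem_ball_self hR)), mul_inv_eq_one₀ (Complex.exp_ne_zero _)]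
    at hconst
  exact hconst.symm

/-- A zero-free function of exponential growth is close to an exponential near the centre. -/
theorem zeroFree_near_exponential {H : ℂ → ℂ} {R C : ℝ} (hR : 0 < R) (hC : 0 < C)
    (hH : DifferentiableOn ℂ H (Metric.ball 0 R)) (hne : ∀ z ∈ Metric.ball (0 : ℂ) R, H z ≠ 0)
    (h0 : H 0 = 1) (hb : ∀ z ∈ Metric.ball (0 : ℂ) R, ‖H z‖ ≤ Real.exp (C * R))
    {z : ℂ} (hz : 8 * ‖z‖ ≤ R) :
    ‖deriv H z / H z - deriv H 0 / H 0‖ ≤ 128 * C * ‖z‖ / R ∧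
    ∃ e : ℂ, ‖e‖ ≤ 16 * C * ‖z‖ ^ 2 / R ∧ H z = Complex.exp (deriv H 0 / H 0 * z + e) := by
  obtain ⟨g, hg0, hg⟩ := exists_log_on_ball hR hH hne
  rw [h0, Complex.log_one] at hg0
  have hgd : DifferentiableOn ℂ g (Metric.ball 0 R) := fun z hz =>
    (hg z hz).1.differentiableAt.differentiableWithinAt
  have hgb : ∀ z ∈ Metric.ball (0 : ℂ) (R / 2), ‖g z‖ ≤ 2 * C * R := by
    intro z hz
    have hzR : z ∈ Metric.ball (0 : ℂ) R := Metric.ball_subset_ball (by linarith) hz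
    -- The growth of H bounds only the real part of its logarithm; Borel–Carathéodory turns this
    -- into a bound for the modulus, after which Schwarz-type estimates control the derivative and
    -- the remainder of order two.
    have h1 := Complex.borelCaratheodory_zero (M := C * R) (by positivity) hgd
      (fun x hx => by
        have h2 := hb x hx
        rw [← (hg x hx).2, Complex.norm_exp] at h2
        exact Real.exp_le_exp.1 h2) hR hzR hg0
    have hz2 : ‖z‖ < R / 2 := by simpa using hz
    refine h1.trans ?_
    rw [div_le_iff₀ (by linarith)]
    have : 0 < C * R := by positivity
    nlinarith
  have hsub2 : Metric.ball (0 : ℂ) (R / 2) ⊆ Metric.ball 0 R :=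
    Metric.ball_subset_ball (by linarith)
  have h0mem : (0 : ℂ) ∈ Metric.ball (0 : ℂ) R := Metric.mem_ball_self hR
  have hd0 : ‖deriv g 0‖ ≤ 4 * C := by
    have := Complex.norm_deriv_le_div_of_mapsTo_ball (c := 0) (R₁ := R / 2) (R₂ := 2 * C * R)
      (hgd.mono hsub2) (fun x hx => by simpa [hg0] using hgb x hx) (by linarith)
    refine this.trans (le_of_eq ?_)
    field_simp
    norm_num
  have hzR2 : z ∈ Metric.ball (0 : ℂ) (R / 2) := by
    simp only [Metric.mem_ball, dist_zero_right]
    linarith [norm_nonneg z]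
  constructor
  · have hdb : ∀ x ∈ Metric.ball (0 : ℂ) (R / 4), ‖deriv g x‖ ≤ 16 * C := by
      intro x hx
      have hsub : Metric.ball x (R / 4) ⊆ Metric.ball 0 (R / 2) := by
        intro y hy
        have h1 : dist y x < R / 4 := hy
        have h2 : dist x 0 < R / 4 := hx
        have := dist_triangle y x 0
        simp only [Metric.mem_ball]
        linarith
      have := Complex.norm_deriv_le_div_of_mapsTo_ball (c := x) (R₁ := R / 4) (R₂ := 4 * C * R)
        (hgd.mono (hsub.trans hsub2)) (fun y hy => by
          rw [Metric.mem_closedBall, dist_eq_norm]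
          refine (norm_sub_le _ _).trans ?_
          have h1 := hgb y (hsub hy)
          have h2 := hgb x (hsub (Metric.mem_ball_self (by linarith)))
          linarith) (by linarith)
      refine this.trans (le_of_eq ?_)
      field_simp
      norm_num
    have hsub4 : Metric.ball (0 : ℂ) (R / 4) ⊆ Metric.ball 0 R :=
      Metric.ball_subset_ball (by linarith)
    have h4 : (0 : ℂ) ∈ Metric.ball (0 : ℂ) (R / 4) := Metric.mem_ball_self (by linarith)
    have := Complex.dist_le_div_mul_dist_of_mapsTo_ball (f := deriv g) (c := 0) (z := z)
      (R₁ := R / 4) (R₂ := 32 * C)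
      ((hgd.deriv Metric.isOpen_ball).mono hsub4) (fun y hy => by
          rw [Metric.mem_closedBall, dist_eq_norm]
          refine (norm_sub_le _ _).trans ?_
          linarith [hdb y hy, hdb 0 h4]) (by
        simp only [Metric.mem_ball, dist_zero_right]
        linarith [norm_nonneg z])
    rw [dist_eq_norm, dist_zero_right, (hg z (hsub2 hzR2)).1.deriv, (hg 0 h0mem).1.deriv] at this
    refine this.trans (le_of_eq ?_)
    field_simp
    ring
  · refine ⟨g z - deriv g 0 * z, ?_, ?_⟩
    · have hk0 : HasDerivAt (fun z => g z - deriv g 0 * z) 0 0 := by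
        have h1 := (hg 0 h0mem).1.differentiableAt.hasDerivAt
        have h2 := (hasDerivAt_id (0 : ℂ)).const_mul (deriv g 0)
        have := h1.fun_sub h2
        simpa using this
      have := Complex.dist_le_mul_div_pow_of_mapsTo_ball_of_isLittleO
        (f := fun z => g z - deriv g 0 * z) (c := 0) (z := z) (R₁ := R / 2) (R₂ := 4 * C * R)
        (n := 1) ((hgd.mono hsub2).sub ((differentiableOn_id).const_mul _)) (fun y hy => by
          simp only [hg0, mul_zero, sub_zero, Metric.mem_closedBall, dist_zero_right]
          refine (norm_sub_le _ _).trans ?_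
          rw [norm_mul]
          have hy2 : ‖y‖ < R / 2 := by simpa using hy
          have := mul_le_mul hd0 hy2.le (norm_nonneg _) (by positivity)
          have := hgb y hy
          linarith) (by
          have := hk0.isLittleO
          simp only [hg0, mul_zero, sub_zero, smul_zero] at this
          simpa [hg0] using this.norm_right) hzR2
      simp only [hg0, mul_zero, sub_zero, dist_zero_right] at this
      refine this.trans (le_of_eq ?_)
      rw [div_pow, div_pow]
      field_simp
      ring
    · rw [← (hg 0 h0mem).1.deriv, add_sub_cancel, (hg z (hsub2 hzR2)).2]

/-! ### Division by finitely many simple zeros -/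

theorem exists_eq_prod_mul {F : ℂ → ℂ} (hF : Differentiable ℂ F) (s : Finset ℂ)
    (hs : ∀ l ∈ s, F l = 0 ∧ l ≠ 0) :
    ∃ H : ℂ → ℂ, Differentiable ℂ H ∧ ∀ z, F z = (∏ l ∈ s, (1 - z / l)) * H z := by
  classical
  induction s using Finset.induction_on with
  | empty => exact ⟨F, hF, by simp⟩
  | insert l s hl ih =>
    obtain ⟨H, hH, hFH⟩ := ih fun l hl => hs l (Finset.mem_insert_of_mem hl)
    obtain ⟨hl0, hlne⟩ := hs l (Finset.mem_insert_self l s)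
    have hHl : H l = 0 := by
      have := hFH l
      rw [hl0] at this
      refine (mul_eq_zero.1 this.symm).resolve_left (Finset.prod_ne_zero_iff.2 fun m hm h => ?_)
      have hm0 := (hs m (Finset.mem_insert_of_mem hm)).2
      rw [sub_eq_zero, eq_comm, div_eq_one_iff_eq hm0] at h
      exact hl (h ▸ hm)
    refine ⟨fun z => -l * dslope H l z, ?_, fun z => ?_⟩
    · refine Differentiable.const_mul ?_ _
      rw [← differentiableOn_univ, Complex.differentiableOn_dslope univ_mem]
      exact hH.differentiableOn
    · have h1 : (z - l) • dslope H l z = H z - H l := sub_smul_dslope H l z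
      rw [hHl, sub_zero, smul_eq_mul] at h1
      rw [Finset.prod_insert hl, hFH z, ← h1]
      field_simp
      ring

/-- A common zero of the product and of the cofactor would be a multiple zero of F. -/
theorem ne_zero_of_eq_prod_mul {F H : ℂ → ℂ} (hH : Differentiable ℂ H) {s : Finset ℂ}
    (hs : ∀ l ∈ s, l ≠ 0 ∧ deriv F l ≠ 0)
    (hFH : ∀ z, F z = (∏ l ∈ s, (1 - z / l)) * H z) {z : ℂ} (hz : F z = 0 → z ∈ s) :
    H z ≠ 0 := by
  intro h
  have hFz : F z = 0 := by rw [hFH z, h, mul_zero]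
  have hzs := hz hFz
  refine (hs z hzs).2 ?_
  have hP : Differentiable ℂ fun z : ℂ => ∏ l ∈ s, (1 - z / l) := by fun_prop
  have hfun : F = fun z => (∏ l ∈ s, (1 - z / l)) * H z := funext hFH
  have hP0 : (∏ l ∈ s, (1 - z / l)) = 0 :=
    Finset.prod_eq_zero hzs (by rw [div_self (hs z hzs).1, sub_self])
  rw [hfun, ((hP z).hasDerivAt.fun_mul (hH z).hasDerivAt).deriv, hP0, h]
  simp


/-! ### Entire functions of exponential type with real simple zeros -/

/-- `F` is an entire function with `F 0 = 1`, whose zeros are simple, real and make up `Λ`, and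
which is of exponential type `π` with at most linear growth on horizontal lines. -/
structure IsSineLike (Λ : Set ℂ) (F : ℂ → ℂ) : Prop where
  differentiable : Differentiable ℂ F
  map_zero : F 0 = 1
  eq_zero_iff : ∀ z, F z = 0 ↔ z ∈ Λ
  deriv_ne_zero : ∀ z ∈ Λ, deriv F z ≠ 0
  im_eq_zero : ∀ z ∈ Λ, z.im = 0
  exists_bound : ∃ C : ℝ, 0 < C ∧ ∀ z, ‖F z‖ ≤ C * (1 + ‖z‖) * Real.exp (Real.pi * |z.im|)

namespace IsSineLike

variable {Λ : Set ℂ} {F : ℂ → ℂ}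

theorem ne_zero_of_mem (h : IsSineLike Λ F) {l : ℂ} (hl : l ∈ Λ) : l ≠ 0 := by
  rintro rfl
  have := (h.eq_zero_iff 0).2 hl
  rw [h.map_zero] at this
  exact one_ne_zero this

theorem finite_truncation (h : IsSineLike Λ F) (R : ℝ) : {l | l ∈ Λ ∧ ‖l‖ < R}.Finite := by
  by_contra hinf
  obtain ⟨x, -, hx⟩ := Set.Infinite.exists_accPt_of_subset_isCompact hinf
    (isCompact_closedBall (0 : ℂ) R) (fun l hl => by simpa using hl.2.le)
  have hA : AnalyticOnNhd ℂ F Set.univ := fun z _ => h.differentiable.analyticAt z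
  have hfreq : ∃ᶠ z in 𝓝[≠] x, F z = (0 : ℂ → ℂ) z := by
    rw [accPt_iff_frequently_nhdsNE] at hx
    exact hx.mono fun z hz => (h.eq_zero_iff z).2 hz.1
  have := hA.eq_of_frequently_eq (fun _ _ => analyticAt_const) hfreq
  have h1 := h.map_zero
  rw [this] at h1
  exact zero_ne_one h1

/-- The zeros of modulus less than `R`. -/
def truncation (h : IsSineLike Λ F) (R : ℝ) : Finset ℂ := (h.finite_truncation R).toFinset

theorem mem_truncation (h : IsSineLike Λ F) {R : ℝ} {l : ℂ} :
    l ∈ h.truncation R ↔ l ∈ Λ ∧ ‖l‖ < R := by simp [truncation]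

theorem truncation_mono (h : IsSineLike Λ F) {R R' : ℝ} (hR : R ≤ R') :
    h.truncation R ⊆ h.truncation R' := fun _ hl =>
  h.mem_truncation.2 ⟨(h.mem_truncation.1 hl).1, (h.mem_truncation.1 hl).2.trans_le hR⟩

theorem tendsto_prod_truncation (h : IsSineLike Λ F) {G : ℂ → ℂ} (hG : IsGeneratingFunction Λ G)
    (z : ℂ) : Tendsto (fun R => ∏ l ∈ h.truncation R, (1 - z / l)) atTop (𝓝 (G z)) := by
  refine (hG z).congr fun R => ?_
  exact finprod_mem_eq_finite_toFinset_prod _ (h.finite_truncation R)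

/-- The coefficient of the linear exponential in the quotient of `F` by its truncated product. -/
def slope (h : IsSineLike Λ F) (R : ℝ) : ℂ := deriv F 0 + ∑ l ∈ h.truncation R, 1 / l

theorem exists_near_exponential (h : IsSineLike Λ F) :
    ∃ K : ℝ, 0 < K ∧ ∀ R, 1 ≤ R → ∀ z : ℂ, 8 * ‖z‖ ≤ R →
      (∃ e : ℂ, ‖e‖ ≤ K * ‖z‖ ^ 2 / R ∧
        F z = (∏ l ∈ h.truncation R, (1 - z / l)) * Complex.exp (h.slope R * z + e)) ∧
      (F z ≠ 0 → ‖deriv F z / F z - (∑ l ∈ h.truncation R, 1 / (z - l)) - h.slope R‖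
        ≤ K * ‖z‖ / R) := by
  obtain ⟨C₀, hC₀, hb⟩ := h.exists_bound
  set C := C₀ + 3 + 3 * Real.pi with hC
  have hCpos : 0 < C := by positivity
  refine ⟨128 * C, by positivity, fun R hR z hz => ?_⟩
  have hR0 : 0 < R := by linarith
  set s := h.truncation R with hs
  have hsΛ : ∀ l ∈ s, l ∈ Λ := fun l hl => (h.mem_truncation.1 hl).1
  have hsne : ∀ l ∈ s, l ≠ 0 := fun l hl => h.ne_zero_of_mem (hsΛ l hl)
  obtain ⟨H, hH, hFH⟩ := exists_eq_prod_mul h.differentiable s fun l hl =>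
    ⟨(h.eq_zero_iff l).2 (hsΛ l hl), hsne l hl⟩
  have hHne : ∀ z ∈ Metric.ball (0 : ℂ) R, H z ≠ 0 := fun z hz =>
    ne_zero_of_eq_prod_mul hH (fun l hl => ⟨hsne l hl, h.deriv_ne_zero l (hsΛ l hl)⟩) hFH
      fun hFz => h.mem_truncation.2 ⟨(h.eq_zero_iff z).1 hFz, by simpa using hz⟩
  have hH0 : H 0 = 1 := by
    have := hFH 0
    rw [h.map_zero] at this
    simpa using this.symm
  have hHb : ∀ z ∈ Metric.ball (0 : ℂ) R, ‖H z‖ ≤ Real.exp (C * R) := by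
    intro z hz
    -- On the circle of radius 3R every factor has modulus at least 3 - 1 ≥ 1, so |H| ≤ |F| there,
    -- and the maximum principle brings the bound inside.
    refine Complex.norm_le_of_forall_mem_frontier_norm_le (U := Metric.ball 0 (3 * R))
      Metric.isBounded_ball hH.diffContOnCl ?_
      (subset_closure (Metric.ball_subset_ball (by linarith) hz))
    intro x hx
    rw [frontier_ball _ (by positivity), mem_sphere_zero_iff_norm] at hx
    have hprod : 1 ≤ ‖∏ l ∈ s, (1 - x / l)‖ := by
      rw [norm_prod]
      refine Finset.prod_induction _ (fun x : ℝ => 1 ≤ x)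
        (fun a b ha hb => one_le_mul_of_one_le_of_one_le ha hb) le_rfl fun l hl => ?_
      have hlR := (h.mem_truncation.1 hl).2
      have hlpos : 0 < ‖l‖ := norm_pos_iff.2 (hsne l hl)
      have h1 : 3 ≤ ‖x / l‖ := by
        rw [norm_div, hx, le_div_iff₀ hlpos]
        linarith
      have h2 := norm_sub_norm_le (x / l) 1
      rw [norm_one, norm_sub_rev] at h2
      linarith
    have h1 : ‖H x‖ ≤ ‖F x‖ := by
      rw [hFH x, norm_mul]
      exact le_mul_of_one_le_left (norm_nonneg _) hprod
    have h2 : |x.im| ≤ 3 * R := hx ▸ Complex.abs_im_le_norm x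
    have e1 : C₀ ≤ Real.exp (C₀ * R) :=
      ((by linarith [Real.add_one_le_exp C₀] : C₀ ≤ Real.exp C₀)).trans
        (Real.exp_le_exp.2 (by nlinarith))
    have e2 : 1 + 3 * R ≤ Real.exp (3 * R) := by linarith [Real.add_one_le_exp (3 * R)]
    calc ‖H x‖ ≤ C₀ * (1 + ‖x‖) * Real.exp (Real.pi * |x.im|) := h1.trans (hb x)
      _ ≤ Real.exp (C₀ * R) * Real.exp (3 * R) * Real.exp (Real.pi * (3 * R)) := by
        rw [hx]
        gcongr
      _ = Real.exp (C * R) := by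
        rw [← Real.exp_add, ← Real.exp_add, hC]
        congr 1
        ring
  have hlog : ∀ z, F z ≠ 0 → deriv F z / F z = (∑ l ∈ s, 1 / (z - l)) + deriv H z / H z := by
    intro z hz
    have hPz : ∏ l ∈ s, (1 - z / l) ≠ 0 := fun h0 => hz (by rw [hFH z, h0, zero_mul])
    have hHz : H z ≠ 0 := fun h0 => hz (by rw [hFH z, h0, mul_zero])
    have hfun : F = fun z => (∏ l ∈ s, (1 - z / l)) * H z := funext hFH
    have hl1 := logDeriv_mul (f := fun z => ∏ l ∈ s, (1 - z / l)) (g := H) z hPz hHz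
      (by fun_prop) (hH z)
    rw [← hfun, logDeriv_apply] at hl1
    rw [hl1, logDeriv_prod, logDeriv_apply]
    · congr 1
      refine Finset.sum_congr rfl fun l hl => ?_
      have hd : HasDerivAt (fun z : ℂ => 1 - z / l) (-(1 / l)) z := by
        simpa using ((hasDerivAt_id z).div_const l).const_sub 1
      rw [logDeriv_apply, hd.deriv]
      have hl0 := hsne l hl
      have hzl : z - l ≠ 0 := by
        intro h0
        exact hz ((h.eq_zero_iff z).2 (sub_eq_zero.1 h0 ▸ hsΛ l hl))
      have hzl' : l - z ≠ 0 := by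
        rw [← neg_sub]; exact neg_ne_zero.2 hzl
      rw [one_sub_div hl0, div_div_eq_mul_div, neg_mul, div_mul_cancel₀ _ hl0, ← neg_sub z l,
        neg_div_neg_eq]
    · intro l hl h0
      exact hPz (Finset.prod_eq_zero hl h0)
    · intro l hl
      fun_prop
  have hslope : deriv H 0 / H 0 = h.slope R := by
    have := hlog 0 (by rw [h.map_zero]; exact one_ne_zero)
    rw [h.map_zero, div_one] at this
    rw [slope, this]
    simp only [zero_sub, one_div, inv_neg, Finset.sum_neg_distrib]
    ring
  obtain ⟨k1, e, he, hke⟩ := zeroFree_near_exponential hR0 hCpos hH.differentiableOn hHne hH0 hHb hz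
  rw [hslope] at k1 hke
  refine ⟨⟨e, he.trans ?_, ?_⟩, fun hFz => ?_⟩
  · gcongr
    norm_num
  · rw [hFH z, hke]
  · rw [hlog z hFz, add_sub_cancel_left]
    exact k1

end IsSineLike


/-- Abel's inequality for weights in `[0, 1]`, by layers. -/
theorem abs_sum_mul_le_of_layers {ι : Type*} (s : Finset ι) (b φ : ι → ℝ) {ε : ℝ}
    (hφ0 : ∀ i ∈ s, 0 ≤ φ i) (hφ1 : ∀ i ∈ s, φ i ≤ 1)
    (hb : ∀ t : ℝ, |∑ i ∈ s with t ≤ φ i, b i| ≤ ε) : |∑ i ∈ s, b i * φ i| ≤ ε := by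
  have hint : ∀ i, IntervalIntegrable (fun t : ℝ => (Set.Iic (φ i)).indicator (fun _ => b i) t)
      volume 0 1 := fun i =>
    ⟨(intervalIntegrable_const (c := b i)).1.indicator measurableSet_Iic,
      (intervalIntegrable_const (c := b i)).2.indicator measurableSet_Iic⟩
  have h1 : ∀ i ∈ s, ∫ t in (0 : ℝ)..1, (Set.Iic (φ i)).indicator (fun _ => b i) t = b i * φ i := by
    intro i hi
    rw [intervalIntegral.integral_of_le zero_le_one, integral_indicator measurableSet_Iic,
      Measure.restrict_restrict measurableSet_Iic]
    have : Set.Iic (φ i) ∩ Set.Ioc 0 1 = Set.Ioc 0 (φ i) := by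
      ext x
      simp only [Set.mem_inter_iff, Set.mem_Iic, Set.mem_Ioc]
      have := hφ1 i hi
      constructor
      · rintro ⟨h1, h2, h3⟩; exact ⟨h2, h1⟩
      · rintro ⟨h1, h2⟩; exact ⟨h2, h1, h2.trans this⟩
    rw [this]
    simp [hφ0 i hi, mul_comm]
  have h2 : ∑ i ∈ s, b i * φ i
      = ∫ t in (0 : ℝ)..1, ∑ i ∈ s with t ≤ φ i, b i := by
    rw [← Finset.sum_congr rfl h1, ← intervalIntegral.integral_finsetSum fun i _ => hint i]
    congr 1
    ext t
    rw [Finset.sum_filter]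
    rfl
  rw [h2]
  have := intervalIntegral.norm_integral_le_of_norm_le_const (a := (0 : ℝ)) (b := 1) (C := ε)
    (f := fun t => ∑ i ∈ s with t ≤ φ i, b i) (fun t _ => hb t)
  simpa using this

/-! ### Convergence of the sums of reciprocals of the zeros, and the exponential factor between F
and G -/

namespace IsSineLike

variable {Λ : Set ℂ} {F : ℂ → ℂ}

theorem slope_re_sub (h : IsSineLike Λ F) {R R' : ℝ} (hR : R ≤ R') :
    (h.slope R').re - (h.slope R).re = ∑ l ∈ h.truncation R' \ h.truncation R, (1 / l).re := by
  rw [← Complex.re_sum, Finset.sum_sdiff_eq_sub (h.truncation_mono hR), slope, slope]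
  simp

/-- Each term is (1/l) φ(l), where φ(l) = |l|²/(|l|² + y²) lies in [0, 1] and increases with |l|.
The layers of φ are therefore annuli, over which the sum of 1/l is a difference of slopes. This
replaces absolute convergence, which is not available. -/
theorem abs_sum_tail_le (h : IsSineLike Λ F) {R₀ R ε y : ℝ} (hy : 0 < y) (hε : 0 ≤ ε)
    (hc : ∀ R₁ R₂, R₀ ≤ R₁ → R₁ ≤ R₂ → |(h.slope R₂).re - (h.slope R₁).re| ≤ ε) :
    |∑ l ∈ h.truncation R \ h.truncation R₀, l.re / (l.re ^ 2 + y ^ 2)| ≤ ε := by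
  classical
  set A := h.truncation R \ h.truncation R₀ with hA
  have hAmem : ∀ l, l ∈ A ↔ l ∈ Λ ∧ ‖l‖ < R ∧ R₀ ≤ ‖l‖ := by
    intro l
    simp only [hA, Finset.mem_sdiff, h.mem_truncation, not_and, not_lt]
    tauto
  set φ : ℂ → ℝ := fun l => ‖l‖ ^ 2 / (‖l‖ ^ 2 + y ^ 2) with hφ
  have hmono : ∀ l m : ℂ, ‖l‖ ≤ ‖m‖ → φ l ≤ φ m := by
    intro l m hlm
    simp only [hφ]
    rw [div_le_div_iff₀ (by positivity) (by positivity)]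
    have : ‖l‖ ^ 2 ≤ ‖m‖ ^ 2 := by gcongr
    nlinarith [sq_nonneg y]
  have hterm : ∀ l ∈ A, l.re / (l.re ^ 2 + y ^ 2) = (1 / l).re * φ l := by
    intro l hl
    have hΛ := ((hAmem l).1 hl).1
    have him := h.im_eq_zero l hΛ
    have hl0 := h.ne_zero_of_mem hΛ
    have hlr : l = (l.re : ℂ) := by
      apply Complex.ext <;> simp [him]
    have hre : l.re ≠ 0 := fun h0 => hl0 (by rw [hlr, h0]; simp)
    have h1 : (1 / l).re = 1 / l.re := by
      conv_lhs => rw [hlr]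
      rw [← Complex.ofReal_one, ← Complex.ofReal_div, Complex.ofReal_re]
    have h2 : ‖l‖ ^ 2 = l.re ^ 2 := by
      conv_lhs => rw [hlr]
      rw [Complex.norm_real, Real.norm_eq_abs, sq_abs]
    simp only [hφ, h1, h2]
    field_simp
  rw [Finset.sum_congr rfl hterm]
  refine abs_sum_mul_le_of_layers A _ φ (fun l _ => by positivity) (fun l _ => ?_) fun t => ?_
  · simp only [hφ]
    exact div_le_one_of_le₀ (by nlinarith [sq_nonneg y]) (by positivity)
  · rcases Finset.eq_empty_or_nonempty (A.filter fun l => t ≤ φ l) with hE | hE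
    · rw [hE]; simpa using hε
    · obtain ⟨m, hm, hmin⟩ := Finset.exists_min_image _ (fun l : ℂ => ‖l‖) hE
      rw [Finset.mem_filter] at hm
      have hmA := (hAmem m).1 hm.1
      have hset : A.filter (fun l => t ≤ φ l) = h.truncation R \ h.truncation ‖m‖ := by
        ext l
        rw [Finset.mem_filter, hAmem, Finset.mem_sdiff, h.mem_truncation, h.mem_truncation]
        constructor
        · rintro ⟨⟨h1, h2, h3⟩, h4⟩
          refine ⟨⟨h1, h2⟩, fun h5 => ?_⟩
          have := hmin l (Finset.mem_filter.2 ⟨(hAmem l).2 ⟨h1, h2, h3⟩, h4⟩)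
          linarith [h5.2]
        · rintro ⟨⟨h1, h2⟩, h5⟩
          have h6 : ‖m‖ ≤ ‖l‖ := by
            by_contra h7
            exact h5 ⟨h1, not_le.1 h7⟩
          exact ⟨⟨h1, h2, hmA.2.2.trans h6⟩, hm.2.trans (hmono m l h6)⟩
      rw [hset, ← h.slope_re_sub hmA.2.1.le]
      exact hc _ _ hmA.2.2 hmA.2.1.le

/-- The tail is small uniformly in y, because the slopes form a Cauchy family; the remaining finite
part is O(1/y). -/
theorem exists_abs_sum_le (h : IsSineLike Λ F) {a : ℂ} (ha : Tendsto h.slope atTop (𝓝 a)) {ε : ℝ}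
    (hε : 0 < ε) : ∃ Y : ℝ, 0 < Y ∧ ∀ y, Y ≤ y → ∃ R₁, ∀ R, R₁ ≤ R →
      |∑ l ∈ h.truncation R, l.re / (l.re ^ 2 + y ^ 2)| ≤ ε := by
  have hre : Tendsto (fun R => (h.slope R).re) atTop (𝓝 a.re) :=
    (Complex.continuous_re.tendsto a).comp ha
  obtain ⟨R₀, hR₀⟩ := Metric.cauchySeq_iff'.1 hre.cauchySeq (ε / 4) (by positivity)
  have hc : ∀ R₁ R₂, R₀ ≤ R₁ → R₁ ≤ R₂ → |(h.slope R₂).re - (h.slope R₁).re| ≤ ε / 2 := by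
    intro R₁ R₂ h1 h2
    have e1 := hR₀ R₁ h1
    have e2 := hR₀ R₂ (h1.trans h2)
    have := dist_triangle_right (h.slope R₂).re (h.slope R₁).re (h.slope R₀).re
    rw [← Real.dist_eq]
    linarith
  set M := ∑ l ∈ h.truncation R₀, |l.re| with hM
  have hM0 : 0 ≤ M := Finset.sum_nonneg fun _ _ => abs_nonneg _
  refine ⟨2 * M / ε + 1, by positivity, fun y hy => ⟨R₀, fun R hR => ?_⟩⟩
  have hy1 : 1 ≤ y := le_trans (by have : 0 ≤ 2 * M / ε := by positivity
                                   linarith) hy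
  have hy0 : 0 < y := by linarith
  rw [← Finset.sum_sdiff (h.truncation_mono hR)]
  refine (abs_add_le _ _).trans ?_
  have e1 := h.abs_sum_tail_le (R := R) hy0 (by positivity) hc
  have e2 : |∑ l ∈ h.truncation R₀, l.re / (l.re ^ 2 + y ^ 2)| ≤ M / y := by
    rw [hM, Finset.sum_div]
    refine (Finset.abs_sum_le_sum_abs _ _).trans (Finset.sum_le_sum fun l _ => ?_)
    rw [abs_div, abs_of_pos (by positivity : 0 < l.re ^ 2 + y ^ 2)]
    gcongr
    nlinarith [sq_nonneg l.re]
  have e3 : M / y ≤ ε / 2 := by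
    rw [div_le_iff₀ hy0]
    have : 2 * M / ε ≤ y := by linarith
    rw [div_le_iff₀ hε] at this
    linarith
  linarith

/-- The point is that the slopes converge. At 1 and -1 the two linear exponentials cancel, so |G(1)
G(-1)| = |F(1) F(-1)| ≠ 0; then the convergence of the products at 1 forces that of Re `slope`. The
imaginary part is constant because the zeros are real. -/
theorem exists_eq_mul_exp (h : IsSineLike Λ F) {G : ℂ → ℂ} (hG : IsGeneratingFunction Λ G)
    (h1 : (1 : ℂ) ∉ Λ) (h2 : (-1 : ℂ) ∉ Λ) :
    ∃ a : ℂ, Tendsto h.slope atTop (𝓝 a) ∧ ∀ z, F z = G z * Complex.exp (a * z) := by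
  obtain ⟨K, hK, hKF⟩ := h.exists_near_exponential
  have hex : ∀ z : ℂ, ∃ e : ℝ → ℂ, Tendsto e atTop (𝓝 0) ∧ ∀ᶠ R in atTop,
      F z = (∏ l ∈ h.truncation R, (1 - z / l)) * Complex.exp (h.slope R * z + e R) := by
    intro z
    have hev : ∀ᶠ R : ℝ in atTop, ∃ e : ℂ, ‖e‖ ≤ K * ‖z‖ ^ 2 / R ∧
        F z = (∏ l ∈ h.truncation R, (1 - z / l)) * Complex.exp (h.slope R * z + e) := by
      filter_upwards [eventually_ge_atTop 1, eventually_ge_atTop (8 * ‖z‖)] with R hR1 hR2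
      exact (hKF R hR1 z hR2).1
    obtain ⟨e, he⟩ := hev.choice
    refine ⟨e, ?_, he.mono fun R hR => hR.2⟩
    refine squeeze_zero_norm' (he.mono fun R hR => hR.1) ?_
    exact tendsto_const_nhds.div_atTop tendsto_id
  have hnorm : ∀ z : ℂ, Tendsto (fun R => ‖∏ l ∈ h.truncation R, (1 - z / l)‖
      * Real.exp ((h.slope R * z).re)) atTop (𝓝 ‖F z‖) := by
    intro z
    obtain ⟨e, he, hFe⟩ := hex z
    have hexp : Tendsto (fun R => Real.exp (-(e R).re)) atTop (𝓝 1) := by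
      have : Tendsto (fun R => -(e R).re) atTop (𝓝 0) := by
        simpa using ((Complex.continuous_re.tendsto 0).comp he).neg
      have h3 := (Real.continuous_exp.tendsto 0).comp this
      rw [Real.exp_zero] at h3
      exact h3
    have h3 := (tendsto_const_nhds (x := ‖F z‖)).mul hexp
    rw [mul_one] at h3
    refine h3.congr' (hFe.mono fun R hR => ?_)
    have : ‖F z‖ = ‖∏ l ∈ h.truncation R, (1 - z / l)‖
        * (Real.exp ((h.slope R * z).re) * Real.exp ((e R).re)) := by
      conv_lhs => rw [hR]
      rw [norm_mul, Complex.norm_exp, Complex.add_re, Real.exp_add]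
    rw [this, Real.exp_neg]
    have := Real.exp_ne_zero (e R).re
    field_simp
  have hF1 : F 1 ≠ 0 := fun h0 => h1 ((h.eq_zero_iff _).1 h0)
  have hF2 : F (-1) ≠ 0 := fun h0 => h2 ((h.eq_zero_iff _).1 h0)
  have n1 := hnorm 1
  have n2 := hnorm (-1)
  have p1 := (h.tendsto_prod_truncation hG 1).norm
  have p2 := (h.tendsto_prod_truncation hG (-1)).norm
  have hG1 : ‖G 1‖ ≠ 0 := by
    have h3 := n1.mul n2
    have h4 : ‖G 1‖ * ‖G (-1)‖ = ‖F 1‖ * ‖F (-1)‖ := by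
      refine tendsto_nhds_unique (p1.mul p2) (h3.congr fun R => ?_)
      have : Real.exp ((h.slope R * 1).re) * Real.exp ((h.slope R * (-1)).re) = 1 := by
        rw [← Real.exp_add]
        simp
      calc _ = ‖∏ l ∈ h.truncation R, (1 - 1 / l)‖ * ‖∏ l ∈ h.truncation R, (1 - -1 / l)‖
            * (Real.exp ((h.slope R * 1).re) * Real.exp ((h.slope R * (-1)).re)) := by ring
        _ = _ := by rw [this, mul_one]
    intro h5
    rw [h5, zero_mul] at h4
    exact mul_ne_zero (norm_ne_zero_iff.2 hF1) (norm_ne_zero_iff.2 hF2) h4.symm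
  have hexp : Tendsto (fun R => Real.exp ((h.slope R).re)) atTop (𝓝 (‖F 1‖ / ‖G 1‖)) := by
    refine (n1.div p1 hG1).congr' ?_
    filter_upwards [p1.eventually_ne hG1] with R hR
    simp only [Pi.div_apply, mul_one]
    rw [mul_div_cancel_left₀ _ hR]
  have hre : Tendsto (fun R => (h.slope R).re) atTop (𝓝 (Real.log (‖F 1‖ / ‖G 1‖))) := by
    have := hexp.log (div_ne_zero (norm_ne_zero_iff.2 hF1) hG1)
    simpa using this
  have him : ∀ R, (h.slope R).im = (deriv F 0).im := by
    intro R
    rw [slope, Complex.add_im, Complex.im_sum, Finset.sum_eq_zero, add_zero]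
    intro l hl
    have := h.im_eq_zero l (h.mem_truncation.1 hl).1
    simp [this]
  set a : ℂ := ⟨Real.log (‖F 1‖ / ‖G 1‖), (deriv F 0).im⟩ with ha
  have hslope : Tendsto h.slope atTop (𝓝 a) := by
    have h3 : Tendsto (fun R => (((h.slope R).re : ℝ) : ℂ) + ((deriv F 0).im : ℂ) * Complex.I)
        atTop (𝓝 ((Real.log (‖F 1‖ / ‖G 1‖) : ℝ) + ((deriv F 0).im : ℂ) * Complex.I)) :=
      ((Complex.continuous_ofReal.tendsto _).comp hre).add tendsto_const_nhds
    rw [ha, Complex.mk_eq_add_mul_I]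
    refine h3.congr fun R => ?_
    rw [← him R, Complex.re_add_im]
  refine ⟨a, hslope, fun z => ?_⟩
  obtain ⟨e, he, hFe⟩ := hex z
  have h3 : Tendsto (fun R => (∏ l ∈ h.truncation R, (1 - z / l))
      * Complex.exp (h.slope R * z + e R)) atTop (𝓝 (G z * Complex.exp (a * z + 0))) :=
    (h.tendsto_prod_truncation hG z).mul
      ((Complex.continuous_exp.tendsto _).comp ((hslope.mul_const z).add he))
  rw [add_zero] at h3
  exact tendsto_nhds_unique (tendsto_const_nhds.congr' hFe) h3

theorem ne_zero_of_im_ne_zero (h : IsSineLike Λ F) {z : ℂ} (hz : z.im ≠ 0) : F z ≠ 0 :=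
  fun h0 => hz (h.im_eq_zero z ((h.eq_zero_iff z).1 h0))

/-- The logarithmic derivative along the imaginary axis detects the real part of the exponent. -/
theorem tendsto_logDeriv_re (h : IsSineLike Λ F) {a : ℂ} (ha : Tendsto h.slope atTop (𝓝 a)) :
    Tendsto (fun y : ℝ => (deriv F (Complex.I * y) / F (Complex.I * y)).re) atTop (𝓝 a.re) := by
  obtain ⟨K, hK, hKF⟩ := h.exists_near_exponential
  rw [Metric.tendsto_atTop]
  intro ε hε
  obtain ⟨Y, hY, hYs⟩ := h.exists_abs_sum_le ha (half_pos hε)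
  refine ⟨Y, fun y hy => ?_⟩
  have hy0 : 0 < y := hY.trans_le hy
  obtain ⟨R₁, hR₁⟩ := hYs y hy
  set z : ℂ := Complex.I * y with hz
  have hzim : z.im = y := by simp [hz]
  have hFz : F z ≠ 0 := h.ne_zero_of_im_ne_zero (by rw [hzim]; exact hy0.ne')
  set D : ℝ := (deriv F z / F z).re with hD
  have hlim : Tendsto (fun R => D - (h.slope R).re - ∑ l ∈ h.truncation R, (1 / (z - l)).re) atTop
      (𝓝 0) := by
    refine squeeze_zero_norm' (a := fun R => K * ‖z‖ / R) ?_
      (tendsto_const_nhds.div_atTop tendsto_id)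
    filter_upwards [eventually_ge_atTop 1, eventually_ge_atTop (8 * ‖z‖)] with R hR1 hR2
    refine le_trans ?_ ((hKF R hR1 z hR2).2 hFz)
    refine le_trans (le_of_eq ?_) (Complex.abs_re_le_norm _)
    rw [Real.norm_eq_abs, Complex.sub_re, Complex.sub_re, Complex.re_sum]
    congr 1
    ring
  have hre : Tendsto (fun R => (h.slope R).re) atTop (𝓝 a.re) :=
    (Complex.continuous_re.tendsto a).comp ha
  have hlim2 : Tendsto (fun R => -∑ l ∈ h.truncation R, (1 / (z - l)).re) atTop
      (𝓝 (a.re - D)) := by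
    have := (hlim.add hre).sub_const D
    rw [zero_add] at this
    refine this.congr fun R => ?_
    ring
  have hle : |a.re - D| ≤ ε / 2 := by
    refine le_of_tendsto hlim2.abs ?_
    filter_upwards [eventually_ge_atTop R₁] with R hR
    have := hR₁ R hR
    refine le_trans (le_of_eq ?_) this
    rw [← Finset.sum_neg_distrib]
    congr 1
    refine Finset.sum_congr rfl fun l hl => ?_
    have him := h.im_eq_zero l (h.mem_truncation.1 hl).1
    rw [one_div, Complex.inv_re, Complex.normSq_apply]
    simp only [hz, Complex.sub_re, Complex.mul_re, Complex.I_re, Complex.ofReal_re, Complex.I_im,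
      Complex.ofReal_im, Complex.sub_im, Complex.mul_im, him]
    ring_nf
  rw [Real.dist_eq, abs_sub_comm]
  linarith

end IsSineLike


/-! ### Holomorphic functions on the upper half-plane with nonnegative real part -/

/-- The open upper half-plane as a set of complex numbers. -/
def upperHalf : Set ℂ := {z | 0 < z.im}

theorem isOpen_upperHalf : IsOpen upperHalf := isOpen_lt continuous_const Complex.continuous_im

/-- The map in x is the inverse of z ↦ (z - w)/(z - conj w), which carries the half-plane to the
disc and w to 0; see `cayley_symm`. -/
theorem cayley_mem_upperHalf {w : ℂ} (hw : 0 < w.im) {x : ℂ} (hx : ‖x‖ < 1) :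
    1 - x ≠ 0 ∧ (w - conj w * x) / (1 - x) ∈ upperHalf := by
  have hne : 1 - x ≠ 0 := by
    intro h
    rw [sub_eq_zero] at h
    rw [← h, norm_one] at hx
    exact lt_irrefl _ hx
  refine ⟨hne, ?_⟩
  have hns : 0 < Complex.normSq (1 - x) := Complex.normSq_pos.2 hne
  have hx2 : x.re ^ 2 + x.im ^ 2 < 1 := by
    have : ‖x‖ ^ 2 < 1 := by
      have := norm_nonneg x
      nlinarith
    rw [Complex.sq_norm, Complex.normSq_apply] at this
    nlinarith
  have : ((w - conj w * x) / (1 - x)).im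
      = w.im * (1 - (x.re ^ 2 + x.im ^ 2)) / Complex.normSq (1 - x) := by
    rw [Complex.div_im]
    simp only [Complex.sub_re, Complex.sub_im, Complex.mul_re, Complex.mul_im, Complex.conj_re,
      Complex.conj_im, Complex.one_re, Complex.one_im]
    rw [← sub_div]
    congr 1
    ring
  show 0 < ((w - conj w * x) / (1 - x)).im
  rw [this]
  have : 0 < 1 - (x.re ^ 2 + x.im ^ 2) := by linarith
  positivity

theorem differentiableOn_comp_cayley {U : ℂ → ℂ} (hU : DifferentiableOn ℂ U upperHalf) {w : ℂ}
    (hw : 0 < w.im) :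
    DifferentiableOn ℂ (fun x => U ((w - conj w * x) / (1 - x))) (Metric.ball 0 1) := by
  refine hU.comp (t := upperHalf) ?_ fun x hx => (cayley_mem_upperHalf hw (by simpa using hx)).2
  refine DifferentiableOn.div (by fun_prop) (by fun_prop) fun x hx => ?_
  exact (cayley_mem_upperHalf hw (by simpa using hx)).1

theorem norm_cayley_lt_one {z w : ℂ} (hz : 0 < z.im) (hw : 0 < w.im) :
    z - conj w ≠ 0 ∧ ‖(z - w) / (z - conj w)‖ < 1 := by
  have hne : z - conj w ≠ 0 := by
    intro h
    have := congrArg Complex.im h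
    simp at this
    linarith
  refine ⟨hne, ?_⟩
  rw [norm_div, div_lt_one (norm_pos_iff.2 hne), ← sq_lt_sq₀ (norm_nonneg _) (norm_nonneg _),
    Complex.sq_norm, Complex.sq_norm, Complex.normSq_apply, Complex.normSq_apply]
  simp only [Complex.sub_re, Complex.sub_im, Complex.conj_re, Complex.conj_im]
  nlinarith [mul_pos hz hw]

theorem cayley_symm {z w : ℂ} (hz : 0 < z.im) (hw : 0 < w.im) :
    (w - conj w * ((z - w) / (z - conj w))) / (1 - (z - w) / (z - conj w)) = z := by
  have h1 := (norm_cayley_lt_one hz hw).1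
  have h2 : w - conj w ≠ 0 := by
    intro h
    have := congrArg Complex.im h
    simp at this
    linarith
  have h3 : 1 - (z - w) / (z - conj w) = (w - conj w) / (z - conj w) := by
    rw [one_sub_div h1]
    congr 1
    ring
  have h4 : w - conj w * ((z - w) / (z - conj w)) = z * (w - conj w) / (z - conj w) := by
    rw [eq_div_iff h1, sub_mul, mul_assoc, div_mul_cancel₀ _ h1]
    ring
  rw [h3, h4, div_div_div_cancel_right₀ h1, mul_div_cancel_right₀ _ h2]

/-- The Schwarz lemma after Cayley transforms in the source and in the target. The identities |A +
conj B|² = |A - B|² + 4 Re A Re B and |z - conj w|² = |z - w|² + 4 Im z Im w turn it into this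
polynomial form. -/
theorem schwarz_pick_of_pos {U : ℂ → ℂ} (hU : DifferentiableOn ℂ U upperHalf)
    (hpos : ∀ z ∈ upperHalf, 0 < (U z).re) {z w : ℂ} (hz : 0 < z.im) (hw : 0 < w.im) :
    ‖U z - U w‖ ^ 2 * (z.im * w.im) ≤ ‖z - w‖ ^ 2 * ((U z).re * (U w).re) := by
  set ψ : ℂ → ℂ := fun x => (w - conj w * x) / (1 - x) with hψ
  have hden : ∀ v ∈ upperHalf, U v + conj (U w) ≠ 0 := by
    intro v hv h
    have := congrArg Complex.re h
    simp at this
    linarith [hpos v hv, hpos w hw]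
  have key : ∀ A B : ℂ, 0 < A.re → 0 < B.re →
      ‖A - B‖ ^ 2 + 4 * (A.re * B.re) = ‖A + conj B‖ ^ 2 := by
    intro A B _ _
    rw [Complex.sq_norm, Complex.sq_norm, Complex.normSq_apply, Complex.normSq_apply]
    simp only [Complex.sub_re, Complex.sub_im, Complex.add_re, Complex.add_im, Complex.conj_re,
      Complex.conj_im]
    ring
  have hφd : DifferentiableOn ℂ (fun x => (U (ψ x) - U w) / (U (ψ x) + conj (U w)))
      (Metric.ball 0 1) := by
    have h1 := differentiableOn_comp_cayley hU hw
    refine DifferentiableOn.div (h1.sub_const _) (h1.add_const _) fun x hx => ?_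
    exact hden _ (cayley_mem_upperHalf hw (by simpa using hx)).2
  have hφm : Set.MapsTo (fun x => (U (ψ x) - U w) / (U (ψ x) + conj (U w))) (Metric.ball 0 1)
      (Metric.closedBall 0 1) := by
    intro x hx
    have hm := (cayley_mem_upperHalf hw (by simpa using hx : ‖x‖ < 1)).2
    rw [mem_closedBall_zero_iff, norm_div]
    refine div_le_one_of_le₀ ?_ (norm_nonneg _)
    rw [← sq_le_sq₀ (norm_nonneg _) (norm_nonneg _), ← key _ _ (hpos _ hm) (hpos w hw)]
    have := mul_pos (hpos _ hm) (hpos w hw)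
    linarith
  have hφ0 : (fun x => (U (ψ x) - U w) / (U (ψ x) + conj (U w))) 0 = 0 := by
    simp [hψ]
  have hS := Complex.norm_le_norm_of_mapsTo_ball hφd hφm hφ0 (norm_cayley_lt_one hz hw).2
  have hψz : ψ ((z - w) / (z - conj w)) = z := cayley_symm hz hw
  simp only [hψz] at hS
  rw [norm_div, norm_div, div_le_div_iff₀ (norm_pos_iff.2 (hden z hz))
    (norm_pos_iff.2 (norm_cayley_lt_one hz hw).1)] at hS
  have hS2 := mul_self_le_mul_self (by positivity) hS
  have e1 : ‖z - conj w‖ ^ 2 = ‖z - w‖ ^ 2 + 4 * (z.im * w.im) := by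
    rw [Complex.sq_norm, Complex.sq_norm, Complex.normSq_apply, Complex.normSq_apply]
    simp only [Complex.sub_re, Complex.sub_im, Complex.conj_re, Complex.conj_im]
    ring
  have e2 := key (U z) (U w) (hpos z hz) (hpos w hw)
  have e3 : ‖U z - U w‖ ^ 2 * ‖z - conj w‖ ^ 2 ≤ ‖z - w‖ ^ 2 * ‖U z + conj (U w)‖ ^ 2 := by
    nlinarith
  rw [e1, ← e2] at e3
  nlinarith

theorem schwarz_pick {U : ℂ → ℂ} (hU : DifferentiableOn ℂ U upperHalf)
    (hnn : ∀ z ∈ upperHalf, 0 ≤ (U z).re) {z w : ℂ} (hz : 0 < z.im) (hw : 0 < w.im) :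
    ‖U z - U w‖ ^ 2 * (z.im * w.im) ≤ ‖z - w‖ ^ 2 * ((U z).re * (U w).re) := by
  have h1 : ∀ δ : ℝ, 0 < δ → ‖U z - U w‖ ^ 2 * (z.im * w.im)
      ≤ ‖z - w‖ ^ 2 * (((U z).re + δ) * ((U w).re + δ)) := by
    intro δ hδ
    have := schwarz_pick_of_pos (U := fun v => U v + δ) (hU.add_const _)
      (fun v hv => by simpa using add_pos_of_nonneg_of_pos (hnn v hv) hδ) hz hw
    simpa using this
  have hc : Tendsto (fun δ : ℝ => ‖z - w‖ ^ 2 * (((U z).re + δ) * ((U w).re + δ))) (𝓝[>] 0)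
      (𝓝 (‖z - w‖ ^ 2 * (((U z).re + 0) * ((U w).re + 0)))) :=
    (Continuous.tendsto (by fun_prop) _).mono_left nhdsWithin_le_nhds
  rw [add_zero, add_zero] at hc
  refine ge_of_tendsto hc ?_
  filter_upwards [self_mem_nhdsWithin] with δ hδ using h1 δ hδ

/-- The infinitesimal form of Schwarz–Pick, with v tending to z. -/
theorem norm_deriv_mul_im_le {U : ℂ → ℂ} (hU : DifferentiableOn ℂ U upperHalf)
    (hnn : ∀ z ∈ upperHalf, 0 ≤ (U z).re) {z : ℂ} (hz : 0 < z.im) :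
    ‖deriv U z‖ * z.im ≤ (U z).re := by
  have hd := (hU.differentiableAt (isOpen_upperHalf.mem_nhds hz)).hasDerivAt
  have hs := hd.tendsto_slope
  have h1 : Tendsto (fun v => ‖slope U z v‖ ^ 2 * (v.im * z.im)) (𝓝[≠] z)
      (𝓝 (‖deriv U z‖ ^ 2 * (z.im * z.im))) :=
    (hs.norm.pow 2).mul (((Complex.continuous_im.tendsto z).mono_left nhdsWithin_le_nhds).mul_const _)
  have h2 : Tendsto (fun v => (U v).re * (U z).re) (𝓝[≠] z) (𝓝 ((U z).re * (U z).re)) :=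
    ((Complex.continuous_re.tendsto _).comp
      (hd.continuousAt.tendsto.mono_left nhdsWithin_le_nhds)).mul_const _
  have h3 : ‖deriv U z‖ ^ 2 * (z.im * z.im) ≤ (U z).re * (U z).re := by
    refine le_of_tendsto_of_tendsto h1 h2 ?_
    filter_upwards [self_mem_nhdsWithin,
      mem_nhdsWithin_of_mem_nhds (isOpen_upperHalf.mem_nhds hz)] with v hv hvU
    have := schwarz_pick hU hnn (z := v) (w := z) hvU hz
    have hvz : 0 < ‖v - z‖ := norm_pos_iff.2 (sub_ne_zero.2 hv)
    rw [slope_def_field, norm_div, div_pow, div_mul_eq_mul_div, div_le_iff₀ (by positivity)]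
    linarith
  rw [← sq_le_sq₀ (by positivity) (hnn z hz)]
  nlinarith

/-- A Julia–Carathéodory statement at infinity: `hinf` says that U has no linear part. Schwarz–Pick
against a point w with Re U(w) ≤ ε Im w gives Re U(iy) = O(εy) for large y, and the infinitesimal
form converts this into a bound for the derivative. -/
theorem tendsto_deriv_of_re_le {U : ℂ → ℂ} (hU : DifferentiableOn ℂ U upperHalf)
    (hnn : ∀ z ∈ upperHalf, 0 ≤ (U z).re)
    (hinf : ∀ ε : ℝ, 0 < ε → ∃ w ∈ upperHalf, (U w).re ≤ ε * w.im) :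
    Tendsto (fun y : ℝ => deriv U (Complex.I * y)) atTop (𝓝 0) := by
  rw [Metric.tendsto_atTop]
  intro ε hε
  obtain ⟨w, hw, hwε⟩ := hinf (ε / 8) (by positivity)
  have hw' : 0 < w.im := hw
  have hUw := hnn w hw
  refine ⟨max (‖w‖ + 1) (8 * (U w).re / ε), fun y hy => ?_⟩
  have hy1 : ‖w‖ + 1 ≤ y := (le_max_left _ _).trans hy
  have hy2 : 8 * (U w).re / ε ≤ y := (le_max_right _ _).trans hy
  have hy0 : 0 < y := by linarith [norm_nonneg w]
  set z : ℂ := Complex.I * y with hz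
  have hzim : z.im = y := by simp [hz]
  have hzpos : 0 < z.im := by rw [hzim]; exact hy0
  have hSP := schwarz_pick hU hnn hzpos hw'
  set X := (U z).re with hX
  have hX0 : 0 ≤ X := hnn z hzpos
  set A := ‖U z - U w‖ with hA
  have hXA : X ≤ (U w).re + A := by
    have := (Complex.abs_re_le_norm (U z - U w))
    rw [Complex.sub_re] at this
    linarith [le_abs_self ((U z).re - (U w).re)]
  have hzw : ‖z - w‖ ^ 2 ≤ 4 * y ^ 2 := by
    have h1 : ‖z - w‖ ≤ 2 * y := by
      refine (norm_sub_le _ _).trans ?_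
      have : ‖z‖ = y := by simp [hz, abs_of_pos hy0]
      linarith
    have := norm_nonneg (z - w)
    nlinarith
  have hA2 : A ^ 2 ≤ ε / 2 * y * X := by
    rw [hzim] at hSP
    have h1 : ‖z - w‖ ^ 2 * (X * (U w).re) ≤ 4 * y ^ 2 * (X * (ε / 8 * w.im)) := by
      gcongr
    have h2 : A ^ 2 * (y * w.im) ≤ (ε / 2 * y * X) * (y * w.im) := by
      refine (hSP.trans h1).trans (le_of_eq (by ring))
    exact le_of_mul_le_mul_right h2 (by positivity)
  have hA3 : A ≤ ε * y / 4 + X / 2 := by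
    rw [← sq_le_sq₀ (norm_nonneg _) (by positivity)]
    nlinarith [sq_nonneg (ε * y / 4 - X / 2)]
  have hXle : X ≤ 2 * (U w).re + ε * y / 2 := by linarith
  have hUy : 8 * (U w).re ≤ y * ε := by rwa [div_le_iff₀ hε] at hy2
  have hd := norm_deriv_mul_im_le hU hnn hzpos
  rw [hzim] at hd
  rw [dist_zero_right]
  have hεy : 0 < ε * y := by positivity
  exact lt_of_mul_lt_mul_right (by linarith : ‖deriv U z‖ * y < ε * y) hy0.le

theorem exists_log_upperHalf {B : ℂ → ℂ} (hB : DifferentiableOn ℂ B upperHalf)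
    (hne : ∀ z ∈ upperHalf, B z ≠ 0) :
    ∃ l : ℂ → ℂ, DifferentiableOn ℂ l upperHalf ∧ ∀ z ∈ upperHalf, Complex.exp (l z) = B z := by
  have hI : 0 < Complex.I.im := by simp
  obtain ⟨g, -, hg⟩ := exists_log_on_ball one_pos (differentiableOn_comp_cayley hB hI)
    (fun x hx => hne _ (cayley_mem_upperHalf hI (by simpa using hx)).2)
  refine ⟨fun z => g ((z - Complex.I) / (z - conj Complex.I)), ?_, fun z hz => ?_⟩
  · have hgd : DifferentiableOn ℂ g (Metric.ball 0 1) := fun x hx =>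
      (hg x hx).1.differentiableAt.differentiableWithinAt
    refine hgd.comp (t := Metric.ball 0 1) ?_ fun z hz => by
      simpa using (norm_cayley_lt_one hz hI).2
    exact DifferentiableOn.div (by fun_prop) (by fun_prop) fun z hz => (norm_cayley_lt_one hz hI).1
  · have := (hg ((z - Complex.I) / (z - conj Complex.I)) (by
      simpa using (norm_cayley_lt_one hz hI).2)).2
    rw [cayley_symm hz hI] at this
    exact this

/-- The logarithmic derivative of a zero-free bounded function on the upper half-plane becomes
purely imaginary along the imaginary axis. -/
theorem tendsto_logDeriv_re_of_bounded {B : ℂ → ℂ} (hB : DifferentiableOn ℂ B upperHalf)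
    (hne : ∀ z ∈ upperHalf, B z ≠ 0) (hb : ∀ z ∈ upperHalf, ‖B z‖ ≤ 1) :
    Tendsto (fun y : ℝ => (deriv B (Complex.I * y) / B (Complex.I * y)).re) atTop (𝓝 0) := by
  obtain ⟨l, hl, hlB⟩ := exists_log_upperHalf hB hne
  have hlre : ∀ z ∈ upperHalf, (l z).re ≤ 0 := by
    intro z hz
    have := hb z hz
    rw [← hlB z hz, Complex.norm_exp] at this
    exact Real.exp_le_one_iff.1 this
  -- The infimum c of these ratios is the linear part of -log |B|. Subtracting c Im z keeps the real
  -- part nonnegative and leaves no linear part; its effect on the derivative is the imaginary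
  -- constant ic, which the real part does not see.
  set T : Set ℝ := (fun z : ℂ => -(l z).re / z.im) '' upperHalf with hT
  have hTne : T.Nonempty := ⟨_, Complex.I, by simp [upperHalf], rfl⟩
  have hTbdd : BddBelow T := by
    refine ⟨0, ?_⟩
    rintro _ ⟨z, hz, rfl⟩
    exact div_nonneg (by linarith [hlre z hz]) (le_of_lt hz)
  set c := sInf T with hc
  have hUd : DifferentiableOn ℂ (fun z => -l z + Complex.I * c * z) upperHalf :=
    hl.neg.add (by fun_prop)
  have hUre : ∀ z : ℂ, (-l z + Complex.I * c * z).re = -(l z).re - c * z.im := by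
    intro z
    simp
    ring
  have hlim := tendsto_deriv_of_re_le hUd (fun z hz => by
    have hz' : 0 < z.im := hz
    have h1 := csInf_le hTbdd (Set.mem_image_of_mem _ hz)
    rw [← hc, le_div_iff₀ hz'] at h1
    rw [hUre]
    linarith) (fun ε hε => by
    obtain ⟨_, ⟨w, hw, rfl⟩, hwlt⟩ := exists_lt_of_csInf_lt hTne (show sInf T < c + ε by linarith)
    have hw' : 0 < w.im := hw
    refine ⟨w, hw, ?_⟩
    simp only [div_lt_iff₀ hw'] at hwlt
    rw [hUre]
    linarith)
  have hre := (Complex.continuous_re.tendsto _).comp hlim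
  rw [Complex.zero_re] at hre
  have h2 := hre.neg
  rw [neg_zero] at h2
  refine h2.congr' ?_
  filter_upwards [eventually_gt_atTop 0] with y hy
  set z : ℂ := Complex.I * y with hz
  have hzU : z ∈ upperHalf := by simpa [upperHalf, hz] using hy
  have hlz := (hl.differentiableAt (isOpen_upperHalf.mem_nhds hzU)).hasDerivAt
  have hBz : HasDerivAt B (Complex.exp (l z) * deriv l z) z := by
    refine hlz.cexp.congr_of_eventuallyEq ?_
    filter_upwards [isOpen_upperHalf.mem_nhds hzU] with v hv using (hlB v hv).symm
  have hUz : HasDerivAt (fun z => -l z + Complex.I * c * z) (-deriv l z + Complex.I * c * 1) z :=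
    hlz.fun_neg.fun_add ((hasDerivAt_id z).const_mul _)
  simp only [Function.comp_apply]
  rw [hUz.deriv, hBz.deriv, hlB z hzU, mul_div_cancel_left₀ _ (hne z hzU)]
  simp


/-! ### The exponent is purely imaginary -/

namespace IsSineLike

variable {Λ : Set ℂ} {F : ℂ → ℂ}

/-- The real part of F'/F along the positive imaginary axis has two limits to compare. The sum over
the zeros gives Re a. On the other hand F(z) e^{iπz}/(z + i), suitably scaled, is zero-free and
bounded by 1 in the upper half-plane, which gives 0, since the extra factors contribute only
imaginary terms on the axis. -/
theorem exponent_re_eq_zero (h : IsSineLike Λ F) {a : ℂ} (ha : Tendsto h.slope atTop (𝓝 a)) :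
    a.re = 0 := by
  obtain ⟨C, hC, hb⟩ := h.exists_bound
  have hden : ∀ z ∈ upperHalf, z + Complex.I ≠ 0 := by
    intro z hz h0
    have hz' : 0 < z.im := hz
    have := congrArg Complex.im h0
    simp at this
    linarith
  have hexp : Differentiable ℂ fun z => Complex.exp (Complex.I * Real.pi * z) := by fun_prop
  set B : ℂ → ℂ := fun z =>
    F z / (z + Complex.I) * (Complex.exp (Complex.I * Real.pi * z) * ((2 * C : ℝ) : ℂ)⁻¹) with hB
  have hC2 : (((2 * C : ℝ) : ℂ))⁻¹ ≠ 0 := by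
    apply inv_ne_zero
    exact_mod_cast (by positivity : (2 * C : ℝ) ≠ 0)
  have hBd : DifferentiableOn ℂ B upperHalf :=
    (h.differentiable.differentiableOn.div (by fun_prop) hden).mul
      (hexp.mul_const _).differentiableOn
  have hFne : ∀ z ∈ upperHalf, F z ≠ 0 := fun z hz => h.ne_zero_of_im_ne_zero (ne_of_gt hz)
  have hBne : ∀ z ∈ upperHalf, B z ≠ 0 := fun z hz =>
    mul_ne_zero (div_ne_zero (hFne z hz) (hden z hz)) (mul_ne_zero (Complex.exp_ne_zero _) hC2)
  have hBb : ∀ z ∈ upperHalf, ‖B z‖ ≤ 1 := by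
    intro z hz
    have hz' : 0 < z.im := hz
    have h1 : 1 + ‖z‖ ≤ 2 * ‖z + Complex.I‖ := by
      have h2 : (1 : ℝ) ≤ ‖z + Complex.I‖ := by
        refine le_trans ?_ (Complex.abs_im_le_norm _)
        rw [Complex.add_im, Complex.I_im]
        exact le_trans (by linarith) (le_abs_self _)
      have h3 : ‖z‖ ≤ ‖z + Complex.I‖ := by
        rw [← sq_le_sq₀ (norm_nonneg _) (norm_nonneg _), Complex.sq_norm, Complex.sq_norm,
          Complex.normSq_apply, Complex.normSq_apply]
        simp
        nlinarith
      linarith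
    have hpos : 0 < ‖z + Complex.I‖ := norm_pos_iff.2 (hden z hz)
    have h4 : ‖Complex.exp (Complex.I * Real.pi * z)‖ = (Real.exp (Real.pi * |z.im|))⁻¹ := by
      rw [Complex.norm_exp, ← Real.exp_neg, abs_of_pos hz']
      congr 1
      simp
    have h5 : ‖F z‖ ≤ (2 * C) * ‖z + Complex.I‖ * Real.exp (Real.pi * |z.im|) :=
      (hb z).trans (by
        have := mul_le_mul_of_nonneg_left h1 hC.le
        have h6 := Real.exp_pos (Real.pi * |z.im|)
        nlinarith)
    have h7 : ‖((2 * C : ℝ) : ℂ)⁻¹‖ = (2 * C)⁻¹ := by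
      rw [norm_inv, Complex.norm_real, Real.norm_eq_abs, abs_of_pos (by positivity)]
    simp only [hB]
    rw [norm_mul, norm_div, norm_mul, h4, h7]
    have h6 := Real.exp_pos (Real.pi * |z.im|)
    rw [div_mul_eq_mul_div, div_le_one hpos, ← mul_inv, ← div_eq_mul_inv,
      div_le_iff₀ (by positivity)]
    linarith
  have hlim := tendsto_logDeriv_re_of_bounded hBd hBne hBb
  have hlim2 := h.tendsto_logDeriv_re ha
  have hinv : Tendsto (fun y : ℝ => (1 / (Complex.I * y + Complex.I)).re) atTop (𝓝 0) := by
    refine tendsto_const_nhds.congr fun y => ?_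
    rw [one_div, Complex.inv_re]
    simp
  have hsub := hlim2.sub hinv
  rw [sub_zero] at hsub
  refine tendsto_nhds_unique hsub (hlim.congr' ?_)
  filter_upwards [eventually_gt_atTop 0] with y hy
  set z : ℂ := Complex.I * y with hz
  have hzU : z ∈ upperHalf := by simpa [upperHalf, hz] using hy
  have h1 := (h.differentiable z).hasDerivAt
  have h2 : HasDerivAt (fun z => z + Complex.I) 1 z := (hasDerivAt_id z).add_const _
  have h3 : HasDerivAt (fun z => Complex.exp (Complex.I * Real.pi * z))
      (Complex.exp (Complex.I * Real.pi * z) * (Complex.I * Real.pi * 1)) z :=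
    ((hasDerivAt_id z).const_mul _).cexp
  have h4 : HasDerivAt B _ z := (h1.fun_div h2 (hden z hzU)).fun_mul (h3.mul_const _)
  have h5 : deriv B z / B z
      = deriv F z / F z - 1 / (z + Complex.I) + ((Real.pi : ℝ) : ℂ) * Complex.I := by
    rw [h4.deriv]
    simp only [hB]
    have e1 := hFne z hzU
    have e2 := hden z hzU
    have e3 := Complex.exp_ne_zero (Complex.I * Real.pi * z)
    generalize Complex.exp (Complex.I * Real.pi * z) = E at *
    generalize ((2 * C : ℝ) : ℂ)⁻¹ = D at *
    field_simp
  rw [h5, Complex.add_re, Complex.sub_re]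
  simp

theorem exists_eq_mul_exp_I (h : IsSineLike Λ F) {G : ℂ → ℂ} (hG : IsGeneratingFunction Λ G)
    (h1 : (1 : ℂ) ∉ Λ) (h2 : (-1 : ℂ) ∉ Λ) :
    ∃ α : ℝ, ∀ z, F z = G z * Complex.exp (α * Complex.I * z) := by
  obtain ⟨a, ha, hFG⟩ := h.exists_eq_mul_exp hG h1 h2
  refine ⟨a.im, fun z => ?_⟩
  rw [hFG z]
  congr 3
  apply Complex.ext <;> simp [h.exponent_re_eq_zero ha]

end IsSineLike

/-! ### The system biorthogonal to a complete minimal exponential system -/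

section Biorthogonal

variable {Λ : Set ℂ} {w : Λ → L2Interval}

theorem pw_biorthogonal_self (hreal : ∀ l ∈ Λ, l.im = 0)
    (hw : IsBiorthogonal (exponentialSystem Λ) w) (l : Λ) : pw (w l) l = 1 := by
  rw [← inner_exponential_eq_pw (hreal l l.2)]
  exact hw.1 l

theorem pw_biorthogonal_of_ne (hreal : ∀ l ∈ Λ, l.im = 0)
    (hw : IsBiorthogonal (exponentialSystem Λ) w) {l : Λ} {m : ℂ} (hm : m ∈ Λ) (hne : m ≠ l) :
    pw (w l) m = 0 := by
  rw [← inner_exponential_eq_pw (hreal m hm)]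
  exact hw.2 ⟨m, hm⟩ l fun h => hne (congrArg Subtype.val h)

theorem eq_zero_of_pw_eq_zero (hΛ : IsCompleteMinimal (exponentialSystem Λ))
    (hreal : ∀ l ∈ Λ, l.im = 0) {u : L2Interval} (hu : ∀ m ∈ Λ, pw u m = 0) : u = 0 :=
  hΛ.eq_zero_of_inner_eq_zero fun m => by
    rw [exponentialSystem, inner_exponential_eq_pw (hreal m m.2)]
    exact hu m m.2

/-- If u vanishes at m, then u + (m - l) g transforms to (z - l)/(z - m) times `pw u`: a zero is
moved from m to l. With u = `w l` this fills the one zero that `pw (w l)` lacks on Λ. -/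
theorem pw_shift_zero {l m : ℂ} {u g : L2Interval} (hg : ∀ z, (z - m) * pw g z = pw u z) (z : ℂ) :
    (z - m) * pw (u + (m - l) • g) z = (z - l) * pw u z := by
  rw [pw_add, pw_smul]
  linear_combination (m - l) * hg z

theorem pw_shift_zero_ne_zero (hreal : ∀ l ∈ Λ, l.im = 0)
    (hoff : ∀ n : ℤ, (n : ℂ) ∉ Λ)
    (hw : IsBiorthogonal (exponentialSystem Λ) w) {l : Λ} {m : ℂ} {g : L2Interval}
    (hg : ∀ z, (z - m) * pw g z = pw (w l) z) : w l + (m - l) • g ≠ 0 := by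
  intro h0
  have hw0 : w l = 0 := by
    refine eq_zero_of_pw_int_eq_zero fun n => ?_
    have := pw_shift_zero (l := l) hg n
    rw [h0, pw_zero, mul_zero] at this
    refine (mul_eq_zero.1 this.symm).resolve_left fun h1 => hoff n ?_
    rw [sub_eq_zero.1 h1]
    exact l.2
  have := pw_biorthogonal_self hreal hw l
  rw [hw0, pw_zero] at this
  exact zero_ne_one this

theorem pw_shift_zero_eq_zero_of_ne (hreal : ∀ l ∈ Λ, l.im = 0)
    (hw : IsBiorthogonal (exponentialSystem Λ) w) {l : Λ} {m : ℂ} {g : L2Interval}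
    (hg : ∀ z, (z - m) * pw g z = pw (w l) z) {k : ℂ} (hk : k ∈ Λ) (hkm : k ≠ m) :
    pw (w l + (m - l) • g) k = 0 := by
  have h1 := pw_shift_zero (l := l) hg k
  have h2 : (k - l) * pw (w l) k = 0 := by
    by_cases hkl : k = l
    · rw [hkl, sub_self, zero_mul]
    · rw [pw_biorthogonal_of_ne hreal hw hk hkl, mul_zero]
  rw [h2] at h1
  exact (mul_eq_zero.1 h1).resolve_left (sub_ne_zero.2 hkm)

/-- A zero m outside Λ could be exchanged for l, producing a nonzero element that vanishes on all of
Λ, against completeness. -/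
theorem mem_of_pw_biorthogonal_eq_zero (hΛ : IsCompleteMinimal (exponentialSystem Λ))
    (hreal : ∀ l ∈ Λ, l.im = 0) (hoff : ∀ n : ℤ, (n : ℂ) ∉ Λ)
    (hw : IsBiorthogonal (exponentialSystem Λ) w) {l : Λ} {m : ℂ} (hm : pw (w l) m = 0) :
    m ∈ Λ := by
  obtain ⟨g, hg⟩ := exists_pw_div hm
  by_contra hmΛ
  refine pw_shift_zero_ne_zero hreal hoff hw hg (eq_zero_of_pw_eq_zero hΛ hreal fun k hk => ?_)
  exact pw_shift_zero_eq_zero_of_ne hreal hw hg hk fun h => hmΛ (h ▸ hk)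

/-- The same exchange: if m were a multiple zero, one zero at m would survive moving another one to
l. -/
theorem deriv_pw_biorthogonal_ne_zero (hΛ : IsCompleteMinimal (exponentialSystem Λ))
    (hreal : ∀ l ∈ Λ, l.im = 0) (hoff : ∀ n : ℤ, (n : ℂ) ∉ Λ)
    (hw : IsBiorthogonal (exponentialSystem Λ) w) {l : Λ} {m : ℂ} (hmΛ : m ∈ Λ) (hml : m ≠ l) :
    deriv (pw (w l)) m ≠ 0 := by
  have hm := pw_biorthogonal_of_ne hreal hw hmΛ hml
  obtain ⟨g, hg⟩ := exists_pw_div hm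
  have hderiv : deriv (pw (w l)) m = pw g m := by
    have h1 : HasDerivAt (fun z => (z - m) * pw g z) _ m :=
      ((hasDerivAt_id m).sub_const m).fun_mul (differentiable_pw g m).hasDerivAt
    rw [← funext hg, h1.deriv]
    simp
  intro h0
  rw [hderiv] at h0
  refine pw_shift_zero_ne_zero hreal hoff hw hg (eq_zero_of_pw_eq_zero hΛ hreal fun k hk => ?_)
  by_cases hkm : k = m
  · rw [hkm, pw_add, pw_smul, hm, h0, mul_zero, zero_add]
  · exact pw_shift_zero_eq_zero_of_ne hreal hw hg hk hkm

/-- Moving the zero of `w l` from k to l gives an element vanishing on Λ except at k, hence by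
completeness a multiple of `w k`. All the biorthogonal elements thus come from one entire function.
-/
theorem exists_pw_biorthogonal_eq_mul (hΛ : IsCompleteMinimal (exponentialSystem Λ))
    (hreal : ∀ l ∈ Λ, l.im = 0) (hoff : ∀ n : ℤ, (n : ℂ) ∉ Λ)
    (hw : IsBiorthogonal (exponentialSystem Λ) w) (l k : Λ) :
    ∃ c : ℂ, ∀ z, (z - k) * pw (w k) z = c * ((z - l) * pw (w l) z) := by
  by_cases hkl : (k : ℂ) = l
  · exact ⟨1, fun z => by rw [Subtype.ext hkl, one_mul]⟩
  obtain ⟨g, hg⟩ := exists_pw_div (pw_biorthogonal_of_ne hreal hw k.2 hkl)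
  set u := w l + ((k : ℂ) - l) • g with hu
  have hu2 : u - pw u k • w k = 0 := by
    refine eq_zero_of_pw_eq_zero hΛ hreal fun m hm => ?_
    rw [pw_sub, pw_smul]
    by_cases hmk : m = k
    · rw [hmk, pw_biorthogonal_self hreal hw, mul_one, sub_self]
    · rw [pw_shift_zero_eq_zero_of_ne hreal hw hg hm hmk, pw_biorthogonal_of_ne hreal hw hm hmk,
        mul_zero, sub_zero]
  have hc : pw u k ≠ 0 := by
    intro h0
    rw [h0, zero_smul, sub_zero] at hu2
    exact pw_shift_zero_ne_zero hreal hoff hw hg hu2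
  refine ⟨(pw u k)⁻¹, fun z => ?_⟩
  have h1 : pw u z = pw u k * pw (w k) z := by
    have := congrArg (fun f => pw f z) (sub_eq_zero.1 hu2)
    simpa only [pw_smul] using this
  rw [← pw_shift_zero (l := l) hg z, ← hu, h1]
  field_simp

/-- The normalized generating function built from one biorthogonal element. -/
theorem isSineLike_biorthogonal (hΛ : IsCompleteMinimal (exponentialSystem Λ))
    (hreal : ∀ l ∈ Λ, l.im = 0) (hoff : ∀ n : ℤ, (n : ℂ) ∉ Λ)
    (hw : IsBiorthogonal (exponentialSystem Λ) w) (l : Λ) :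
    ∃ c : ℂ, c ≠ 0 ∧ IsSineLike Λ fun z => c * ((z - l) * pw (w l) z) := by
  have h0Λ : (0 : ℂ) ∉ Λ := by simpa using hoff 0
  have hl0 : (l : ℂ) ≠ 0 := fun h => h0Λ (h ▸ l.2)
  have hw0 : pw (w l) 0 ≠ 0 := fun h => h0Λ (mem_of_pw_biorthogonal_eq_zero hΛ hreal hoff hw h)
  have hd := differentiable_pw (w l)
  set c : ℂ := ((0 - l) * pw (w l) 0)⁻¹ with hc
  have hcne : c ≠ 0 := inv_ne_zero (mul_ne_zero (by simpa using hl0) hw0)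
  refine ⟨c, hcne, ?_, ?_, ?_, ?_, hreal, ?_⟩
  · fun_prop
  · exact inv_mul_cancel₀ (mul_ne_zero (by simpa using hl0) hw0)
  · intro z
    rw [mul_eq_zero, or_iff_right hcne, mul_eq_zero, sub_eq_zero]
    constructor
    · rintro (rfl | h)
      · exact l.2
      · exact mem_of_pw_biorthogonal_eq_zero hΛ hreal hoff hw h
    · intro hz
      by_cases hzl : z = l
      · exact Or.inl hzl
      · exact Or.inr (pw_biorthogonal_of_ne hreal hw hz hzl)
  · intro z hz
    have h1 : HasDerivAt (fun z => c * ((z - l) * pw (w l) z)) _ z :=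
      (((hasDerivAt_id z).sub_const (l : ℂ)).fun_mul (hd z).hasDerivAt).const_mul c
    rw [h1.deriv]
    refine mul_ne_zero hcne ?_
    by_cases hzl : z = l
    · rw [hzl, pw_biorthogonal_self hreal hw]
      simp
    · rw [pw_biorthogonal_of_ne hreal hw hz hzl, mul_zero, zero_add]
      exact mul_ne_zero (sub_ne_zero.2 hzl) (deriv_pw_biorthogonal_ne_zero hΛ hreal hoff hw hz hzl)
  · obtain ⟨C, hC, hb⟩ := exists_norm_pw_le (w l)
    refine ⟨‖c‖ * (1 + ‖(l : ℂ)‖) * C, by positivity, fun z => ?_⟩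
    rw [norm_mul, norm_mul]
    have h1 : ‖z - l‖ ≤ (1 + ‖(l : ℂ)‖) * (1 + ‖z‖) := by
      refine (norm_sub_le _ _).trans ?_
      nlinarith [norm_nonneg z, norm_nonneg (l : ℂ), mul_nonneg (norm_nonneg z) (norm_nonneg (l : ℂ))]
    calc ‖c‖ * (‖z - l‖ * ‖pw (w l) z‖)
        ≤ ‖c‖ * ((1 + ‖(l : ℂ)‖) * (1 + ‖z‖) * (C * Real.exp (Real.pi * |z.im|))) := by
          gcongr
          exact hb z
      _ = _ := by ring

/-- The values at the integers of the biorthogonal system. -/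
theorem exists_integer_values {G : ℂ → ℂ} (hΛ : IsCompleteMinimal (exponentialSystem Λ))
    (hG : IsGeneratingFunction Λ G) (hreal : ∀ l ∈ Λ, l.im = 0)
    {δ : ℝ} (hδ : 0 < δ) (hsep : ∀ n : ℤ, ∀ l ∈ Λ, δ ≤ dist (n : ℂ) l)
    (hd : (fun y : ℝ => G (Complex.I * y)) =o[cocompact ℝ] fun y : ℝ => Real.exp (Real.pi * |y|))
    (hsum : Summable fun n : ℤ => ‖G n‖ / (1 + |(n : ℝ)|)) (hne : Λ.Nonempty)
    (hw : IsBiorthogonal (exponentialSystem Λ) w) :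
    ∃ γ : ℤ → ℂ, γ 0 = 1 ∧ (∀ n, ‖γ n‖ = ‖G n‖) ∧
      (∀ l : Λ, ∃ c : ℂ, ∀ n : ℤ, pw (w l) n = c * (γ n / (n - l))) ∧
      ∀ l : Λ, HasSum (fun n : ℤ => (-1) ^ n * γ n / (n - l)) 0 := by
  have hoff : ∀ n : ℤ, (n : ℂ) ∉ Λ := fun n hn => by
    have := hsep n _ hn
    rw [dist_self] at this
    linarith
  obtain ⟨l₀, hl₀⟩ := hne
  obtain ⟨c₀, hc₀, hF⟩ := isSineLike_biorthogonal hΛ hreal hoff hw ⟨l₀, hl₀⟩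
  set F : ℂ → ℂ := fun z => c₀ * ((z - l₀) * pw (w ⟨l₀, hl₀⟩) z) with hFdef
  obtain ⟨α, hα⟩ := hF.exists_eq_mul_exp_I hG (by simpa using hoff 1) (by simpa using hoff (-1))
  have hγG : ∀ n : ℤ, ‖F n‖ = ‖G n‖ := by
    intro n
    rw [hα, norm_mul, Complex.norm_exp]
    simp
  have hval : ∀ k : Λ, ∃ c : ℂ, ∀ z, (z - k) * pw (w k) z = c * F z := by
    intro k
    obtain ⟨c, hc⟩ := exists_pw_biorthogonal_eq_mul hΛ hreal hoff hw ⟨l₀, hl₀⟩ k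
    refine ⟨c / c₀, fun z => ?_⟩
    rw [hc z, hFdef]
    field_simp
  clear_value F
  have hnk : ∀ (k : Λ) (n : ℤ), (n : ℂ) - k ≠ 0 := fun k n h0 =>
    hoff n (sub_eq_zero.1 h0 ▸ k.2)
  have hpw : ∀ (k : Λ) (c : ℂ), (∀ z, (z - k) * pw (w k) z = c * F z) →
      ∀ n : ℤ, pw (w k) n = c * (F n / (n - k)) := by
    intro k c hc n
    rw [mul_div_assoc', eq_div_iff (hnk k n), mul_comm, hc]
  refine ⟨fun n => F n, ?_, hγG, fun k => ?_, fun k => ?_⟩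
  · simpa using hF.map_zero
  · obtain ⟨c, hc⟩ := hval k
    exact ⟨c, hpw k c hc⟩
  · obtain ⟨c, hc⟩ := hval k
    have hcn := hpw k c hc
    have hcne : c ≠ 0 := by
      rintro rfl
      have h1 := pw_biorthogonal_self hreal hw k
      rw [eq_zero_of_pw_int_eq_zero (f := w k) fun n => by rw [hcn n, zero_mul], pw_zero] at h1
      exact zero_ne_one h1
    have hdist : ∀ n : ℤ, (1 + |(n : ℝ)|) ≤ ((1 + ‖(k : ℂ)‖) / δ + 1) * ‖(n : ℂ) - k‖ := by
      intro n
      have h1 : δ ≤ ‖(n : ℂ) - k‖ := by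
        rw [← dist_eq_norm]
        exact hsep n k k.2
      have h2 : |(n : ℝ)| ≤ ‖(n : ℂ) - k‖ + ‖(k : ℂ)‖ := by
        have := norm_add_le ((n : ℂ) - k) k
        rw [sub_add_cancel] at this
        simpa using this
      have h3 : 1 + ‖(k : ℂ)‖ ≤ (1 + ‖(k : ℂ)‖) / δ * ‖(n : ℂ) - k‖ := by
        rw [div_mul_eq_mul_div, le_div_iff₀ hδ]
        gcongr
      linarith
    have hsumk : Summable fun n : ℤ => ‖F n / (n - k)‖ := by
      refine Summable.of_nonneg_of_le (fun _ => norm_nonneg _) (fun n => ?_)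
        (hsum.mul_left ((1 + ‖(k : ℂ)‖) / δ + 1))
      rw [norm_div, hγG, div_le_iff₀ (norm_pos_iff.2 (hnk k n)), mul_div_assoc', div_mul_eq_mul_div,
        le_div_iff₀ (by positivity)]
      have := mul_le_mul_of_nonneg_left (hdist n) (norm_nonneg (G n))
      linarith
    have hpm : ∀ n : ℤ, ‖((-1 : ℂ)) ^ n‖ = 1 := fun n => by simp
    have hsum' : Summable fun n : ℤ => (-1 : ℂ) ^ n * F n / (n - k) := by
      refine Summable.of_norm (hsumk.congr fun n => ?_)
      rw [mul_div_assoc, norm_mul, hpm, one_mul]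
    -- the direction of the imaginary axis along which `F` is dominated by `G`
    obtain ⟨L, hLbot, hLc, hLα⟩ : ∃ L : Filter ℝ, L.NeBot ∧ L ≤ cocompact ℝ ∧
        ∀ᶠ y in L, Real.exp (-(α * y)) ≤ 1 := by
      rcases le_total 0 α with h | h
      · refine ⟨atTop, inferInstance, atTop_le_cocompact, ?_⟩
        filter_upwards [eventually_ge_atTop 0] with y hy
        exact Real.exp_le_one_iff.2 (by nlinarith)
      · refine ⟨atBot, inferInstance, atBot_le_cocompact, ?_⟩
        filter_upwards [eventually_le_atBot 0] with y hy
        exact Real.exp_le_one_iff.2 (by nlinarith)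
    have hLabs : Tendsto (fun y : ℝ => |y|) L atTop := by
      have := tendsto_norm_cocompact_atTop (E := ℝ)
      exact this.mono_left hLc
    have hFo : Tendsto (fun y : ℝ => ‖F (Complex.I * y)‖ / Real.exp (Real.pi * |y|)) L (𝓝 0) := by
      have h1 := (hd.mono hLc).norm_left.tendsto_div_nhds_zero
      refine squeeze_zero' (Eventually.of_forall fun y => by positivity) ?_ h1
      filter_upwards [hLα] with y hy
      gcongr
      rw [hα, norm_mul, Complex.norm_exp]
      refine mul_le_of_le_one_right (norm_nonneg _) (le_trans (le_of_eq ?_) hy)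
      congr 1
      simp
    have hnotint : ∀ᶠ y in L, (∀ n : ℤ, Complex.I * (y : ℝ) ≠ n) ∧ 1 ≤ |y| := by
      filter_upwards [hLabs.eventually_ge_atTop 1] with y hy
      refine ⟨fun n hn => ?_, hy⟩
      have := congrArg Complex.im hn
      simp at this
      rw [this, abs_zero] at hy
      linarith
    -- The factor iy/(iy - n) has modulus at most 1 and tends to 1, so these sums tend to the series
    -- in question. By the sampling formula for `w k` they also equal iy/(iy - k) · πF(iy)/sin(πiy),
    -- which tends to 0 along L; this is `hrhs`.
    have hlhs : Tendsto (fun y : ℝ => ∑' n : ℤ, (-1 : ℂ) ^ n * F n / (n - k)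
        * (Complex.I * y / (Complex.I * y - n))) L
        (𝓝 (∑' n : ℤ, (-1 : ℂ) ^ n * F n / (n - k) * 1)) := by
      refine tendsto_tsum_of_dominated_convergence hsumk (fun n => ?_) ?_
      · refine Tendsto.const_mul _ ?_
        have h1 : Tendsto (fun y : ℝ => (n : ℂ) / (Complex.I * y - n)) L (𝓝 0) := by
          refine squeeze_zero_norm' (a := fun y : ℝ => ‖(n : ℂ)‖ / |y|) ?_
            (tendsto_const_nhds.div_atTop hLabs)
          filter_upwards [hnotint] with y hy
          rw [norm_div]
          have : 0 < |y| := by linarith [hy.2]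
          gcongr
          have := Complex.abs_im_le_norm (Complex.I * y - n)
          simpa using this
        have h2 := h1.const_add 1
        rw [add_zero] at h2
        refine h2.congr' ?_
        filter_upwards [hnotint] with y hy
        have := sub_ne_zero.2 (hy.1 n)
        rw [one_add_div this, sub_add_cancel]
      · filter_upwards [hnotint] with y hy n
        rw [norm_mul, mul_div_assoc, norm_mul, hpm, one_mul]
        refine mul_le_of_le_one_right (norm_nonneg _) ?_
        rw [norm_div]
        refine div_le_one_of_le₀ ?_ (norm_nonneg _)
        have := Complex.abs_im_le_norm (Complex.I * y - n)
        simpa using this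
    have hrhs : Tendsto (fun y : ℝ => ∑' n : ℤ, (-1 : ℂ) ^ n * F n / (n - k)
        * (Complex.I * y / (Complex.I * y - n))) L (𝓝 0) := by
      have hb := hFo.const_mul (4 * Real.pi)
      rw [mul_zero] at hb
      refine squeeze_zero_norm' ?_ hb
      filter_upwards [hnotint] with y hy
      set z : ℂ := Complex.I * y with hz
      clear_value z
      have hzk : z - k ≠ 0 := by
        intro h0
        have := congrArg Complex.im h0
        simp [hz, hreal k k.2] at this
        rw [this, abs_zero] at hy
        linarith [hy.2]
      have h1 := ((hasSum_sampling (w k) hy.1).mul_left (z / c)).tsum_eq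
      have h2 : ∑' n : ℤ, (-1 : ℂ) ^ n * F n / (n - k) * (z / (z - n))
          = z / c * (Real.pi * pw (w k) z / Complex.sin (Real.pi * z)) := by
        rw [← h1]
        refine tsum_congr fun n => ?_
        rw [hcn n]
        have e1 := sub_ne_zero.2 (hy.1 n)
        have e2 := hnk k n
        field_simp
      have h3 : pw (w k) z = c * F z / (z - k) := by
        rw [eq_div_iff hzk, mul_comm, hc]
      have h4 : z / c * (Real.pi * pw (w k) z / Complex.sin (Real.pi * z))
          = z / (z - k) * (Real.pi * F z / Complex.sin (Real.pi * z)) := by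
        rw [h3]
        field_simp
      rw [h2, h4, norm_mul, norm_div, norm_div, norm_mul]
      have h5 : ‖z‖ / ‖z - k‖ ≤ 1 := by
        refine div_le_one_of_le₀ ?_ (norm_nonneg _)
        have := Complex.abs_im_le_norm (z - k)
        simpa [hz, hreal k k.2] using this
      have h6 : Real.exp (Real.pi * |y|) / 4 ≤ ‖Complex.sin (Real.pi * z)‖ := by
        have e1 : Complex.sin (Real.pi * z) = Complex.sinh ((Real.pi * y : ℝ)) * Complex.I := by
          rw [hz, ← Complex.sin_mul_I]
          congr 1
          push_cast
          ring
        rw [e1, norm_mul, Complex.norm_I, mul_one, ← Complex.ofReal_sinh, Complex.norm_real,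
          Real.norm_eq_abs, Real.abs_sinh, abs_mul, abs_of_pos Real.pi_pos, Real.sinh_eq]
        have h7 : Real.exp (-(Real.pi * |y|)) ≤ 1 := Real.exp_le_one_iff.2 (by
          have := mul_nonneg Real.pi_pos.le (abs_nonneg y); linarith)
        have h8 : 2 ≤ Real.exp (Real.pi * |y|) := by
          have := Real.add_one_le_exp (Real.pi * |y|)
          have := Real.pi_gt_three
          nlinarith [hy.2]
        linarith
      have hexp := Real.exp_pos (Real.pi * |y|)
      calc ‖z‖ / ‖z - k‖ * (‖(Real.pi : ℂ)‖ * ‖F z‖ / ‖Complex.sin (Real.pi * z)‖)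
          ≤ 1 * (‖(Real.pi : ℂ)‖ * ‖F z‖ / (Real.exp (Real.pi * |y|) / 4)) := by gcongr
        _ = 4 * Real.pi * (‖F z‖ / Real.exp (Real.pi * |y|)) := by
          rw [Complex.norm_real, Real.norm_eq_abs, abs_of_pos Real.pi_pos]
          field_simp
    have h0 := tendsto_nhds_unique hlhs hrhs
    simp only [mul_one] at h0
    rw [← h0]
    exact hsum'.hasSum

end Biorthogonal


/-! ### Products of quotients with lacunary zeros and poles -/

/-- The quotient `(1 - x / a) / (1 - x / b)`. -/
def ratioFactor (a b x : ℝ) : ℝ := b / a * (1 + (a - b) / (b - x))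

theorem ratioFactor_self {a : ℝ} (ha : a ≠ 0) (x : ℝ) : ratioFactor a a x = 1 := by
  simp [ratioFactor, ha]

theorem ratioFactor_zero {a b : ℝ} (ha : a ≠ 0) (hb : b ≠ 0) : ratioFactor a b 0 = 1 := by
  rw [ratioFactor]
  field_simp
  ring

theorem ratioFactor_eq {a b x : ℝ} (hx : b - x ≠ 0) :
    ratioFactor a b x = b * (a - x) / (a * (b - x)) := by
  rw [ratioFactor, one_add_div hx, div_mul_div_comm]
  congr 2
  ring

theorem ratioFactor_eq_one_add {a b x : ℝ} (ha : a ≠ 0) (hx : b - x ≠ 0) :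
    ratioFactor a b x = 1 + x * (a - b) / (a * (b - x)) := by
  rw [ratioFactor]
  field_simp
  ring

/-- A lacunary sequence of positive numbers. -/
structure IsLacunary (ρ : ℕ → ℝ) : Prop where
  pos : ∀ k, 0 < ρ k
  two_mul_le : ∀ k, 2 * ρ k ≤ ρ (k + 1)

namespace IsLacunary

variable {ρ : ℕ → ℝ}

theorem monotone (h : IsLacunary ρ) : Monotone ρ :=
  monotone_nat_of_le_succ fun k => by linarith [h.pos k, h.two_mul_le k]

theorem two_mul_le_of_lt (h : IsLacunary ρ) {j k : ℕ} (hjk : j < k) : 2 * ρ j ≤ ρ k :=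
  (h.two_mul_le j).trans (h.monotone hjk)

theorem two_pow_mul_le (h : IsLacunary ρ) (k : ℕ) : 2 ^ k * ρ 0 ≤ ρ k := by
  induction k with
  | zero => simp
  | succ k ih => rw [pow_succ]; linarith [h.two_mul_le k]

theorem exists_gt (h : IsLacunary ρ) (x : ℝ) : ∃ k, x < ρ k := by
  have h0 := h.pos 0
  obtain ⟨k, hk⟩ := pow_unbounded_of_one_lt (x / ρ 0) (one_lt_two : (1 : ℝ) < 2)
  refine ⟨k, lt_of_lt_of_le ?_ (h.two_pow_mul_le k)⟩
  rwa [div_lt_iff₀ h0] at hk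

theorem sum_range_succ_le (h : IsLacunary ρ) (m : ℕ) :
    ∑ j ∈ Finset.range (m + 1), ρ j ≤ 2 * ρ m := by
  induction m with
  | zero => simp; linarith [h.pos 0]
  | succ m ih => rw [Finset.sum_range_succ]; linarith [h.two_mul_le m]

theorem sum_inv_le (h : IsLacunary ρ) (m N : ℕ) :
    ∑ j ∈ Finset.Ico m N, (ρ j)⁻¹ ≤ 2 * (ρ m)⁻¹ := by
  have key : ∀ N, m ≤ N → ∑ j ∈ Finset.Ico m N, (ρ j)⁻¹ ≤ 2 * (ρ m)⁻¹ - 2 * (ρ N)⁻¹ := by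
    intro N hN
    induction N, hN using Nat.le_induction with
    | base => simp
    | succ N hN ih =>
      rw [Finset.sum_Ico_succ_top hN]
      have h1 : 2 * (ρ (N + 1))⁻¹ ≤ (ρ N)⁻¹ := by
        rw [← div_eq_mul_inv, div_le_iff₀ (h.pos _), inv_mul_eq_div, le_div_iff₀ (h.pos N)]
        exact h.two_mul_le N
      linarith
  rcases le_total m N with hN | hN
  · have := key N hN
    have : 0 < (ρ N)⁻¹ := inv_pos.2 (h.pos N)
    linarith
  · rw [Finset.Ico_eq_empty_of_le hN]
    have := inv_pos.2 (h.pos m)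
    simp
    exact (h.pos m).le

theorem summable_inv (h : IsLacunary ρ) : Summable fun k => (ρ k)⁻¹ := by
  refine summable_of_sum_range_le (c := 2 * (ρ 0)⁻¹) (fun k => (inv_pos.2 (h.pos k)).le) fun n => ?_
  have := h.sum_inv_le 0 n
  rwa [← Finset.range_eq_Ico] at this

end IsLacunary

/-- Zeros and poles in a fixed proportion of the lacunary sequence. -/
structure IsNear (ρ a : ℕ → ℝ) : Prop where
  le_left : ∀ k, 0.725 * ρ k ≤ a k
  le_right : ∀ k, a k ≤ 1.275 * ρ k

/-- For x far beyond the zero and the pole the factor is close to its limit b/a at infinity, not to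
1. This is why the partial products of b/a have to be bounded separately. -/
theorem abs_ratioFactor_small {ρ a b x : ℝ} (hρ : 0 < ρ) (ha : 0.725 * ρ ≤ a) (ha' : a ≤ 1.275 * ρ)
    (hb : 0.725 * ρ ≤ b) (hb' : b ≤ 1.275 * ρ) (hx : 2 * ρ ≤ |x|) :
    |ratioFactor a b x| ≤ b / a * Real.exp (2 * (ρ / |x|)) := by
  have hxpos : 0 < |x| := by linarith
  have ha0 : 0 < a := by nlinarith
  have hb0 : 0 < b := by nlinarith
  have h1 : 0.3625 * |x| ≤ |b - x| := by
    have := abs_sub_abs_le_abs_sub x b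
    rw [abs_sub_comm, abs_of_pos hb0] at this
    linarith
  have h2 : |a - b| ≤ 0.55 * ρ := abs_le.2 ⟨by linarith, by linarith⟩
  rw [ratioFactor, abs_mul, abs_of_pos (div_pos hb0 ha0)]
  gcongr
  refine (abs_add_le _ _).trans ?_
  rw [abs_one, abs_div]
  have h3 : |a - b| / |b - x| ≤ 2 * (ρ / |x|) := by
    rw [div_le_iff₀ (by linarith)]
    have h4 : 0.725 * ρ ≤ 2 * (ρ / |x|) * |b - x| := by
      calc 0.725 * ρ = 2 * (ρ / |x|) * (0.3625 * |x|) := by field_simp; norm_num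
        _ ≤ _ := by gcongr
    linarith
  linarith [Real.add_one_le_exp (2 * (ρ / |x|))]

theorem abs_ratioFactor_sub_one_large {ρ a b x : ℝ} (hρ : 0 < ρ) (ha : 0.725 * ρ ≤ a)
    (ha' : a ≤ 1.275 * ρ) (hb : 0.725 * ρ ≤ b) (hb' : b ≤ 1.275 * ρ) (hx : 2 * |x| ≤ ρ) :
    |ratioFactor a b x - 1| ≤ 4 * (|x| * ρ⁻¹) := by
  have ha0 : 0 < a := by nlinarith
  have h1 : 0.225 * ρ ≤ b - x := by linarith [le_abs_self x]
  have hbx : 0 < b - x := by nlinarith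
  have h2 : |a - b| ≤ 0.55 * ρ := abs_le.2 ⟨by linarith, by linarith⟩
  rw [ratioFactor_eq_one_add ha0.ne' hbx.ne', add_sub_cancel_left, abs_div, abs_mul,
    abs_of_pos (mul_pos ha0 hbx), div_le_iff₀ (mul_pos ha0 hbx)]
  calc |x| * |a - b| ≤ |x| * (0.55 * ρ) := by gcongr
    _ ≤ 4 * (|x| * ρ⁻¹) * ((0.725 * ρ) * (0.225 * ρ)) := by
      have : 4 * (|x| * ρ⁻¹) * ((0.725 * ρ) * (0.225 * ρ)) = |x| * (0.6525 * ρ) := by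
        field_simp; ring
      rw [this]
      gcongr
      norm_num
    _ ≤ _ := by gcongr

/-- The constant in the bound for lacunary products. -/
def lacunaryConst : ℝ := Real.exp 6

/-- Lacunary products are controlled by the two factors next to the argument. -/
theorem exists_prod_ratioFactor_le {ρ a b : ℕ → ℝ} (hρ : IsLacunary ρ) (ha : IsNear ρ a)
    (hb : IsNear ρ b) {B : ℝ} (hB : ∀ m, ∏ j ∈ Finset.range m, (b j / a j) ≤ B) (x : ℝ)
    {V : ℕ → ℝ} (hV1 : ∀ j, 1 ≤ V j) (hV : ∀ j, |ratioFactor (a j) (b j) x| ≤ V j) :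
    ∃ p, ∀ N, |∏ j ∈ Finset.range N, ratioFactor (a j) (b j) x|
      ≤ B * lacunaryConst * (V p * V (p + 1)) := by
  classical
  set u : ℕ → ℝ := fun j => |ratioFactor (a j) (b j) x| with hu
  have hu0 : ∀ j, 0 ≤ u j := fun j => abs_nonneg _
  have hapos : ∀ j, 0 < a j := fun j => by
    have := ha.le_left j
    have := hρ.pos j
    linarith
  have hbpos : ∀ j, 0 < b j := fun j => by
    have := hb.le_left j
    have := hρ.pos j
    linarith
  -- All j < p satisfy 2ρ_j ≤ |x|, and all j ≥ p + 2 satisfy ρ_j ≥ 4ρ_p > 2|x|. Only the factors p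
  -- and p + 1 escape both asymptotic regimes. The two geometric sums of errors are bounded by 2 and
  -- 4, whence e⁶.
  set p := Nat.find (hρ.exists_gt (|x| / 2)) with hp
  have hpspec : |x| / 2 < ρ p := Nat.find_spec (hρ.exists_gt (|x| / 2))
  have hpmin : ∀ j < p, 2 * ρ j ≤ |x| := by
    intro j hj
    have := Nat.find_min (hρ.exists_gt (|x| / 2)) hj
    rw [not_lt] at this
    linarith
  have hB0 : 1 ≤ B := by simpa using hB 0
  have hsmall : ∀ m ≤ p, ∏ j ∈ Finset.range m, u j ≤ B * Real.exp 2 := by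
    intro m hm
    calc ∏ j ∈ Finset.range m, u j
        ≤ ∏ j ∈ Finset.range m, (b j / a j * Real.exp (2 * (ρ j / |x|))) :=
          Finset.prod_le_prod (fun j _ => hu0 j) fun j hj =>
            abs_ratioFactor_small (hρ.pos j) (ha.le_left j) (ha.le_right j) (hb.le_left j)
              (hb.le_right j) (hpmin j ((Finset.mem_range.1 hj).trans_le hm))
      _ = (∏ j ∈ Finset.range m, b j / a j)
          * Real.exp (∑ j ∈ Finset.range m, 2 * (ρ j / |x|)) := by
          rw [Finset.prod_mul_distrib, Real.exp_sum]
      _ ≤ B * Real.exp 2 := by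
          have hsum : ∑ j ∈ Finset.range m, 2 * (ρ j / |x|) ≤ 2 := by
            rw [← Finset.mul_sum, ← Finset.sum_div]
            rcases Nat.eq_zero_or_pos m with rfl | hm0
            · simp
            · obtain ⟨m, rfl⟩ := Nat.exists_eq_succ_of_ne_zero hm0.ne'
              have h1 := hρ.sum_range_succ_le m
              have h2 := hpmin m (by omega)
              have hx : 0 < |x| := by linarith [hρ.pos m]
              have : (∑ j ∈ Finset.range (m + 1), ρ j) / |x| ≤ 1 := by
                rw [div_le_one hx]
                linarith
              simp only [Nat.succ_eq_add_one]
              linarith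
          have hexp := Real.exp_le_exp.2 hsum
          exact mul_le_mul (hB m) hexp (Real.exp_pos _).le (by linarith)
  have hlarge : ∀ N, ∏ j ∈ Finset.Ico (p + 2) N, u j ≤ Real.exp 4 := by
    intro N
    have hge : ∀ j, p + 2 ≤ j → 2 * |x| ≤ ρ j := by
      intro j hj
      have h1 := hρ.two_mul_le p
      have h2 := hρ.two_mul_le (p + 1)
      have h3 := hρ.monotone hj
      linarith
    calc ∏ j ∈ Finset.Ico (p + 2) N, u j
        ≤ ∏ j ∈ Finset.Ico (p + 2) N, Real.exp (4 * (|x| * (ρ j)⁻¹)) := by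
          refine Finset.prod_le_prod (fun j _ => hu0 j) fun j hj => ?_
          have h1 := abs_ratioFactor_sub_one_large (hρ.pos j) (ha.le_left j) (ha.le_right j)
            (hb.le_left j) (hb.le_right j) (hge j (Finset.mem_Ico.1 hj).1)
          have h2 := Real.add_one_le_exp (4 * (|x| * (ρ j)⁻¹))
          have h3 := abs_add_le (ratioFactor (a j) (b j) x - 1) 1
          rw [sub_add_cancel, abs_one] at h3
          exact h3.trans (by linarith)
      _ = Real.exp (∑ j ∈ Finset.Ico (p + 2) N, 4 * (|x| * (ρ j)⁻¹)) := by rw [Real.exp_sum]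
      _ ≤ Real.exp 4 := by
          refine Real.exp_le_exp.2 ?_
          rw [← Finset.mul_sum, ← Finset.mul_sum]
          have h1 := hρ.sum_inv_le (p + 2) N
          have h2 := hge (p + 2) le_rfl
          have h3 := hρ.pos (p + 2)
          have h4 : |x| * ∑ j ∈ Finset.Ico (p + 2) N, (ρ j)⁻¹ ≤ |x| * (2 * (ρ (p + 2))⁻¹) := by
            gcongr
          have h5 : |x| * (2 * (ρ (p + 2))⁻¹) ≤ 1 := by
            rw [← mul_assoc, ← div_eq_mul_inv, div_le_one h3]
            linarith
          linarith
  have hVV : 1 ≤ V p * V (p + 1) := one_le_mul_of_one_le_of_one_le (hV1 _) (hV1 _)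
  have hmid : ∀ N, ∏ j ∈ Finset.Ico p (min N (p + 2)), u j ≤ V p * V (p + 1) := by
    intro N
    have h1 : ∏ j ∈ Finset.Ico p (min N (p + 2)), u j ≤ ∏ j ∈ Finset.Ico p (min N (p + 2)), V j :=
      Finset.prod_le_prod (fun j _ => hu0 j) fun j _ => hV j
    refine h1.trans ?_
    have h2 : min N (p + 2) ≤ p ∨ min N (p + 2) = p + 1 ∨ min N (p + 2) = p + 1 + 1 := by omega
    rcases h2 with h2 | h2 | h2
    · rw [Finset.Ico_eq_empty_of_le h2, Finset.prod_empty]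
      exact hVV
    · rw [h2, Nat.Ico_succ_singleton, Finset.prod_singleton]
      exact le_mul_of_one_le_right (by linarith [hV1 p]) (hV1 _)
    · rw [h2, Finset.prod_Ico_succ_top (by omega), Nat.Ico_succ_singleton, Finset.prod_singleton]
  have hE : lacunaryConst = Real.exp 2 * Real.exp 4 := by
    rw [lacunaryConst, ← Real.exp_add]
    norm_num
  refine ⟨p, fun N => ?_⟩
  rw [Finset.abs_prod]
  rw [hE]
  have hBe : 1 ≤ B * Real.exp 2 :=
    one_le_mul_of_one_le_of_one_le hB0 (Real.one_le_exp (by norm_num))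
  have he4 : 1 ≤ Real.exp 4 := Real.one_le_exp (by norm_num)
  rcases le_total N p with hN | hN
  · calc ∏ j ∈ Finset.range N, u j ≤ B * Real.exp 2 := hsmall N hN
      _ ≤ (B * Real.exp 2) * (Real.exp 4 * (V p * V (p + 1))) :=
        le_mul_of_one_le_right (by linarith) (one_le_mul_of_one_le_of_one_le he4 hVV)
      _ = _ := by ring
  · have hsplit : ∏ j ∈ Finset.range N, u j = (∏ j ∈ Finset.range p, u j)
        * ((∏ j ∈ Finset.Ico p (min N (p + 2)), u j) * ∏ j ∈ Finset.Ico (p + 2) N, u j) := by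
      rcases le_total N (p + 2) with h2 | h2
      · rw [min_eq_left h2, Finset.Ico_eq_empty_of_le h2, Finset.prod_empty, mul_one,
          Finset.prod_range_mul_prod_Ico _ hN]
      · rw [min_eq_right h2, Finset.prod_Ico_consecutive _ (by omega) h2,
          Finset.prod_range_mul_prod_Ico _ hN]
    rw [show ∏ j ∈ Finset.range N, |ratioFactor (a j) (b j) x| = ∏ j ∈ Finset.range N, u j from rfl,
      hsplit]
    calc _ ≤ (B * Real.exp 2) * ((V p * V (p + 1)) * Real.exp 4) := by
          refine mul_le_mul (hsmall p le_rfl) ?_ ?_ (by linarith)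
          · exact mul_le_mul (hmid N) (hlarge N) (Finset.prod_nonneg fun j _ => hu0 j)
              (by linarith)
          · exact mul_nonneg (Finset.prod_nonneg fun j _ => hu0 j)
              (Finset.prod_nonneg fun j _ => hu0 j)
      _ = _ := by ring

/-- Removing one index costs at most a factor two in the partial products. -/
theorem prod_update_le {ρ a b : ℕ → ℝ} (hρ : IsLacunary ρ) (ha : IsNear ρ a)
    (hb : IsNear ρ b) {B : ℝ} (hB : ∀ m, ∏ j ∈ Finset.range m, (b j / a j) ≤ B) (k m : ℕ) :
    ∏ j ∈ Finset.range m, (Function.update b k (ρ k) j / Function.update a k (ρ k) j) ≤ 2 * B := by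
  have hr := hρ.pos k
  have hapos : ∀ j, 0 < a j := fun j => by
    have := ha.le_left j
    have := hρ.pos j
    linarith
  have hbpos : ∀ j, 0 < b j := fun j => by
    have := hb.le_left j
    have := hρ.pos j
    linarith
  have hpos : 0 < ∏ j ∈ Finset.range m, (b j / a j) :=
    Finset.prod_pos fun j _ => div_pos (hbpos j) (hapos j)
  have hBm := hB m
  by_cases hk : k ∈ Finset.range m
  · rw [← Finset.mul_prod_erase _ _ hk] at hBm hpos ⊢
    simp only [Function.update_self, div_self hr.ne', one_mul]
    have he : ∏ j ∈ (Finset.range m).erase k,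
        (Function.update b k (ρ k) j / Function.update a k (ρ k) j)
        = ∏ j ∈ (Finset.range m).erase k, (b j / a j) :=
      Finset.prod_congr rfl fun j hj => by
        rw [Function.update_of_ne (Finset.ne_of_mem_erase hj),
          Function.update_of_ne (Finset.ne_of_mem_erase hj)]
    rw [he]
    -- The omitted factor is at least 0.725/1.275 > 1/2.
    have h1 : 1 ≤ 2 * (b k / a k) := by
      rw [← mul_div_assoc, le_div_iff₀ (hapos k)]
      linarith [hb.le_left k, ha.le_right k]
    have h2 : 0 < ∏ j ∈ (Finset.range m).erase k, (b j / a j) :=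
      Finset.prod_pos fun j _ => div_pos (hbpos j) (hapos j)
    nlinarith
  · have he : ∏ j ∈ Finset.range m, (Function.update b k (ρ k) j / Function.update a k (ρ k) j)
        = ∏ j ∈ Finset.range m, (b j / a j) :=
      Finset.prod_congr rfl fun j hj => by
        have : j ≠ k := fun h => hk (h ▸ hj)
        rw [Function.update_of_ne this, Function.update_of_ne this]
    rw [he]
    linarith

theorem IsNear.update {ρ a : ℕ → ℝ} (hρ : IsLacunary ρ) (ha : IsNear ρ a) (k : ℕ) :
    IsNear ρ (Function.update a k (ρ k)) := by
  constructor
  all_goals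
    intro j
    by_cases h : j = k
    · subst h
      rw [Function.update_self]
      linarith [hρ.pos j]
    · rw [Function.update_of_ne h]
      first | exact ha.le_left j | exact ha.le_right j

/-! ### Balanced products and well-placed frequencies -/

/-- Greedy choice between factors above and below one that keeps all partial products bounded. -/
theorem exists_balanced_choice {p m : ℕ → ℝ} {A B : ℝ} (hA0 : 0 < A) (hA : A ≤ 1) (hB : 1 ≤ B)
    (hp : ∀ k, 1 ≤ p k ∧ p k ≤ B) (hm : ∀ k, A ≤ m k ∧ m k ≤ 1) :
    ∃ c : ℕ → Prop, ∃ _ : DecidablePred c, ∀ n,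
      A ≤ ∏ j ∈ Finset.range n, (if c j then p j else m j) ∧
      ∏ j ∈ Finset.range n, (if c j then p j else m j) ≤ B := by
  classical
  let x : ℕ → ℝ := fun n =>
    Nat.rec (motive := fun _ => ℝ) 1 (fun k (y : ℝ) => y * if y ≤ 1 then p k else m k) n
  have hx : ∀ n : ℕ, x (n + 1) = x n * (if x n ≤ (1 : ℝ) then p n else m n) := fun n => rfl
  refine ⟨fun k => x k ≤ 1, fun k => inferInstance, ?_⟩
  have hprod : ∀ n, ∏ j ∈ Finset.range n, (if x j ≤ 1 then p j else m j) = x n := by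
    intro n
    induction n with
    | zero => rfl
    | succ n ih => rw [Finset.prod_range_succ, ih, hx]
  intro n
  rw [hprod]
  induction n with
  | zero => exact ⟨hA, hB⟩
  | succ n ih =>
    rw [hx]
    split_ifs with h
    · have := hp n
      constructor <;> nlinarith
    · have := hm n
      rw [not_le] at h
      constructor <;> nlinarith

/-- The point nearest to 0, of index i₀, contributes at most 1/δ². Every other one satisfies |i -
i₀| ≤ |y i - y i₀| ≤ 2|y i|. The term j = 0 of the series is 0, since 1/0 = 0. -/
theorem sum_inv_sq_le_of_separated {m : ℕ} {y : ℕ → ℝ} {δ : ℝ} (hδ : 0 < δ)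
    (hsep : ∀ i < m, ∀ j < m, |(i : ℝ) - j| ≤ |y i - y j|) (hy : ∀ i < m, δ ≤ |y i|) :
    ∑ i ∈ Finset.range m, 1 / y i ^ 2 ≤ 1 / δ ^ 2 + 4 * ∑' j : ℤ, 1 / (j : ℝ) ^ 2 := by
  classical
  have hsum : Summable fun j : ℤ => 1 / (j : ℝ) ^ 2 := Real.summable_one_div_int_pow.2 (by norm_num)
  rcases Nat.eq_zero_or_pos m with rfl | hm
  · rw [Finset.range_zero, Finset.sum_empty]
    have : 0 ≤ ∑' j : ℤ, 1 / (j : ℝ) ^ 2 := tsum_nonneg fun j => by positivity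
    positivity
  obtain ⟨i₀, hi₀, hmin⟩ := Finset.exists_min_image (Finset.range m) (fun i => |y i|)
    ⟨0, Finset.mem_range.2 hm⟩
  rw [← Finset.add_sum_erase _ _ hi₀]
  have hi₀' := Finset.mem_range.1 hi₀
  refine add_le_add ?_ ?_
  · have := hy i₀ hi₀'
    rw [← sq_abs (y i₀)]
    exact one_div_le_one_div_of_le (by positivity) (by gcongr)
  · have h1 : ∀ i ∈ (Finset.range m).erase i₀,
        1 / y i ^ 2 ≤ 4 * (1 / (((i : ℤ) - (i₀ : ℤ) : ℤ) : ℝ) ^ 2) := by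
      intro i hi
      have hne := Finset.ne_of_mem_erase hi
      have him := Finset.mem_range.1 (Finset.mem_of_mem_erase hi)
      have h2 := hsep i him i₀ hi₀'
      have h3 := hmin i (Finset.mem_of_mem_erase hi)
      have h4 := abs_sub (y i) (y i₀)
      have h5 : |(i : ℝ) - i₀| ≤ 2 * |y i| := by linarith
      have h6 : 0 < |(i : ℝ) - i₀| := abs_pos.2 (sub_ne_zero.2 (by exact_mod_cast hne))
      push_cast
      rw [← sq_abs (y i), ← sq_abs ((i : ℝ) - i₀), mul_one_div, div_le_div_iff₀ (by
        have : 0 < |y i| := by linarith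
        positivity) (by positivity)]
      nlinarith [abs_nonneg (y i)]
    refine (Finset.sum_le_sum h1).trans ?_
    rw [← Finset.mul_sum]
    gcongr
    have hinj : Set.InjOn (fun i : ℕ => (i : ℤ) - (i₀ : ℤ)) ((Finset.range m).erase i₀) :=
      fun i _ j _ hij => by
        simp only at hij
        omega
    rw [← Finset.sum_image (f := fun j : ℤ => 1 / (j : ℝ) ^ 2) hinj]
    exact hsum.sum_le_tsum _ fun j _ => by positivity

/-- In a long interval there is a frequency that is well placed with respect to given masses. -/
theorem exists_good_frequency {Λ : Set ℂ} {δ c : ℝ} (hδ : 0 < δ) (hc1 : 1 ≤ c)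
    (hsep : ∀ n : ℤ, ∀ l ∈ Λ, δ ≤ dist (n : ℂ) l)
    (hc : ∀ a b : ℝ, c ≤ b - a → ∃ x ∈ Set.Icc a b, (x : ℂ) ∈ Λ)
    {A L : ℝ} (hL : 2 * c ≤ L) (J : Finset ℤ) (M : ℤ → ℝ) :
    ∃ x ∈ Set.Icc A (A + L), (x : ℂ) ∈ Λ ∧
      ∑ n ∈ J, M n ^ 2 * (1 / ((n : ℝ) - x) ^ 2)
        ≤ 4 * c * (1 / δ ^ 2 + 4 * ∑' j : ℤ, 1 / (j : ℝ) ^ 2) / L * ∑ n ∈ J, M n ^ 2 := by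
  set K := 1 / δ ^ 2 + 4 * ∑' j : ℤ, 1 / (j : ℝ) ^ 2 with hK
  -- The interval holds m windows of length c whose left ends are 2c apart, with one frequency in
  -- each; since c ≥ 1 these are separated like the indices. The weighted sum averaged over the m
  -- frequencies is at most K/m times the total mass, so one of them does at least as well.
  set m := ⌊L / (2 * c)⌋₊ with hm
  have hc0 : 0 < 2 * c := by linarith
  have hLc : 1 ≤ L / (2 * c) := by rwa [one_le_div hc0]
  have hm1 : 1 ≤ m := Nat.one_le_floor_iff _ |>.2 hLc
  have hmle : (m : ℝ) * (2 * c) ≤ L := by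
    have := Nat.floor_le (by linarith : 0 ≤ L / (2 * c))
    rwa [← hm, le_div_iff₀ hc0] at this
  have hmge : L ≤ 4 * c * m := by
    have h1 := Nat.lt_floor_add_one (L / (2 * c))
    rw [← hm, div_lt_iff₀ hc0] at h1
    have : (1 : ℝ) ≤ m := by exact_mod_cast hm1
    nlinarith
  have hex : ∀ i : ℕ, ∃ x ∈ Set.Icc (A + 2 * c * i) (A + 2 * c * i + c), (x : ℂ) ∈ Λ := fun i =>
    hc _ _ (by linarith)
  choose x hx hxΛ using hex
  have hmem : ∀ i < m, x i ∈ Set.Icc A (A + L) := by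
    intro i hi
    have h1 := (hx i).1
    have h2 := (hx i).2
    have h3 : (i : ℝ) + 1 ≤ m := by exact_mod_cast hi
    have h4 : (0 : ℝ) ≤ i := Nat.cast_nonneg i
    constructor
    · nlinarith
    · nlinarith
  have hxsep : ∀ i j : ℕ, |(i : ℝ) - j| ≤ |x i - x j| := by
    have key : ∀ i j : ℕ, j < i → (i : ℝ) - j ≤ x i - x j := by
      intro i j hij
      have h1 := (hx i).1
      have h2 := (hx j).2
      have h3 : (j : ℝ) + 1 ≤ i := by exact_mod_cast hij
      nlinarith
    intro i j
    rcases lt_trichotomy i j with h | h | h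
    · have h1 := key j i h
      have h2 : (i : ℝ) < j := by exact_mod_cast h
      rw [abs_sub_comm, abs_sub_comm (x i), abs_of_pos (by linarith), abs_of_pos (by linarith)]
      exact h1
    · rw [h]; simp
    · have h1 := key i j h
      have h2 : (j : ℝ) < i := by exact_mod_cast h
      rw [abs_of_pos (by linarith), abs_of_pos (by linarith)]
      exact h1
  have hpt : ∀ n : ℤ, ∑ i ∈ Finset.range m, 1 / ((n : ℝ) - x i) ^ 2 ≤ K := by
    intro n
    refine sum_inv_sq_le_of_separated hδ (fun i _ j _ => ?_) fun i _ => ?_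
    · have := hxsep i j
      rw [show (n : ℝ) - x i - (n - x j) = -(x i - x j) by ring, abs_neg]
      exact this
    · have := hsep n _ (hxΛ i)
      rw [dist_eq_norm] at this
      have h2 : (n : ℂ) - (x i : ℂ) = (((n : ℝ) - x i : ℝ) : ℂ) := by push_cast; rfl
      rwa [h2, Complex.norm_real, Real.norm_eq_abs] at this
  have htot : ∑ i ∈ Finset.range m, ∑ n ∈ J, M n ^ 2 * (1 / ((n : ℝ) - x i) ^ 2)
      ≤ ∑ i ∈ Finset.range m, (K * ∑ n ∈ J, M n ^ 2) / m := by
    rw [Finset.sum_comm, Finset.sum_const, Finset.card_range, nsmul_eq_mul,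
      mul_div_cancel₀ _ (by positivity), Finset.mul_sum]
    refine Finset.sum_le_sum fun n _ => ?_
    rw [← Finset.mul_sum, mul_comm]
    exact mul_le_mul_of_nonneg_right (hpt n) (by positivity)
  obtain ⟨i, hi, hile⟩ := Finset.exists_le_of_sum_le ⟨0, Finset.mem_range.2 (by omega)⟩ htot
  refine ⟨x i, hmem i (Finset.mem_range.1 hi), hxΛ i, hile.trans ?_⟩
  have hK0 : 0 ≤ K := by
    have : 0 ≤ ∑' j : ℤ, 1 / (j : ℝ) ^ 2 := tsum_nonneg fun j => by positivity
    positivity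
  have hS0 : 0 ≤ ∑ n ∈ J, M n ^ 2 := Finset.sum_nonneg fun _ _ => by positivity
  have hmpos : (0 : ℝ) < m := by exact_mod_cast hm1
  have hLpos : 0 < L := by linarith
  rw [div_mul_eq_mul_div, div_le_div_iff₀ hmpos hLpos]
  have := mul_le_mul_of_nonneg_right hmge (mul_nonneg hK0 hS0)
  linarith


/-! ### Integers in the core and flanking sets -/

/-- The integers in `[ρ - d, ρ + d]`. -/
def coreInts (ρ d : ℝ) : Finset ℤ := Finset.Icc ⌈ρ - d⌉ ⌊ρ + d⌋

/-- The integers at distance between `d + s` and `d + 2 s` of `ρ`. -/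
def flankInts (ρ d s : ℝ) : Finset ℤ :=
  Finset.Icc ⌈ρ - d - 2 * s⌉ ⌊ρ - d - s⌋ ∪ Finset.Icc ⌈ρ + d + s⌉ ⌊ρ + d + 2 * s⌋

theorem mem_coreInts {ρ d : ℝ} {n : ℤ} : n ∈ coreInts ρ d ↔ |(n : ℝ) - ρ| ≤ d := by
  rw [coreInts, Finset.mem_Icc, Int.ceil_le, Int.le_floor, abs_le]
  constructor <;> rintro ⟨h1, h2⟩ <;> constructor <;> linarith

theorem mem_flankInts {ρ d s : ℝ} (hd : 0 ≤ d) (hs : 0 ≤ s) {n : ℤ} :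
    n ∈ flankInts ρ d s ↔ d + s ≤ |(n : ℝ) - ρ| ∧ |(n : ℝ) - ρ| ≤ d + 2 * s := by
  rw [flankInts, Finset.mem_union, Finset.mem_Icc, Finset.mem_Icc, Int.ceil_le, Int.le_floor,
    Int.ceil_le, Int.le_floor]
  rcases le_total 0 ((n : ℝ) - ρ) with h | h
  · rw [abs_of_nonneg h]
    constructor
    · rintro (⟨h1, h2⟩ | ⟨h1, h2⟩) <;> constructor <;> linarith
    · rintro ⟨h1, h2⟩
      right
      constructor <;> linarith
  · rw [abs_of_nonpos h]
    constructor
    · rintro (⟨h1, h2⟩ | ⟨h1, h2⟩) <;> constructor <;> linarith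
    · rintro ⟨h1, h2⟩
      left
      constructor <;> linarith

/-- The sum of squares over the core. -/
def coreSum (M : ℤ → ℝ) (ρ d : ℝ) : ℝ := ∑ n ∈ coreInts ρ d, M n ^ 2

/-- The sum of squares over the flanking set. -/
def flankSum (M : ℤ → ℝ) (ρ d s : ℝ) : ℝ := ∑ n ∈ flankInts ρ d s, M n ^ 2

theorem coreSum_nonneg (M : ℤ → ℝ) (ρ d : ℝ) : 0 ≤ coreSum M ρ d :=
  Finset.sum_nonneg fun _ _ => by positivity

theorem card_coreInts_le {ρ d : ℝ} (hd : 0 ≤ d) : ((coreInts ρ d).card : ℝ) ≤ 2 * d + 1 := by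
  rw [coreInts, Int.card_Icc]
  have h1 : ((⌊ρ + d⌋ + 1 - ⌈ρ - d⌉ : ℤ) : ℝ) ≤ 2 * d + 1 := by
    push_cast
    linarith [Int.floor_le (ρ + d), Int.le_ceil (ρ - d)]
  rcases le_total 0 (⌊ρ + d⌋ + 1 - ⌈ρ - d⌉) with h | h
  · have h2 : (((⌊ρ + d⌋ + 1 - ⌈ρ - d⌉).toNat : ℤ) : ℝ) = ((⌊ρ + d⌋ + 1 - ⌈ρ - d⌉ : ℤ) : ℝ) := by
      rw [Int.toNat_of_nonneg h]
    rw [← h2] at h1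
    exact_mod_cast h1
  · rw [Int.toNat_of_nonpos h]
    simp
    linarith

/-! ### Summability by covering -/

theorem sum_biUnion_le {ι α : Type*} [DecidableEq ι] [DecidableEq α] {f : α → ℝ}
    (hf : ∀ a, 0 ≤ f a) (s : Finset ι) (T : ι → Finset α) :
    ∑ a ∈ s.biUnion T, f a ≤ ∑ i ∈ s, ∑ a ∈ T i, f a := by
  induction s using Finset.induction_on with
  | empty => simp
  | insert i s hi ih =>
    rw [Finset.biUnion_insert, Finset.sum_insert hi]
    have h1 := Finset.sum_union_inter (s₁ := T i) (s₂ := s.biUnion T) (f := f)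
    have h2 : 0 ≤ ∑ a ∈ T i ∩ s.biUnion T, f a := Finset.sum_nonneg fun a _ => hf a
    linarith

/-- The finite pieces may overlap: the terms are nonnegative, so each covered index is charged to
one piece containing it. -/
theorem summable_of_cover {f A : ℤ → ℝ} {T : ℕ → Finset ℤ} {B : ℕ → ℝ} (hf : ∀ n, 0 ≤ f n)
    (hA : Summable A) (hA0 : ∀ n, 0 ≤ A n) (hB : Summable B)
    (hout : ∀ n, (∀ k, n ∉ T k) → f n ≤ A n) (hT : ∀ k, ∑ n ∈ T k, f n ≤ B k) : Summable f := by
  classical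
  have hB0 : ∀ k, 0 ≤ B k := fun k => (Finset.sum_nonneg fun n _ => hf n).trans (hT k)
  refine summable_of_sum_le hf (c := ∑' n, A n + ∑' k, B k) fun s => ?_
  rw [← Finset.sum_filter_add_sum_filter_not s (fun n => ∀ k, n ∉ T k)]
  refine add_le_add ?_ ?_
  · refine (Finset.sum_le_sum fun n hn => hout n (Finset.mem_filter.1 hn).2).trans ?_
    exact hA.sum_le_tsum _ fun n _ => hA0 n
  · set s' := s.filter fun n => ¬∀ k, n ∉ T k with hs'
    have hex : ∀ n, ∃ k, n ∈ s' → n ∈ T k := by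
      intro n
      by_cases hn : n ∈ s'
      · have := (Finset.mem_filter.1 hn).2
        push Not at this
        obtain ⟨k, hk⟩ := this
        exact ⟨k, fun _ => hk⟩
      · exact ⟨0, fun h => absurd h hn⟩
    choose κ hκ using hex
    have hsub : s' ⊆ (s'.image κ).biUnion T := fun n hn =>
      Finset.mem_biUnion.2 ⟨κ n, Finset.mem_image_of_mem _ hn, hκ n hn⟩
    calc ∑ n ∈ s', f n ≤ ∑ n ∈ (s'.image κ).biUnion T, f n :=
          Finset.sum_le_sum_of_subset_of_nonneg hsub fun n _ _ => hf n
      _ ≤ ∑ k ∈ s'.image κ, ∑ n ∈ T k, f n := sum_biUnion_le hf _ _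
      _ ≤ ∑ k ∈ s'.image κ, B k := Finset.sum_le_sum fun k _ => hT k
      _ ≤ ∑' k, B k := hB.sum_le_tsum _ fun k _ => hB0 k

theorem summable_inv_one_add_abs_sq : Summable fun n : ℤ => 1 / (1 + |(n : ℝ)|) ^ 2 := by
  have h : Summable fun n : ℤ => 1 / (n : ℝ) ^ 2 := Real.summable_one_div_int_pow.2 (by norm_num)
  refine Summable.of_norm_bounded_eventually (g := fun n : ℤ => 1 / (n : ℝ) ^ 2) h ?_
  have : ∀ᶠ n : ℤ in cofinite, n ≠ 0 := (Set.finite_singleton (0 : ℤ)).compl_mem_cofinite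
  filter_upwards [this] with n hn
  have hn' : 0 < |(n : ℝ)| := abs_pos.2 (by exact_mod_cast hn)
  rw [Real.norm_eq_abs, abs_of_nonneg (by positivity), ← sq_abs (n : ℝ)]
  gcongr
  linarith

/-- The masses on the lacunary cores are too small to prevent absolute convergence. -/
theorem summable_div_one_add_abs {M : ℤ → ℝ} (hM : ∀ n, 0 ≤ M n) {ρ d : ℕ → ℝ}
    (hρ : IsLacunary ρ) (hd : ∀ k, d k ≤ 0.1 * ρ k)
    (hd3 : ∀ k, (coreInts (ρ k) (d k)).Nonempty → 1 / 3 ≤ d k)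
    (hg : ∀ k, d k * coreSum M (ρ k) (d k) * ρ k ≤ 0.01 * ρ k ^ 2)
    {A : ℤ → ℝ} (hA : Summable A) (hA0 : ∀ n, 0 ≤ A n)
    (hout : ∀ n, (∀ k, n ∉ coreInts (ρ k) (d k)) → M n ^ 2 ≤ A n) :
    Summable fun n : ℤ => M n / (1 + |(n : ℝ)|) := by
  have hB : Summable fun k : ℕ => (2 / 3 : ℝ) ^ k + 9 * (ρ 0)⁻¹ * (3 / 4) ^ k :=
    (summable_geometric_of_lt_one (by norm_num) (by norm_num)).add
      ((summable_geometric_of_lt_one (by norm_num) (by norm_num)).mul_left _)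
  refine summable_of_cover (T := fun k => coreInts (ρ k) (d k))
    (A := fun n => A n + 1 / (1 + |(n : ℝ)|) ^ 2) (fun n => by have := hM n; positivity)
    (hA.add summable_inv_one_add_abs_sq) (fun n => by have := hA0 n; positivity) hB
    (fun n hn => ?_) fun k => ?_
  · have h1 := hout n hn
    have h2 : M n / (1 + |(n : ℝ)|) ≤ M n ^ 2 + 1 / (1 + |(n : ℝ)|) ^ 2 := by
      rw [div_eq_mul_one_div, ← one_div_pow]
      nlinarith [sq_nonneg (M n - 1 / (1 + |(n : ℝ)|)), sq_nonneg (M n + 1 / (1 + |(n : ℝ)|))]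
    linarith
  · rcases Finset.eq_empty_or_nonempty (coreInts (ρ k) (d k)) with he | hne
    · rw [he, Finset.sum_empty]
      have := hρ.pos 0
      positivity
    · have hd13 := hd3 k hne
      have hr := hρ.pos k
      have hr0 := hρ.pos 0
      have hdk : 0 < d k := by linarith
      -- A weight for M/ρ ≤ t M² + 1/(t ρ²), constants aside. The bound on d g makes the first sum
      -- O((2/3)^k), while the count O(d) of integers makes the second O((3/2)^k/ρ_k) = O((3/4)^k).
      set t : ℝ := d k * (2 / 3) ^ k / ρ k with ht
      have ht0 : 0 < t := by positivity
      have hterm : ∀ n ∈ coreInts (ρ k) (d k),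
          M n / (1 + |(n : ℝ)|) ≤ t * M n ^ 2 + 1 / (t * (0.81 * ρ k ^ 2)) := by
        intro n hn
        have h1 := mem_coreInts.1 hn
        have h2 : 0.9 * ρ k ≤ 1 + |(n : ℝ)| := by
          have := (abs_le.1 h1).1
          have := hd k
          linarith [le_abs_self (n : ℝ)]
        have h3 : M n / (1 + |(n : ℝ)|) ≤ M n / (0.9 * ρ k) := by
          have := hM n
          gcongr
        refine h3.trans ?_
        have h4 : 1 / (t * (0.81 * ρ k ^ 2)) = t * (1 / (t * (0.9 * ρ k))) ^ 2 := by
          field_simp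
          norm_num
        have h5 : M n / (0.9 * ρ k) = t * (M n * (1 / (t * (0.9 * ρ k)))) := by
          field_simp
        rw [h4, h5, ← mul_add]
        refine mul_le_mul_of_nonneg_left ?_ ht0.le
        nlinarith [sq_nonneg (M n - 1 / (t * (0.9 * ρ k))), sq_nonneg (M n + 1 / (t * (0.9 * ρ k)))]
      refine (Finset.sum_le_sum hterm).trans ?_
      rw [Finset.sum_add_distrib, ← Finset.mul_sum, Finset.sum_const, nsmul_eq_mul]
      have hg1 : d k * coreSum M (ρ k) (d k) ≤ 0.01 * ρ k := by
        have := hg k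
        rw [pow_two, ← mul_assoc] at this
        exact le_of_mul_le_mul_right this hr
      refine add_le_add ?_ ?_
      · calc t * ∑ n ∈ coreInts (ρ k) (d k), M n ^ 2
            = (d k * coreSum M (ρ k) (d k)) * ((2 / 3) ^ k / ρ k) := by
              rw [ht, coreSum]; ring
          _ ≤ (0.01 * ρ k) * ((2 / 3) ^ k / ρ k) := by gcongr
          _ = 0.01 * (2 / 3) ^ k := by field_simp
          _ ≤ (2 / 3) ^ k := by
            have : (0 : ℝ) < (2 / 3) ^ k := by positivity
            linarith
      · have hcard : ((coreInts (ρ k) (d k)).card : ℝ) ≤ 5 * d k :=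
          (card_coreInts_le hdk.le).trans (by linarith)
        have h2k := hρ.two_pow_mul_le k
        calc ((coreInts (ρ k) (d k)).card : ℝ) * (1 / (t * (0.81 * ρ k ^ 2)))
            ≤ 5 * d k * (1 / (t * (0.81 * ρ k ^ 2))) := by gcongr
          _ = 5 / 0.81 * (3 / 2) ^ k / ρ k := by
            rw [ht, div_pow 2, div_pow 3]
            field_simp
          _ ≤ 9 * (3 / 2) ^ k / (2 ^ k * ρ 0) := by
            gcongr
            norm_num
          _ = 9 * (ρ 0)⁻¹ * (3 / 4) ^ k := by
            rw [show (3 / 4 : ℝ) = (3 / 2) / 2 by norm_num, div_pow (3 / 2) 2]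
            field_simp

/-! ### The chosen zeros and poles -/

/-- The poles `lam k`, `k ∈ S`, chosen in the flanking sets, together with the smallness of the
masses `M` near them. -/
structure PoleChoice (M : ℤ → ℝ) (ρ d s : ℕ → ℝ) (S : Set ℕ) (lam : ℕ → ℝ) (C₀ : ℝ) : Prop where
  lac : IsLacunary ρ
  d_nonneg : ∀ k, 0 ≤ d k
  d_le : ∀ k, d k ≤ 0.1 * ρ k
  s_nonneg : ∀ k, 0 ≤ s k
  s_le : ∀ k, s k ≤ 0.1 * ρ k
  s_pos : ∀ k ∈ S, 0 < s k
  d_le_s : ∀ k ∈ S, d k ≤ s k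
  s_sq : ∀ k, s k ^ 2 = d k * coreSum M (ρ k) (d k) * ρ k
  -- Outside S zero and pole coincide, so the factor is 1 and all products may run over every index.
  lam_off : ∀ k, k ∉ S → lam k = ρ k
  le_dist : ∀ k ∈ S, d k + 1.25 * s k ≤ |lam k - ρ k|
  dist_le : ∀ k ∈ S, |lam k - ρ k| ≤ d k + 1.75 * s k
  lam_ne : ∀ k ∈ S, ∀ n : ℤ, lam k - n ≠ 0
  le_prod : ∀ m, 0.725 ≤ ∏ j ∈ Finset.range m, lam j / ρ j
  prod_le : ∀ m, ∏ j ∈ Finset.range m, lam j / ρ j ≤ 1.275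
  flank_le : ∀ k ∈ S, s k ^ 2 * ∑ n ∈ flankInts (ρ k) (d k) (s k), M n ^ 2 * (1 / (n - lam k) ^ 2)
    ≤ C₀ * (s k * flankSum M (ρ k) (d k) (s k))

/-- The constant in the bounds for the quotient of lacunary products. -/
def poleConst : ℝ := 1000 * lacunaryConst

theorem poleConst_pos : 0 < poleConst := by
  rw [poleConst, lacunaryConst]
  positivity

namespace PoleChoice

variable {M : ℤ → ℝ} {ρ d s : ℕ → ℝ} {S : Set ℕ} {lam : ℕ → ℝ} {C₀ : ℝ}

theorem near (h : PoleChoice M ρ d s S lam C₀) : IsNear ρ lam := by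
  -- 0.275 = 0.1 + 1.75 · 0.1, from d + 1.75 s.
  have key : ∀ k, |lam k - ρ k| ≤ 0.275 * ρ k := by
    intro k
    by_cases hk : k ∈ S
    · have := h.dist_le k hk
      linarith [h.d_le k, h.s_le k]
    · rw [h.lam_off k hk, sub_self, abs_zero]
      linarith [h.lac.pos k]
  constructor
  · intro k
    linarith [(abs_le.1 (key k)).1]
  · intro k
    linarith [(abs_le.1 (key k)).2]

theorem near_self (h : PoleChoice M ρ d s S lam C₀) : IsNear ρ ρ := by
  constructor <;> intro k <;> linarith [h.lac.pos k]

/-- The partial products of the quotient. -/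
def partialProd (_ : PoleChoice M ρ d s S lam C₀) (N : ℕ) (x : ℝ) : ℝ :=
  ∏ j ∈ Finset.range N, ratioFactor (ρ j) (lam j) x

theorem abs_ratioFactor_le_of_dist (h : PoleChoice M ρ d s S lam C₀) {k : ℕ} (hk : k ∈ S) {x : ℝ}
    {e : ℝ} (he : s k ≤ e * |lam k - x|) :
    |ratioFactor (ρ k) (lam k) x| ≤ 1.275 * (1 + 2.75 * e) := by
  have hr := h.lac.pos k
  have hs := h.s_pos k hk
  have hlam : 0 < lam k := by linarith [h.near.le_left k]
  have hpos : 0 < |lam k - x| := by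
    rcases (abs_nonneg (lam k - x)).eq_or_lt with h0 | h0
    · rw [← h0, mul_zero] at he
      linarith
    · exact h0
  rw [ratioFactor, abs_mul, abs_of_pos (div_pos hlam hr)]
  refine mul_le_mul ?_ ?_ (abs_nonneg _) (by norm_num)
  · rw [div_le_iff₀ hr]
    exact h.near.le_right k
  · refine (abs_add_le _ _).trans ?_
    rw [abs_one, abs_div]
    have h1 : |ρ k - lam k| ≤ 2.75 * s k := by
      rw [abs_sub_comm]
      linarith [h.dist_le k hk, h.d_le_s k hk]
    have h2 : |ρ k - lam k| / |lam k - x| ≤ 2.75 * e := by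
      rw [div_le_iff₀ hpos]
      linarith
    linarith

/-- The pole sits in the middle half of its side of the flanking set, so an integer outside that set
is at distance at least s/4 from it. -/
theorem abs_ratioFactor_le_of_not_flank (h : PoleChoice M ρ d s S lam C₀) (k : ℕ) {n : ℤ}
    (hn : k ∈ S → n ∉ flankInts (ρ k) (d k) (s k)) : |ratioFactor (ρ k) (lam k) n| ≤ 16 := by
  by_cases hk : k ∈ S
  · have hn' := hn hk
    rw [mem_flankInts (h.d_nonneg k) (h.s_nonneg k), not_and_or, not_le, not_le] at hn'
    refine (h.abs_ratioFactor_le_of_dist hk (e := 4) ?_).trans (by norm_num)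
    have h1 := h.le_dist k hk
    have h2 := h.dist_le k hk
    rcases hn' with h3 | h3
    · have := abs_sub_abs_le_abs_sub (lam k - ρ k) ((n : ℝ) - ρ k)
      rw [sub_sub_sub_cancel_right] at this
      linarith
    · have := abs_sub_abs_le_abs_sub ((n : ℝ) - ρ k) (lam k - ρ k)
      rw [sub_sub_sub_cancel_right, abs_sub_comm (n : ℝ) (lam k)] at this
      linarith
  · rw [h.lam_off k hk, ratioFactor_self (h.lac.pos k).ne']
    norm_num

theorem abs_ratioFactor_le_of_flank (h : PoleChoice M ρ d s S lam C₀) {k : ℕ} (hk : k ∈ S) {n : ℤ}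
    (hn : n ∈ flankInts (ρ k) (d k) (s k)) :
    |ratioFactor (ρ k) (lam k) n| ≤ 12 * (s k / |lam k - n|) := by
  have hpos : 0 < |lam k - n| := abs_pos.2 (h.lam_ne k hk n)
  rw [mem_flankInts (h.d_nonneg k) (h.s_nonneg k)] at hn
  have h1 := h.abs_ratioFactor_le_of_dist hk (x := n) (e := s k / |lam k - n|)
    (by rw [div_mul_cancel₀ _ hpos.ne'])
  have h2 : 1 ≤ 6 * (s k / |lam k - n|) := by
    rw [← mul_div_assoc, le_div_iff₀ hpos]
    have h3 := abs_sub (lam k - ρ k) ((n : ℝ) - ρ k)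
    rw [sub_sub_sub_cancel_right] at h3
    linarith [h.dist_le k hk, h.d_le_s k hk]
  refine h1.trans ?_
  have h3 : 0 ≤ s k / |lam k - n| := div_nonneg (h.s_nonneg k) hpos.le
  linarith

/-- The zones [0.7ρ, 1.3ρ] are disjoint, because 1.3 < 0.7 · 2. -/
theorem zone_unique (h : PoleChoice M ρ d s S lam C₀) {j k : ℕ} {x : ℝ}
    (hj : |x - ρ j| ≤ 0.3 * ρ j) (hk : |x - ρ k| ≤ 0.3 * ρ k) : j = k := by
  rw [abs_le] at hj hk
  rcases lt_trichotomy j k with hjk | hjk | hjk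
  · have := h.lac.two_mul_le_of_lt hjk
    linarith [h.lac.pos j]
  · exact hjk
  · have := h.lac.two_mul_le_of_lt hjk
    linarith [h.lac.pos k]

theorem zone_of_flank (h : PoleChoice M ρ d s S lam C₀) {k : ℕ} {n : ℤ}
    (hn : n ∈ flankInts (ρ k) (d k) (s k)) : |(n : ℝ) - ρ k| ≤ 0.3 * ρ k := by
  have := ((mem_flankInts (h.d_nonneg k) (h.s_nonneg k)).1 hn).2
  linarith [h.d_le k, h.s_le k]

theorem zone_of_core (h : PoleChoice M ρ d s S lam C₀) {k : ℕ} {n : ℤ}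
    (hn : n ∈ coreInts (ρ k) (d k)) : |(n : ℝ) - ρ k| ≤ 0.3 * ρ k := by
  have := mem_coreInts.1 hn
  linarith [h.d_le k, h.lac.pos k]

open Classical in
/-- The size of the pole factor at an integer of a flanking set, and zero elsewhere. -/
def poleWeight (_ : PoleChoice M ρ d s S lam C₀) (n : ℤ) : ℝ :=
  if hn : ∃ k ∈ S, n ∈ flankInts (ρ k) (d k) (s k) then s hn.choose / |lam hn.choose - n| else 0

theorem poleWeight_of_flank (h : PoleChoice M ρ d s S lam C₀) {k : ℕ} (hk : k ∈ S) {n : ℤ}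
    (hn : n ∈ flankInts (ρ k) (d k) (s k)) : h.poleWeight n = s k / |lam k - n| := by
  have hex : ∃ k ∈ S, n ∈ flankInts (ρ k) (d k) (s k) := ⟨k, hk, hn⟩
  have heq : hex.choose = k :=
    h.zone_unique (h.zone_of_flank hex.choose_spec.2) (h.zone_of_flank hn)
  rw [poleWeight, dif_pos hex, heq]

theorem poleWeight_of_not_flank (h : PoleChoice M ρ d s S lam C₀) {n : ℤ}
    (hn : ∀ k ∈ S, n ∉ flankInts (ρ k) (d k) (s k)) : h.poleWeight n = 0 := by
  rw [poleWeight, dif_neg]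
  rintro ⟨k, hk, hkn⟩
  exact hn k hk hkn

theorem poleWeight_nonneg (h : PoleChoice M ρ d s S lam C₀) (n : ℤ) : 0 ≤ h.poleWeight n := by
  rw [poleWeight]
  split_ifs with hn
  · exact div_nonneg (h.s_nonneg _) (abs_nonneg _)
  · exact le_rfl

/-- Of the two neighbouring factors left uncontrolled by lacunarity, at most one has the integer in
its flanking set, so the weight enters only to the first power. -/
theorem abs_partialProd_le (h : PoleChoice M ρ d s S lam C₀) (N : ℕ) (n : ℤ) :
    |h.partialProd N n| ≤ poleConst * (1 + h.poleWeight n) := by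
  classical
  have hE := h.poleWeight_nonneg n
  set V : ℕ → ℝ := fun j =>
    16 + if j ∈ S ∧ n ∈ flankInts (ρ j) (d j) (s j) then 12 * h.poleWeight n else 0 with hV
  have hV16 : ∀ j, 16 ≤ V j := fun j => by
    simp only [hV]
    split_ifs <;> linarith
  have hVle : ∀ j, V j ≤ 16 + 12 * h.poleWeight n := fun j => by
    simp only [hV]
    split_ifs <;> linarith
  obtain ⟨p, hp⟩ := exists_prod_ratioFactor_le h.lac h.near_self h.near h.prod_le (n : ℝ) (V := V)
    (fun j => by linarith [hV16 j]) fun j => by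
      by_cases hj : j ∈ S ∧ n ∈ flankInts (ρ j) (d j) (s j)
      · have := h.abs_ratioFactor_le_of_flank hj.1 hj.2
        rw [← h.poleWeight_of_flank hj.1 hj.2] at this
        simp only [hV, if_pos hj]
        linarith
      · have := h.abs_ratioFactor_le_of_not_flank j (n := n) fun hjS hjn => hj ⟨hjS, hjn⟩
        simp only [hV, if_neg hj]
        linarith
  have hVV : V p * V (p + 1) ≤ 16 * (16 + 12 * h.poleWeight n) := by
    have h16 : V p = 16 ∨ V (p + 1) = 16 := by
      by_contra hcon
      rw [not_or] at hcon
      have h1 : p ∈ S ∧ n ∈ flankInts (ρ p) (d p) (s p) := by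
        by_contra h0
        exact hcon.1 (by simp only [hV, if_neg h0, add_zero])
      have h2 : p + 1 ∈ S ∧ n ∈ flankInts (ρ (p + 1)) (d (p + 1)) (s (p + 1)) := by
        by_contra h0
        exact hcon.2 (by simp only [hV, if_neg h0, add_zero])
      have := h.zone_unique (h.zone_of_flank h1.2) (h.zone_of_flank h2.2)
      omega
    rcases h16 with h1 | h1
    · rw [h1]
      linarith [hVle (p + 1)]
    · rw [h1]
      linarith [hVle p]
  have hL : 0 < lacunaryConst := Real.exp_pos _
  refine (hp N).trans ?_
  calc 1.275 * lacunaryConst * (V p * V (p + 1))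
      ≤ 1.275 * lacunaryConst * (16 * (16 + 12 * h.poleWeight n)) := by gcongr
    _ = lacunaryConst * (326.4 + 244.8 * h.poleWeight n) := by ring
    _ ≤ lacunaryConst * (1000 * (1 + h.poleWeight n)) := by
      gcongr
      linarith
    _ = _ := by rw [poleConst]; ring

/-- On the k-th core the zero is within d_k and the pole is at distance at least s_k. The other
factors are bounded by the general estimate, applied with the k-th zero and pole both replaced by
ρ_k. -/
theorem abs_partialProd_core_le (h : PoleChoice M ρ d s S lam C₀) {k : ℕ} (hk : k ∈ S) {n : ℤ}
    (hn : n ∈ coreInts (ρ k) (d k)) {N : ℕ} (hN : k < N) :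
    |h.partialProd N n| ≤ poleConst * (d k / s k) := by
  classical
  have hr := h.lac.pos k
  have hs := h.s_pos k hk
  have hupd : Function.update ρ k (ρ k) = ρ := Function.update_eq_self k ρ
  have hB := prod_update_le h.lac h.near_self h.near h.prod_le k
  obtain ⟨p, hp⟩ := exists_prod_ratioFactor_le h.lac (h.near_self.update h.lac k)
    (h.near.update h.lac k) hB (n : ℝ) (V := fun _ => 16) (fun _ => by norm_num) fun j => by
      by_cases hj : j = k
      · subst hj
        rw [Function.update_self, Function.update_self, ratioFactor_self hr.ne']
        norm_num
      · rw [Function.update_of_ne hj, Function.update_of_ne hj]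
        refine h.abs_ratioFactor_le_of_not_flank j fun _ hjn => hj ?_
        exact h.zone_unique (h.zone_of_flank hjn) (h.zone_of_core hn)
  have hpN := hp N
  have hkN : k ∈ Finset.range N := Finset.mem_range.2 hN
  have he : ∏ j ∈ Finset.range N,
      ratioFactor (Function.update ρ k (ρ k) j) (Function.update lam k (ρ k) j) n
      = ∏ j ∈ (Finset.range N).erase k, ratioFactor (ρ j) (lam j) n := by
    rw [← Finset.mul_prod_erase _ _ hkN, Function.update_self, Function.update_self,
      ratioFactor_self hr.ne', one_mul]
    refine Finset.prod_congr rfl fun j hj => ?_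
    rw [Function.update_of_ne (Finset.ne_of_mem_erase hj),
      Function.update_of_ne (Finset.ne_of_mem_erase hj)]
  rw [he] at hpN
  have hfac : |ratioFactor (ρ k) (lam k) n| ≤ 1.275 * (d k / s k) := by
    have hcore := mem_coreInts.1 hn
    have hlamn : s k ≤ |lam k - n| := by
      have := abs_sub_abs_le_abs_sub (lam k - ρ k) ((n : ℝ) - ρ k)
      rw [sub_sub_sub_cancel_right] at this
      linarith [h.le_dist k hk]
    have hlam : 0 < lam k := by linarith [h.near.le_left k]
    rw [ratioFactor_eq (h.lam_ne k hk n), abs_div, abs_mul, abs_mul, abs_of_pos hlam,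
      abs_of_pos hr, mul_div_mul_comm]
    refine mul_le_mul ?_ ?_ (by positivity) (by norm_num)
    · rw [div_le_iff₀ hr]
      exact h.near.le_right k
    · rw [abs_sub_comm]
      gcongr
      exact h.d_nonneg k
  have hL : 0 < lacunaryConst := Real.exp_pos _
  have hds : 0 ≤ d k / s k := div_nonneg (h.d_nonneg k) hs.le
  rw [partialProd, ← Finset.mul_prod_erase _ _ hkN, abs_mul]
  calc _ ≤ 1.275 * (d k / s k) * (2 * 1.275 * lacunaryConst * (16 * 16)) := by gcongr
    _ = 832.32 * (lacunaryConst * (d k / s k)) := by ring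
    _ ≤ 1000 * (lacunaryConst * (d k / s k)) := by gcongr; norm_num
    _ = _ := by rw [poleConst]; ring

theorem exists_tendsto_partialProd (h : PoleChoice M ρ d s S lam C₀) (x : ℝ) :
    ∃ y, Tendsto (fun N => h.partialProd N x) atTop (𝓝 y) := by
  have hsum : Summable fun j => ‖ratioFactor (ρ j) (lam j) x - 1‖ := by
    refine Summable.of_norm_bounded_eventually_nat
      (g := fun j => 4 * (|x| * (ρ j)⁻¹)) ((h.lac.summable_inv.mul_left _).mul_left _) ?_
    obtain ⟨p, hp⟩ := h.lac.exists_gt (2 * |x|)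
    filter_upwards [eventually_ge_atTop p] with j hj
    rw [norm_norm, Real.norm_eq_abs]
    exact abs_ratioFactor_sub_one_large (h.lac.pos j) (h.near_self.le_left j)
      (h.near_self.le_right j) (h.near.le_left j) (h.near.le_right j)
      (hp.le.trans (h.lac.monotone hj))
  have hm := multipliable_one_add_of_summable hsum
  refine ⟨_, hm.hasProd.tendsto_prod_nat.congr fun N => ?_⟩
  rw [partialProd]
  exact Finset.prod_congr rfl fun j _ => by ring

/-- The quotient of the two infinite products. -/
def quotient (h : PoleChoice M ρ d s S lam C₀) (x : ℝ) : ℝ :=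
  (h.exists_tendsto_partialProd x).choose

theorem tendsto_quotient (h : PoleChoice M ρ d s S lam C₀) (x : ℝ) :
    Tendsto (fun N => h.partialProd N x) atTop (𝓝 (h.quotient x)) :=
  (h.exists_tendsto_partialProd x).choose_spec

theorem quotient_zero (h : PoleChoice M ρ d s S lam C₀) : h.quotient 0 = 1 := by
  refine tendsto_nhds_unique (h.tendsto_quotient 0) (tendsto_const_nhds.congr fun N => ?_)
  rw [partialProd, Finset.prod_eq_one]
  intro j _
  have := h.lac.pos j
  exact ratioFactor_zero this.ne' (by linarith [h.near.le_left j])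

theorem abs_quotient_le (h : PoleChoice M ρ d s S lam C₀) (n : ℤ) :
    |h.quotient n| ≤ poleConst * (1 + h.poleWeight n) :=
  le_of_tendsto (h.tendsto_quotient n).abs (Eventually.of_forall fun N => h.abs_partialProd_le N n)

theorem abs_quotient_core_le (h : PoleChoice M ρ d s S lam C₀) {k : ℕ} (hk : k ∈ S) {n : ℤ}
    (hn : n ∈ coreInts (ρ k) (d k)) : |h.quotient n| ≤ poleConst * (d k / s k) :=
  le_of_tendsto (h.tendsto_quotient n).abs (by
    filter_upwards [eventually_gt_atTop k] with N hN using h.abs_partialProd_core_le hk hn hN)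

/-- The scale s_k is made for this: s² = d g ρ turns (d/s)² g into d/ρ. -/
theorem sum_core_quotient_le (h : PoleChoice M ρ d s S lam C₀) {k : ℕ} (hk : k ∈ S) :
    ∑ n ∈ coreInts (ρ k) (d k), (M n * h.quotient n) ^ 2 ≤ poleConst ^ 2 * (d k / ρ k) := by
  have hs := h.s_pos k hk
  have hr := h.lac.pos k
  calc ∑ n ∈ coreInts (ρ k) (d k), (M n * h.quotient n) ^ 2
      ≤ ∑ n ∈ coreInts (ρ k) (d k), M n ^ 2 * (poleConst * (d k / s k)) ^ 2 := by
        refine Finset.sum_le_sum fun n hn => ?_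
        rw [mul_pow, ← sq_abs (h.quotient n)]
        have := h.abs_quotient_core_le hk hn
        gcongr
    _ = poleConst ^ 2 * (d k * (d k * coreSum M (ρ k) (d k) * ρ k) / s k ^ 2 / ρ k) := by
        rw [← Finset.sum_mul, coreSum]
        field_simp
    _ = poleConst ^ 2 * (d k / ρ k) := by
        rw [← h.s_sq k, mul_div_cancel_right₀ _ (by positivity)]

theorem sum_flank_weight_le (h : PoleChoice M ρ d s S lam C₀) {k : ℕ} (hk : k ∈ S) :
    ∑ n ∈ flankInts (ρ k) (d k) (s k), (M n * h.poleWeight n) ^ 2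
      ≤ C₀ * (s k * flankSum M (ρ k) (d k) (s k)) := by
  refine le_trans (le_of_eq ?_) (h.flank_le k hk)
  rw [Finset.mul_sum]
  refine Finset.sum_congr rfl fun n hn => ?_
  rw [h.poleWeight_of_flank hk hn, mul_pow, div_pow, sq_abs,
    show ((n : ℝ) - lam k) ^ 2 = (lam k - n) ^ 2 by ring]
  ring

theorem summable_mul_weight_sq (h : PoleChoice M ρ d s S lam C₀)
    (hflank : Summable fun k => s k * flankSum M (ρ k) (d k) (s k)) :
    Summable fun n : ℤ => (M n * h.poleWeight n) ^ 2 := by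
  classical
  have hnn : ∀ k, 0 ≤ s k * flankSum M (ρ k) (d k) (s k) := fun k =>
    mul_nonneg (h.s_nonneg k) (Finset.sum_nonneg fun _ _ => by positivity)
  refine summable_of_cover (T := fun k => if k ∈ S then flankInts (ρ k) (d k) (s k) else ∅)
    (A := fun _ => 0) (fun n => by positivity) summable_zero (fun _ => le_rfl)
    (hflank.mul_left |C₀|) (fun n hn => ?_) fun k => ?_
  · rw [h.poleWeight_of_not_flank, mul_zero]
    · simp
    · intro k hk hkn
      have := hn k
      rw [if_pos hk] at this
      exact this hkn
  · split_ifs with hk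
    · exact (h.sum_flank_weight_le hk).trans
        (mul_le_mul_of_nonneg_right (le_abs_self _) (hnn k))
    · rw [Finset.sum_empty]
      exact mul_nonneg (abs_nonneg _) (hnn k)

/-- Cores in S contribute O(d_k/ρ_k). Cores outside S meet no flanking set of S, so the quotient is
bounded there and their total mass is finite by `hoff`. Off the cores the squares are dominated by
the summable mass and the weighted flank sums. -/
theorem summable_mul_quotient_sq (h : PoleChoice M ρ d s S lam C₀)
    (hflank : Summable fun k => s k * flankSum M (ρ k) (d k) (s k))
    (hdρ : Summable fun k => d k / ρ k)
    (hoff : Summable fun k => Sᶜ.indicator (fun k => coreSum M (ρ k) (d k)) k)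
    {A : ℤ → ℝ} (hA : Summable A) (hA0 : ∀ n, 0 ≤ A n)
    (hout : ∀ n, (∀ k, n ∉ coreInts (ρ k) (d k)) → M n ^ 2 ≤ A n) :
    Summable fun n : ℤ => (M n * h.quotient n) ^ 2 := by
  classical
  have hC := poleConst_pos
  have hgen : ∀ n, (M n * h.quotient n) ^ 2
      ≤ 2 * poleConst ^ 2 * (M n ^ 2 + (M n * h.poleWeight n) ^ 2) := by
    intro n
    have h1 := h.abs_quotient_le n
    have h2 : h.quotient n ^ 2 ≤ (poleConst * (1 + h.poleWeight n)) ^ 2 := by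
      rw [← sq_abs (h.quotient n)]
      gcongr
    have h3 : (1 + h.poleWeight n) ^ 2 ≤ 2 * (1 + h.poleWeight n ^ 2) := by
      nlinarith [sq_nonneg (1 - h.poleWeight n)]
    calc (M n * h.quotient n) ^ 2 = M n ^ 2 * h.quotient n ^ 2 := by ring
      _ ≤ M n ^ 2 * (poleConst * (1 + h.poleWeight n)) ^ 2 := by gcongr
      _ = poleConst ^ 2 * M n ^ 2 * (1 + h.poleWeight n) ^ 2 := by ring
      _ ≤ poleConst ^ 2 * M n ^ 2 * (2 * (1 + h.poleWeight n ^ 2)) := by gcongr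
      _ = _ := by ring
  have hw := h.summable_mul_weight_sq hflank
  refine summable_of_cover (T := fun k => coreInts (ρ k) (d k))
    (A := fun n => 2 * poleConst ^ 2 * (A n + (M n * h.poleWeight n) ^ 2))
    (B := fun k => poleConst ^ 2 * (d k / ρ k)
      + 2 * poleConst ^ 2 * Sᶜ.indicator (fun k => coreSum M (ρ k) (d k)) k)
    (fun n => by positivity) ((hA.add hw).mul_left _) (fun n => by have := hA0 n; positivity)
    ((hdρ.mul_left _).add (hoff.mul_left _)) (fun n hn => ?_) fun k => ?_
  · refine (hgen n).trans ?_
    have := hout n hn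
    gcongr
  · by_cases hk : k ∈ S
    · rw [Set.indicator_of_notMem (by simpa using hk), mul_zero, add_zero]
      exact h.sum_core_quotient_le hk
    · rw [Set.indicator_of_mem (by simpa using hk)]
      have h1 : 0 ≤ poleConst ^ 2 * (d k / ρ k) := by
        have := h.d_nonneg k
        have := h.lac.pos k
        positivity
      refine le_trans ?_ (le_add_of_nonneg_left h1)
      rw [coreSum, Finset.mul_sum]
      refine Finset.sum_le_sum fun n hn => (hgen n).trans ?_
      rw [h.poleWeight_of_not_flank, mul_zero]
      · simp
      · intro j hj hjn
        have := h.zone_unique (h.zone_of_flank hjn) (h.zone_of_core hn)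
        exact hk (this ▸ hj)

/-- The dominating series for passing from partial products to the infinite quotient. -/
theorem summable_majorant (h : PoleChoice M ρ d s S lam C₀)
    (hM : ∀ n, 0 ≤ M n)
    (hflank : Summable fun k => s k * flankSum M (ρ k) (d k) (s k))
    (hsum : Summable fun n : ℤ => M n / (1 + |(n : ℝ)|)) :
    Summable fun n : ℤ => M n * (1 + h.poleWeight n) / (1 + |(n : ℝ)|) := by
  refine Summable.of_nonneg_of_le (fun n => ?_) (fun n => ?_)
    (hsum.add ((h.summable_mul_weight_sq hflank).add summable_inv_one_add_abs_sq))
  · have := hM n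
    have := h.poleWeight_nonneg n
    positivity
  · rw [mul_add, mul_one, add_div]
    gcongr
    rw [div_eq_mul_one_div, ← one_div_pow]
    nlinarith [sq_nonneg (M n * h.poleWeight n - 1 / (1 + |(n : ℝ)|)),
      sq_nonneg (M n * h.poleWeight n + 1 / (1 + |(n : ℝ)|))]

end PoleChoice


/-! ### Choice of the poles -/

/-- The indices at which the core mass is not negligible. -/
def heavySet (M : ℤ → ℝ) (ρ d : ℕ → ℝ) (K₀ : ℕ) : Set ℕ :=
  {k | K₀ ≤ k ∧ d k / ρ k + (3 / 4) ^ k < coreSum M (ρ k) (d k)}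

theorem summable_indicator_compl_heavySet (M : ℤ → ℝ) {ρ d : ℕ → ℝ}
    (hdρ0 : ∀ k, 0 ≤ d k / ρ k)
    (hdρ : Summable fun k => d k / ρ k) (K₀ : ℕ) :
    Summable fun k => (heavySet M ρ d K₀)ᶜ.indicator (fun k => coreSum M (ρ k) (d k)) k := by
  refine Summable.of_norm_bounded_eventually_nat (g := fun k => d k / ρ k + (3 / 4 : ℝ) ^ k)
    (hdρ.add (summable_geometric_of_lt_one (by norm_num) (by norm_num))) ?_
  filter_upwards [eventually_ge_atTop K₀] with k hk
  rw [Real.norm_eq_abs, abs_of_nonneg (Set.indicator_nonneg (fun k _ => coreSum_nonneg M _ _) k)]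
  by_cases hkS : k ∈ heavySet M ρ d K₀
  · rw [Set.indicator_of_notMem (by simpa using hkS)]
    have := hdρ0 k
    positivity
  · rw [Set.indicator_of_mem (by simpa using hkS)]
    by_contra hcon
    exact hkS ⟨hk, not_le.1 hcon⟩

/-- The condition g > d/ρ gives s² ≥ d². The condition g > (3/4)^k, with ρ_k ≥ 2^k ρ_0 and d ≥ 1/3,
makes s² grow at least like (3/2)^k, so the flanking sets become long enough to contain many
frequencies. -/
theorem eventually_large_of_mem_heavySet {M : ℤ → ℝ} {ρ d s : ℕ → ℝ} (hρ : IsLacunary ρ)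
    (hd3 : ∀ k, (coreInts (ρ k) (d k)).Nonempty → 1 / 3 ≤ d k) (hd0 : ∀ k, 0 ≤ d k)
    (hs0 : ∀ k, 0 ≤ s k)
    (hs : ∀ k, s k ^ 2 = d k * coreSum M (ρ k) (d k) * ρ k) (L : ℝ) :
    ∃ K₁, ∀ K₀, K₁ ≤ K₀ → ∀ k ∈ heavySet M ρ d K₀, L ≤ s k ∧ d k ≤ s k ∧ 0 < s k := by
  have hρ0 := hρ.pos 0
  have ht : Tendsto (fun k : ℕ => (ρ 0 / 3) * (3 / 2 : ℝ) ^ k) atTop atTop :=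
    (tendsto_pow_atTop_atTop_of_one_lt (by norm_num)).const_mul_atTop (by positivity)
  obtain ⟨K₁, hK₁⟩ := eventually_atTop.1 (ht.eventually_ge_atTop (L ^ 2))
  refine ⟨K₁, fun K₀ hK₀ k hk => ?_⟩
  have hr := hρ.pos k
  have h34 : (0 : ℝ) < (3 / 4) ^ k := by positivity
  have hdr : 0 ≤ d k / ρ k := div_nonneg (hd0 k) hr.le
  have hd13 : 1 / 3 ≤ d k := by
    refine hd3 k (Finset.nonempty_iff_ne_empty.2 fun he => ?_)
    have := hk.2
    rw [coreSum, he, Finset.sum_empty] at this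
    linarith
  have hsq1 : d k ^ 2 ≤ s k ^ 2 := by
    rw [hs k]
    calc d k ^ 2 = d k * (d k / ρ k) * ρ k := by field_simp
      _ ≤ d k * coreSum M (ρ k) (d k) * ρ k := by
        have := hd0 k
        have : d k / ρ k ≤ coreSum M (ρ k) (d k) := by linarith [hk.2]
        gcongr
  have hds : d k ≤ s k := (abs_le_of_sq_le_sq' hsq1 (hs0 k)).2
  refine ⟨?_, hds, by linarith⟩
  refine (abs_le_of_sq_le_sq' ((hK₁ k (hK₀.trans hk.1)).trans ?_) (hs0 k)).2
  rw [hs k]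
  calc ρ 0 / 3 * (3 / 2) ^ k = 1 / 3 * (3 / 4) ^ k * (2 ^ k * ρ 0) := by
        rw [show (3 / 2 : ℝ) = 3 / 4 * 2 by norm_num, mul_pow]
        ring
    _ ≤ d k * coreSum M (ρ k) (d k) * ρ k := by
      have h1 : (3 / 4 : ℝ) ^ k ≤ coreSum M (ρ k) (d k) := by linarith [hk.2]
      have h2 := hρ.two_pow_mul_le k
      have := hd0 k
      have := coreSum_nonneg M (ρ k) (d k)
      gcongr

/-- The poles can be chosen among the frequencies. -/
theorem exists_poleChoice {Λ : Set ℂ} {δ c : ℝ} (hδ : 0 < δ) (hc1 : 1 ≤ c)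
    (hsep : ∀ n : ℤ, ∀ l ∈ Λ, δ ≤ dist (n : ℂ) l)
    (hc : ∀ a b : ℝ, c ≤ b - a → ∃ x ∈ Set.Icc a b, (x : ℂ) ∈ Λ)
    {M : ℤ → ℝ} {ρ d s : ℕ → ℝ} (hρ : IsLacunary ρ)
    (hd3 : ∀ k, (coreInts (ρ k) (d k)).Nonempty → 1 / 3 ≤ d k) (hd0 : ∀ k, 0 ≤ d k)
    (hdle : ∀ k, d k ≤ 0.1 * ρ k) (hs0 : ∀ k, 0 ≤ s k) (hsle : ∀ k, s k ≤ 0.1 * ρ k)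
    (hs : ∀ k, s k ^ 2 = d k * coreSum M (ρ k) (d k) * ρ k) :
    ∃ C₀ : ℝ, ∃ K₁ : ℕ, ∀ K₀, K₁ ≤ K₀ → ∃ lam : ℕ → ℝ,
      PoleChoice M ρ d s (heavySet M ρ d K₀) lam C₀ ∧
        ∀ k ∈ heavySet M ρ d K₀, (lam k : ℂ) ∈ Λ := by
  classical
  set K : ℝ := 1 / δ ^ 2 + 4 * ∑' j : ℤ, 1 / (j : ℝ) ^ 2 with hK
  obtain ⟨K₁, hK₁⟩ := eventually_large_of_mem_heavySet hρ hd3 hd0 hs0 hs (4 * c)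
  refine ⟨8 * c * K, K₁, fun K₀ hK₀ => ?_⟩
  set S := heavySet M ρ d K₀ with hS
  have hex : ∀ (A : ℕ → ℝ) k, ∃ x : ℝ, k ∈ S → x ∈ Set.Icc (A k) (A k + s k / 2) ∧ (x : ℂ) ∈ Λ ∧
      s k ^ 2 * ∑ n ∈ flankInts (ρ k) (d k) (s k), M n ^ 2 * (1 / ((n : ℝ) - x) ^ 2)
        ≤ 8 * c * K * (s k * flankSum M (ρ k) (d k) (s k)) := by
    intro A k
    by_cases hk : k ∈ S
    · obtain ⟨hL, -, hpos⟩ := hK₁ K₀ hK₀ k hk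
      obtain ⟨x, hx, hxΛ, hle⟩ := exists_good_frequency hδ hc1 hsep hc (A := A k) (L := s k / 2)
        (by linarith) (flankInts (ρ k) (d k) (s k)) M
      refine ⟨x, fun _ => ⟨hx, hxΛ, ?_⟩⟩
      calc _ ≤ s k ^ 2 * (4 * c * K / (s k / 2)
            * ∑ n ∈ flankInts (ρ k) (d k) (s k), M n ^ 2) := by gcongr
        _ = _ := by rw [flankSum]; field_simp; ring
    · exact ⟨0, fun h => absurd h hk⟩
  -- Both search windows have length s/2 and are the middle halves of the right and left flanks.
  -- They give a factor lam/ρ at least 1 and at most 1 respectively, the two options needed for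
  -- balancing.
  choose P hP using hex fun k => ρ k + d k + 1.25 * s k
  choose Q hQ using hex fun k => ρ k - d k - 1.75 * s k
  have hp : ∀ k, 1 ≤ (if k ∈ S then P k / ρ k else 1) ∧
      (if k ∈ S then P k / ρ k else 1) ≤ 1.275 := by
    intro k
    have hr := hρ.pos k
    split_ifs with hk
    · obtain ⟨⟨h1, h2⟩, -⟩ := hP k hk
      rw [le_div_iff₀ hr, div_le_iff₀ hr]
      constructor <;> linarith [hd0 k, hs0 k, hdle k, hsle k]
    · norm_num
  have hm : ∀ k, 0.725 ≤ (if k ∈ S then Q k / ρ k else 1) ∧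
      (if k ∈ S then Q k / ρ k else 1) ≤ 1 := by
    intro k
    have hr := hρ.pos k
    split_ifs with hk
    · obtain ⟨⟨h1, h2⟩, -⟩ := hQ k hk
      rw [le_div_iff₀ hr, div_le_iff₀ hr]
      constructor <;> linarith [hd0 k, hs0 k, hdle k, hsle k]
    · norm_num
  obtain ⟨σ, hσ, hprod⟩ := exists_balanced_choice (by norm_num) (by norm_num) (by norm_num) hp hm
  let lam : ℕ → ℝ := fun k => if k ∈ S then (if σ k then P k else Q k) else ρ k
  have hlam : ∀ k, lam k / ρ k
      = if σ k then (if k ∈ S then P k / ρ k else 1) else (if k ∈ S then Q k / ρ k else 1) := by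
    intro k
    have hr := (hρ.pos k).ne'
    simp only [lam]
    split_ifs <;> simp [hr]
  have hcase : ∀ k ∈ S, (lam k = P k) ∨ (lam k = Q k) := by
    intro k hk
    simp only [lam, if_pos hk]
    split_ifs <;> simp
  have hmem : ∀ k ∈ S, (lam k : ℂ) ∈ Λ := by
    intro k hk
    rcases hcase k hk with h | h <;> rw [h]
    · exact (hP k hk).2.1
    · exact (hQ k hk).2.1
  refine ⟨lam, ⟨hρ, hd0, hdle, hs0, hsle, fun k hk => (hK₁ K₀ hK₀ k hk).2.2,
    fun k hk => (hK₁ K₀ hK₀ k hk).2.1, hs, fun k hk => if_neg hk, fun k hk => ?_, fun k hk => ?_,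
    fun k hk n h0 => ?_, fun m => ?_, fun m => ?_, fun k hk => ?_⟩, hmem⟩
  · have := hd0 k
    have := hs0 k
    rcases hcase k hk with h | h <;> rw [h]
    · obtain ⟨⟨h1, h2⟩, -⟩ := hP k hk
      rw [abs_of_nonneg] <;> linarith
    · obtain ⟨⟨h1, h2⟩, -⟩ := hQ k hk
      rw [abs_of_nonpos] <;> linarith
  · have := hd0 k
    have := hs0 k
    rcases hcase k hk with h | h <;> rw [h]
    · obtain ⟨⟨h1, h2⟩, -⟩ := hP k hk
      rw [abs_of_nonneg] <;> linarith
    · obtain ⟨⟨h1, h2⟩, -⟩ := hQ k hk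
      rw [abs_of_nonpos] <;> linarith
  · have h1 := hsep n _ (hmem k hk)
    rw [sub_eq_zero.1 h0] at h1
    simp at h1
    linarith
  · simpa only [hlam] using (hprod m).1
  · simpa only [hlam] using (hprod m).2
  · rcases hcase k hk with h | h <;> rw [h]
    · exact (hP k hk).2.2
    · exact (hQ k hk).2.2


/-! ### Vanishing of the modified interpolation series -/

theorem inv_norm_int_sub_le {δ : ℝ} (hδ : 0 < δ) {μ : ℂ} (hμ : ∀ n : ℤ, δ ≤ dist (n : ℂ) μ)
    (n : ℤ) :
    1 / ‖(n : ℂ) - μ‖ ≤ (1 + (1 + ‖μ‖) / δ) * (1 / (1 + |(n : ℝ)|)) := by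
  have h1 := hμ n
  rw [dist_eq_norm] at h1
  have hpos : 0 < ‖(n : ℂ) - μ‖ := hδ.trans_le h1
  have hn : 0 < 1 + |(n : ℝ)| := by positivity
  rw [mul_one_div, div_le_div_iff₀ hpos hn, one_mul]
  have h2 : |(n : ℝ)| ≤ ‖(n : ℂ) - μ‖ + ‖μ‖ := by
    have := norm_add_le ((n : ℂ) - μ) μ
    rwa [sub_add_cancel, Complex.norm_intCast] at this
  have h3 : 1 + ‖μ‖ ≤ (1 + ‖μ‖) / δ * ‖(n : ℂ) - μ‖ := by
    rw [div_mul_eq_mul_div, le_div_iff₀ hδ]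
    gcongr
  linarith

namespace PoleChoice

variable {M : ℤ → ℝ} {ρ d s : ℕ → ℝ} {S : Set ℕ} {lam : ℕ → ℝ} {C₀ : ℝ}

theorem lam_injective (h : PoleChoice M ρ d s S lam C₀) : Function.Injective lam := by
  have key : ∀ j k, j < k → lam j < lam k := fun j k hjk => by
    have h1 := h.lac.two_mul_le_of_lt hjk
    linarith [h.near.le_right j, h.near.le_left k, h.lac.pos j]
  intro j k hjk
  rcases lt_trichotomy j k with h1 | h1 | h1
  · exact absurd hjk (key j k h1).ne
  · exact h1
  · exact absurd hjk (key k j h1).ne'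

/-- Introducing the factor N splits by partial fractions into the series at μ and at `lam N`, both
of which vanish by induction. The induction must therefore carry all unused frequencies μ at once.
-/
theorem hasSum_partialProd_zero (h : PoleChoice M ρ d s S lam C₀) {Λ : Set ℂ} {γ : ℤ → ℂ}
    (hγ : ∀ l ∈ Λ, HasSum (fun n : ℤ => (-1) ^ n * γ n / (n - l)) 0)
    (hlam : ∀ k ∈ S, (lam k : ℂ) ∈ Λ) (hΛ : ∀ l ∈ Λ, ∀ n : ℤ, (n : ℂ) - l ≠ 0) (N : ℕ) :
    ∀ μ ∈ Λ, (∀ j ∈ S, j < N → μ ≠ lam j) →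
      HasSum (fun n : ℤ => (-1) ^ n * γ n * (h.partialProd N n : ℂ) / (n - μ)) 0 := by
  induction N with
  | zero =>
    intro μ hμ _
    simpa [partialProd] using hγ μ hμ
  | succ N ih =>
    intro μ hμ hne
    have h1 := ih μ hμ fun j hj hjN => hne j hj (hjN.trans N.lt_succ_self)
    by_cases hN : N ∈ S
    · have h2 := ih (lam N) (hlam N hN) fun j _ hjN hcon =>
        hjN.ne' (h.lam_injective (by exact_mod_cast hcon))
      have hμN : (lam N : ℂ) - μ ≠ 0 := sub_ne_zero.2 (hne N hN N.lt_succ_self).symm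
      have h3 := (h1.sub ((h2.sub h1).mul_left (((ρ N : ℂ) - lam N) / (lam N - μ)))).mul_left
        ((lam N : ℂ) / ρ N)
      simp only [sub_zero, mul_zero] at h3
      refine h3.of_eq fun n => ?_
      have e1 := hΛ μ hμ n
      have e2 := hΛ _ (hlam N hN) n
      have e3 : (lam N : ℂ) - n ≠ 0 := by
        rw [← neg_sub]
        exact neg_ne_zero.2 e2
      have e4 : (ρ N : ℂ) ≠ 0 := by exact_mod_cast (h.lac.pos N).ne'
      have e5 : ((h.partialProd (N + 1) n : ℝ) : ℂ) = (h.partialProd N n : ℂ)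
          * ((lam N : ℂ) / ρ N * (1 + (ρ N - lam N) / (lam N - n))) := by
        rw [partialProd, Finset.prod_range_succ, ratioFactor, ← partialProd]
        push_cast
        rfl
      rw [e5]
      have e6 : ((ρ N : ℂ) - lam N) / (lam N - n) / (n - μ)
          = -(((ρ N : ℂ) - lam N) / (lam N - μ) * (1 / (n - lam N) - 1 / (n - μ))) := by
        field_simp
        ring
      linear_combination (-((-1) ^ n * γ n * (h.partialProd N n : ℂ) * (lam N / ρ N))) * e6
    · refine h1.of_eq fun n => ?_
      rw [partialProd, partialProd, Finset.prod_range_succ, h.lam_off N hN,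
        ratioFactor_self (h.lac.pos N).ne', mul_one]

theorem hasSum_quotient_zero (h : PoleChoice M ρ d s S lam C₀) {Λ : Set ℂ} {γ : ℤ → ℂ}
    (hγ : ∀ l ∈ Λ, HasSum (fun n : ℤ => (-1) ^ n * γ n / (n - l)) 0)
    (hlam : ∀ k ∈ S, (lam k : ℂ) ∈ Λ) {δ : ℝ} (hδ : 0 < δ)
    (hΛ : ∀ n : ℤ, ∀ l ∈ Λ, δ ≤ dist (n : ℂ) l) (hM : ∀ n, ‖γ n‖ = M n)
    (hmaj : Summable fun n : ℤ => M n * (1 + h.poleWeight n) / (1 + |(n : ℝ)|))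
    {μ : ℂ} (hμ : μ ∈ Λ) (hne : ∀ k ∈ S, μ ≠ lam k) :
    HasSum (fun n : ℤ => (-1) ^ n * γ n * (h.quotient n : ℂ) / (n - μ)) 0 := by
  have hΛ' : ∀ l ∈ Λ, ∀ n : ℤ, (n : ℂ) - l ≠ 0 := fun l hl n h0 => by
    have := hΛ n l hl
    rw [dist_eq_norm, h0, norm_zero] at this
    linarith
  have hP : ∀ N, HasSum (fun n : ℤ => (-1) ^ n * γ n * (h.partialProd N n : ℂ) / (n - μ)) 0 :=
    fun N => h.hasSum_partialProd_zero hγ hlam hΛ' N μ hμ fun j hj _ => hne j hj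
  set C := poleConst * (1 + (1 + ‖μ‖) / δ) with hC
  have hbound : ∀ (a : ℝ) (n : ℤ), |a| ≤ poleConst * (1 + h.poleWeight n) →
      ‖(-1) ^ n * γ n * (a : ℂ) / (n - μ)‖
        ≤ C * (M n * (1 + h.poleWeight n) / (1 + |(n : ℝ)|)) := by
    intro a n ha
    have h1 := inv_norm_int_sub_le hδ (fun n => hΛ n μ hμ) n
    have hM0 : 0 ≤ M n := hM n ▸ norm_nonneg _
    have hw := h.poleWeight_nonneg n
    rw [norm_div, norm_mul, norm_mul, norm_zpow, norm_neg, norm_one, one_zpow, one_mul, hM,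
      Complex.norm_real, Real.norm_eq_abs, div_eq_mul_one_div]
    calc M n * |a| * (1 / ‖(n : ℂ) - μ‖)
        ≤ M n * (poleConst * (1 + h.poleWeight n))
          * ((1 + (1 + ‖μ‖) / δ) * (1 / (1 + |(n : ℝ)|))) := by
          have := poleConst_pos
          gcongr
      _ = _ := by rw [hC]; ring
  have hlim := tendsto_tsum_of_dominated_convergence
    (f := fun (N : ℕ) (n : ℤ) => (-1) ^ n * γ n * (h.partialProd N n : ℂ) / (n - μ))
    (g := fun n : ℤ => (-1) ^ n * γ n * (h.quotient n : ℂ) / (n - μ)) (𝓕 := atTop)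
    (hmaj.mul_left C)
    (fun n => (((Complex.continuous_ofReal.tendsto _).comp
      (h.tendsto_quotient n)).const_mul _).div_const _)
    (Eventually.of_forall fun N n => hbound _ n (h.abs_partialProd_le N n))
  have hz : ∑' n : ℤ, (-1) ^ n * γ n * (h.quotient n : ℂ) / (n - μ) = 0 := by
    refine tendsto_nhds_unique hlim (tendsto_const_nhds.congr fun N => ?_)
    exact (hP N).tsum_eq.symm
  have hsum : Summable fun n : ℤ => (-1) ^ n * γ n * (h.quotient n : ℂ) / (n - μ) :=
    Summable.of_norm_bounded (hmaj.mul_left C) fun n => hbound _ n (h.abs_quotient_le n)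
  exact hz ▸ hsum.hasSum

/-- Square summability provides f. By the sampling formula its value at μ is a multiple of the
modified series, which vanishes as a dominated limit of the series for the partial products. -/
theorem exists_pw_eq_mul_quotient (h : PoleChoice M ρ d s S lam C₀) {Λ : Set ℂ} {γ : ℤ → ℂ}
    (hγ : ∀ l ∈ Λ, HasSum (fun n : ℤ => (-1) ^ n * γ n / (n - l)) 0)
    (hlam : ∀ k ∈ S, (lam k : ℂ) ∈ Λ) {δ : ℝ} (hδ : 0 < δ)
    (hΛ : ∀ n : ℤ, ∀ l ∈ Λ, δ ≤ dist (n : ℂ) l) (hM : ∀ n, ‖γ n‖ = M n)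
    (hmaj : Summable fun n : ℤ => M n * (1 + h.poleWeight n) / (1 + |(n : ℝ)|))
    (hsq : Summable fun n : ℤ => (M n * h.quotient n) ^ 2) :
    ∃ f : L2Interval, (∀ n : ℤ, pw f n = γ n * h.quotient n) ∧
      ∀ μ ∈ Λ, (∀ k ∈ S, μ ≠ lam k) → pw f μ = 0 := by
  obtain ⟨f, hf⟩ := exists_pw_int_eq (a := fun n => γ n * (h.quotient n : ℂ)) (by
    refine hsq.congr fun n => ?_
    rw [norm_mul, hM, Complex.norm_real, mul_pow, mul_pow, Real.norm_eq_abs, sq_abs])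
  refine ⟨f, hf, fun μ hμ hne => ?_⟩
  have hμn : ∀ n : ℤ, μ ≠ n := fun n h0 => by
    have := hΛ n μ hμ
    rw [h0, dist_self] at this
    linarith
  have h1 := hasSum_sampling f hμn
  have h2 := (h.hasSum_quotient_zero hγ hlam hδ hΛ hM hmaj hμ hne).neg
  have h3 : HasSum (fun n : ℤ => (-1) ^ n * pw f n / (μ - n)) (-0) := by
    refine h2.of_eq fun n => ?_
    rw [hf, ← neg_sub, div_neg, neg_neg, mul_assoc]
  have h4 := h1.unique h3
  rw [neg_zero, div_eq_zero_iff] at h4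
  rcases h4 with h4 | h4
  · exact (mul_eq_zero.1 h4).resolve_left (by exact_mod_cast Real.pi_ne_zero)
  · exfalso
    rw [Complex.sin_eq_zero_iff] at h4
    obtain ⟨n, hn⟩ := h4
    refine hμn n (mul_left_cancel₀ (by exact_mod_cast Real.pi_ne_zero : (Real.pi : ℂ) ≠ 0) ?_)
    rw [hn, mul_comm]

end PoleChoice


/-! ### Interpolation of sums of simple fractions -/

open Polynomial in
-- Multiplied by ∏ (x - b_j), the fraction becomes a polynomial of degree less than the number of
-- nodes, so Lagrange interpolation recovers its value at 0. The coefficients are written as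
-- products of the shape of `ratioFactor (b j) (y j) (y k)`, to which the lacunary bounds apply.
theorem sum_simple_fractions_zero {F ι : Type*} [Field F] [DecidableEq ι] {T : Finset ι}
    {b y : ι → F} (c : ι → F) (hb : ∀ k ∈ T, b k ≠ 0) (hy : Set.InjOn y T)
    (hyb : ∀ k ∈ T, ∀ j ∈ T, y k - b j ≠ 0) :
    ∑ k ∈ T, c k / (0 - b k) = ∑ k ∈ T, (∑ j ∈ T, c j / (y k - b j)) *
      ((1 - y k / b k) * ∏ j ∈ T.erase k, (y j * (b j - y k) / (b j * (y j - y k)))) := by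
  set P : F[X] := ∑ k ∈ T, C (c k) * ∏ j ∈ T.erase k, (X - C (b j)) with hP
  have heval : ∀ x, (∀ j ∈ T, x - b j ≠ 0) →
      P.eval x = (∑ k ∈ T, c k / (x - b k)) * ∏ j ∈ T, (x - b j) := by
    intro x hx
    rw [hP, eval_finsetSum, Finset.sum_mul]
    refine Finset.sum_congr rfl fun k hk => ?_
    rw [eval_mul, eval_C, eval_prod, ← Finset.mul_prod_erase T (fun j => x - b j) hk]
    simp only [eval_sub, eval_X, eval_C]
    have := hx k hk
    field_simp
  have hdeg : P.degree < T.card := by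
    rw [← mem_degreeLT]
    refine Submodule.sum_mem _ fun k hk => ?_
    rw [mem_degreeLT]
    calc (C (c k) * ∏ j ∈ T.erase k, (X - C (b j))).degree
        ≤ (C (c k)).degree + (∏ j ∈ T.erase k, (X - C (b j))).degree := degree_mul_le _ _
      _ ≤ 0 + ((T.erase k).card : WithBot ℕ) := by
        refine add_le_add degree_C_le ?_
        rw [degree_prod]
        simp
      _ < T.card := by
        rw [zero_add]
        exact_mod_cast Finset.card_erase_lt_of_mem hk
  have hint := Lagrange.eq_interpolate_of_eval_eq (r := fun k => P.eval (y k)) hy hdeg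
    fun _ _ => rfl
  have h0 := congrArg (eval 0) hint
  rw [heval 0 fun j hj => by rw [zero_sub]; exact neg_ne_zero.2 (hb j hj),
    Lagrange.interpolate_apply, eval_finsetSum] at h0
  have hprod : ∏ j ∈ T, (0 - b j) ≠ 0 := Finset.prod_ne_zero_iff.2 fun j hj => by
    rw [zero_sub]
    exact neg_ne_zero.2 (hb j hj)
  refine mul_right_cancel₀ hprod (h0.trans ?_)
  rw [Finset.sum_mul]
  refine Finset.sum_congr rfl fun k hk => ?_
  rw [eval_mul, eval_C, heval (y k) (hyb k hk), Lagrange.basis, eval_prod, mul_assoc, mul_assoc,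
    ← Finset.mul_prod_erase T (fun j => y k - b j) hk,
    ← Finset.mul_prod_erase T (fun j => 0 - b j) hk]
  congr 1
  have e1 : (1 - y k / b k) * (0 - b k) = y k - b k := by
    have := hb k hk
    field_simp
    ring
  rw [mul_assoc, ← Finset.prod_mul_distrib, mul_mul_mul_comm, e1, ← Finset.prod_mul_distrib]
  congr 1
  refine Finset.prod_congr rfl fun j hj => ?_
  have hj' := Finset.mem_of_mem_erase hj
  have h1 := hb j hj'
  have h2 : y k - y j ≠ 0 := fun h => Finset.ne_of_mem_erase hj
    (hy hj' hk (sub_eq_zero.1 h).symm)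
  have h3 : y j - y k ≠ 0 := by
    rw [← neg_sub]
    exact neg_ne_zero.2 h2
  simp only [Lagrange.basisDivisor, eval_mul, eval_C, eval_sub, eval_X]
  field_simp
  ring

/-! ### Smallness at the origin of combinations of simple fractions -/

namespace PoleChoice

variable {M : ℤ → ℝ} {ρ d s : ℕ → ℝ} {S : Set ℕ} {lam : ℕ → ℝ} {C₀ : ℝ}

/-- The constant bounding the interpolation coefficients at nodes in the cores. -/
def nodeConst (η : ℝ) : ℝ := 6 * (2 * (Real.exp η / 0.725) * lacunaryConst * (16 * 16))

theorem nodeConst_pos (η : ℝ) : 0 < nodeConst η := by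
  rw [nodeConst, lacunaryConst]
  positivity

/-- The frequencies are now the zeros and the nodes the poles. In ∏ y/lam = (∏ y/ρ)/(∏ lam/ρ) the
numerator is controlled by the sum of d/ρ, and the denominator by the lower balance bound. -/
theorem prod_core_div_le (h : PoleChoice M ρ d s S lam C₀) {η : ℝ}
    (hη : ∀ T : Finset ℕ, ∑ k ∈ T, d k / ρ k ≤ η) {y : ℕ → ℝ} (hy : ∀ k, |y k - ρ k| ≤ d k)
    (m : ℕ) : ∏ j ∈ Finset.range m, y j / lam j ≤ Real.exp η / 0.725 := by
  have hlam : ∀ j, 0 < lam j := fun j => by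
    have := h.near.le_left j
    have := h.lac.pos j
    linarith
  have e : ∏ j ∈ Finset.range m, y j / lam j
      = (∏ j ∈ Finset.range m, y j / ρ j) / ∏ j ∈ Finset.range m, lam j / ρ j := by
    rw [← Finset.prod_div_distrib]
    refine Finset.prod_congr rfl fun j _ => ?_
    have := (h.lac.pos j).ne'
    have := (hlam j).ne'
    field_simp
  rw [e]
  have h1 : ∏ j ∈ Finset.range m, y j / ρ j ≤ Real.exp η := by
    calc ∏ j ∈ Finset.range m, y j / ρ j ≤ ∏ j ∈ Finset.range m, Real.exp (d j / ρ j) := by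
          refine Finset.prod_le_prod (fun j _ => ?_) fun j _ => ?_
          · have := (abs_le.1 (hy j)).1
            have := h.d_le j
            have := h.lac.pos j
            exact div_nonneg (by linarith) this.le
          · refine le_trans ?_ (Real.add_one_le_exp _)
            rw [div_add_one (h.lac.pos j).ne']
            have := (abs_le.1 (hy j)).2
            have := h.lac.pos j
            gcongr
            linarith
      _ = Real.exp (∑ j ∈ Finset.range m, d j / ρ j) := (Real.exp_sum _ _).symm
      _ ≤ Real.exp η := Real.exp_le_exp.2 (hη _)
  have h2 := h.le_prod m
  gcongr

theorem abs_ratioFactor_node_le (h : PoleChoice M ρ d s S lam C₀) {y : ℕ → ℝ}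
    (hy : ∀ k, |y k - ρ k| ≤ d k) {j k : ℕ} (hjk : j ≠ k) :
    |ratioFactor (lam j) (y j) (y k)| ≤ 16 ∧ y j - y k ≠ 0 := by
  have b1 := h.near.le_left j
  have b2 := h.near.le_right j
  have b3 := abs_le.1 (hy j)
  have b4 := abs_le.1 (hy k)
  have b5 := h.d_le j
  have b6 := h.d_le k
  have b7 := h.lac.pos j
  have b8 := h.lac.pos k
  have hlam : 0 < lam j := by linarith
  have hyj : 0 < y j := by linarith [b3.1]
  have key : ∀ D : ℝ, 0 < D → D ≤ |y j - y k| → |lam j - y k| ≤ 5 * D →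
      |ratioFactor (lam j) (y j) (y k)| ≤ 16 ∧ y j - y k ≠ 0 := by
    intro D hD h1 h2
    have hne : y j - y k ≠ 0 := abs_pos.1 (hD.trans_le h1)
    refine ⟨?_, hne⟩
    rw [ratioFactor_eq hne, mul_div_mul_comm, abs_mul, abs_div, abs_div, abs_of_pos hyj,
      abs_of_pos hlam]
    have e1 : y j / lam j ≤ 1.6 := by
      rw [div_le_iff₀ hlam]
      linarith [b3.2]
    have e2 : |lam j - y k| / |y j - y k| ≤ 5 := by
      rw [div_le_iff₀ (hD.trans_le h1)]
      linarith
    calc y j / lam j * (|lam j - y k| / |y j - y k|) ≤ 1.6 * 5 := by gcongr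
      _ ≤ 16 := by norm_num
  rcases lt_or_gt_of_ne hjk with hlt | hlt
  · have h2 := h.lac.two_mul_le_of_lt hlt
    refine key (0.25 * y k) (by linarith [b4.1]) ?_ ?_
    · rw [abs_of_neg] <;> linarith [b3.2, b4.1]
    · rw [abs_of_neg] <;> linarith [b4.1]
  · have h2 := h.lac.two_mul_le_of_lt hlt
    refine key (0.3 * ρ j) (by linarith) ?_ ?_
    · rw [abs_of_pos] <;> linarith [b3.1, b4.2]
    · rw [abs_of_pos] <;> linarith [b4.1, b4.2]

/-- The factor 1 - y_k/λ_k is O(s_k/ρ_k), as both points are within a multiple of s_k of ρ_k; the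
remaining product is bounded. -/
theorem abs_prod_node_le (h : PoleChoice M ρ d s S lam C₀) {η : ℝ}
    (hη : ∀ T : Finset ℕ, ∑ k ∈ T, d k / ρ k ≤ η) {y : ℕ → ℝ} (hy : ∀ k, |y k - ρ k| ≤ d k)
    {k N : ℕ} (hk : k ∈ S) (hN : k < N) :
    |(1 - y k / lam k) * ∏ j ∈ (Finset.range N).erase k, ratioFactor (lam j) (y j) (y k)|
      ≤ nodeConst η * (s k / ρ k) := by
  classical
  have hr := h.lac.pos k
  have hlam : 0 < lam k := by
    have := h.near.le_left k
    linarith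
  have hynear : IsNear ρ y := by
    constructor <;> intro j <;>
      linarith [(abs_le.1 (hy j)).1, (abs_le.1 (hy j)).2, h.d_le j, h.lac.pos j]
  obtain ⟨p, hp⟩ := exists_prod_ratioFactor_le h.lac (h.near.update h.lac k)
    (hynear.update h.lac k) (prod_update_le h.lac h.near hynear (h.prod_core_div_le hη hy) k) (y k)
    (V := fun _ => 16) (fun _ => by norm_num) fun j => by
      by_cases hj : j = k
      · subst hj
        rw [Function.update_self, Function.update_self, ratioFactor_self hr.ne']
        norm_num
      · rw [Function.update_of_ne hj, Function.update_of_ne hj]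
        exact (h.abs_ratioFactor_node_le hy hj).1
  have hpN := hp N
  have hkN : k ∈ Finset.range N := Finset.mem_range.2 hN
  rw [← Finset.mul_prod_erase _ _ hkN, Function.update_self, Function.update_self,
    ratioFactor_self hr.ne', one_mul] at hpN
  have he : ∏ j ∈ (Finset.range N).erase k,
      ratioFactor (Function.update lam k (ρ k) j) (Function.update y k (ρ k) j) (y k)
      = ∏ j ∈ (Finset.range N).erase k, ratioFactor (lam j) (y j) (y k) := by
    refine Finset.prod_congr rfl fun j hj => ?_
    rw [Function.update_of_ne (Finset.ne_of_mem_erase hj),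
      Function.update_of_ne (Finset.ne_of_mem_erase hj)]
  rw [he] at hpN
  have h1 : |1 - y k / lam k| ≤ 6 * (s k / ρ k) := by
    rw [one_sub_div hlam.ne', abs_div, abs_of_pos hlam, div_le_iff₀ hlam]
    have e1 : |lam k - y k| ≤ 3.75 * s k := by
      have := abs_sub_le (lam k) (ρ k) (y k)
      rw [abs_sub_comm (ρ k) (y k)] at this
      linarith [h.dist_le k hk, hy k, h.d_le_s k hk]
    have e2 : 4.35 * s k ≤ 6 * (s k / ρ k) * lam k := by
      calc 4.35 * s k = 6 * (s k / ρ k) * (0.725 * ρ k) := by field_simp; ring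
        _ ≤ _ := by
          have := h.s_nonneg k
          have := h.near.le_left k
          gcongr
    linarith [h.s_nonneg k]
  rw [abs_mul]
  have hs : 0 ≤ s k / ρ k := div_nonneg (h.s_nonneg k) hr.le
  calc _ ≤ 6 * (s k / ρ k)
        * (2 * (Real.exp η / 0.725) * lacunaryConst * (16 * 16)) := by gcongr
    _ = _ := by rw [nodeConst]; ring

/-- A sum of simple fractions with poles `lam k`. -/
def fraction (_ : PoleChoice M ρ d s S lam C₀) (T : Finset ℕ) (c : ℕ → ℂ) (x : ℂ) : ℂ :=
  ∑ k ∈ T, c k / (x - lam k)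

theorem core_nonempty (h : PoleChoice M ρ d s S lam C₀) {k : ℕ} (hk : k ∈ S) :
    (coreInts (ρ k) (d k)).Nonempty := by
  refine Finset.nonempty_iff_ne_empty.2 fun he => ?_
  have h1 := h.s_sq k
  rw [coreSum, he, Finset.sum_empty, mul_zero, zero_mul] at h1
  exact (pow_pos (h.s_pos k hk) 2).ne' h1

/-- Let R be the fraction and x_k an integer of the k-th core with |R| minimal, so that |R(x_k)|²
g_k is at most the core energy A_k. The interpolation term is a constant times |R(x_k)| s_k/ρ_k,
which equals the square root of |R(x_k)|² g_k · d_k/ρ_k and so is at most A_k + d_k/ρ_k. -/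
theorem norm_fraction_zero_le (h : PoleChoice M ρ d s S lam C₀) {η : ℝ}
    (hη : ∀ T : Finset ℕ, ∑ k ∈ T, d k / ρ k ≤ η) {T : Finset ℕ} {N : ℕ}
    (hT : ∀ k, k ∈ T ↔ k < N ∧ k ∈ S) (c : ℕ → ℂ) :
    ‖h.fraction T c 0‖ ≤ nodeConst η *
      (∑ k ∈ T, ∑ n ∈ coreInts (ρ k) (d k), (M n * ‖h.fraction T c n‖) ^ 2
        + ∑ k ∈ T, d k / ρ k) := by
  classical
  have hnode : ∀ k, ∃ n : ℤ, k ∈ T → n ∈ coreInts (ρ k) (d k) ∧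
      ‖h.fraction T c n‖ ^ 2 * coreSum M (ρ k) (d k)
        ≤ ∑ n ∈ coreInts (ρ k) (d k), (M n * ‖h.fraction T c n‖) ^ 2 := by
    intro k
    by_cases hk : k ∈ T
    · obtain ⟨n, hn, hmin⟩ := Finset.exists_min_image _ (fun n : ℤ => ‖h.fraction T c n‖)
        (h.core_nonempty ((hT k).1 hk).2)
      refine ⟨n, fun _ => ⟨hn, ?_⟩⟩
      rw [coreSum, Finset.mul_sum]
      refine Finset.sum_le_sum fun m hm => ?_
      rw [mul_pow, mul_comm]
      have := hmin m hm
      gcongr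
    · exact ⟨0, fun h0 => absurd h0 hk⟩
  choose x hx using hnode
  -- For indices below N and outside T the node, the zero and ρ coincide, so the product over T
  -- extends to the full range with factors 1.
  let y : ℕ → ℝ := fun k => if k ∈ T then (x k : ℝ) else ρ k
  have hyT : ∀ k ∈ T, y k = x k := fun k hk => if_pos hk
  have hy : ∀ k, |y k - ρ k| ≤ d k := by
    intro k
    by_cases hk : k ∈ T
    · rw [hyT k hk]
      exact mem_coreInts.1 (hx k hk).1
    · simp only [y, if_neg hk, sub_self, abs_zero]
      exact h.d_nonneg k
  have hlam0 : ∀ k, (lam k : ℂ) ≠ 0 := fun k => by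
    have := h.near.le_left k
    have := h.lac.pos k
    exact_mod_cast (by linarith : (0 : ℝ) < lam k).ne'
  have hne : ∀ k ∈ T, ∀ j ∈ T, ((y k : ℝ) : ℂ) - lam j ≠ 0 := by
    intro k hk j hj h0
    rw [hyT k hk] at h0
    refine h.lam_ne j ((hT j).1 hj).2 (x k) ?_
    rw [← neg_sub, neg_eq_zero]
    exact_mod_cast h0
  have hinj : Set.InjOn (fun k => ((y k : ℝ) : ℂ)) T := by
    intro j _ k _ hjk
    by_contra hcon
    refine (h.abs_ratioFactor_node_le hy hcon).2 (sub_eq_zero.2 ?_)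
    have hjk' : ((y j : ℝ) : ℂ) = y k := hjk
    exact_mod_cast hjk'
  have hmain := sum_simple_fractions_zero c (fun k _ => hlam0 k) hinj hne
  rw [fraction, hmain]
  refine (norm_sum_le _ _).trans ?_
  rw [← Finset.sum_add_distrib, Finset.mul_sum]
  refine Finset.sum_le_sum fun k hk => ?_
  obtain ⟨hkN, hkS⟩ := (hT k).1 hk
  have hr := h.lac.pos k
  have hcoef : ‖(1 - (y k : ℂ) / lam k) * ∏ j ∈ T.erase k,
      ((y j : ℂ) * (lam j - y k) / (lam j * (y j - y k)))‖ ≤ nodeConst η * (s k / ρ k) := by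
    refine le_trans (le_of_eq ?_) (h.abs_prod_node_le hη hy hkS hkN)
    have hsub : T.erase k ⊆ (Finset.range N).erase k :=
      Finset.erase_subset_erase _ fun j hj => Finset.mem_range.2 ((hT j).1 hj).1
    rw [← Finset.prod_subset hsub, ← Real.norm_eq_abs, ← Complex.norm_real]
    · congr 1
      push_cast
      congr 1
      refine Finset.prod_congr rfl fun j hj => ?_
      rw [ratioFactor_eq (h.abs_ratioFactor_node_le hy (Finset.ne_of_mem_erase hj)).2]
      push_cast
      rfl
    · intro j hj hjT
      have hjk := Finset.ne_of_mem_erase hj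
      have hjT' : j ∉ T := fun h0 => hjT (Finset.mem_erase.2 ⟨hjk, h0⟩)
      have hjS : j ∉ S := fun h0 =>
        hjT' ((hT j).2 ⟨Finset.mem_range.1 (Finset.mem_of_mem_erase hj), h0⟩)
      simp only [y, if_neg hjT', h.lam_off j hjS]
      exact ratioFactor_self (h.lac.pos j).ne' _
  have hfr : ∑ j ∈ T, c j / ((y k : ℂ) - lam j) = h.fraction T c (x k) := by
    rw [hyT k hk, fraction]
    simp
  rw [norm_mul, hfr]
  have hmass := (hx k hk).2
  set A := ∑ n ∈ coreInts (ρ k) (d k), (M n * ‖h.fraction T c n‖) ^ 2 with hA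
  have hA0 : 0 ≤ A := Finset.sum_nonneg fun n _ => sq_nonneg _
  have hD0 : 0 ≤ d k / ρ k := div_nonneg (h.d_nonneg k) hr.le
  have hsq : (‖h.fraction T c (x k)‖ * (s k / ρ k)) ^ 2 ≤ (A + d k / ρ k) ^ 2 := by
    calc (‖h.fraction T c (x k)‖ * (s k / ρ k)) ^ 2
        = ‖h.fraction T c (x k)‖ ^ 2 * coreSum M (ρ k) (d k) * (d k / ρ k) := by
          rw [mul_pow, div_pow, h.s_sq k]
          field_simp
      _ ≤ A * (d k / ρ k) := by gcongr
      _ ≤ (A + d k / ρ k) ^ 2 := by nlinarith [mul_nonneg hA0 hD0]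
  have hle := (abs_le_of_sq_le_sq' hsq (by positivity)).2
  calc _ ≤ ‖h.fraction T c (x k)‖ * (nodeConst η * (s k / ρ k)) := by gcongr
    _ = nodeConst η * (‖h.fraction T c (x k)‖ * (s k / ρ k)) := by ring
    _ ≤ nodeConst η * (A + d k / ρ k) :=
      mul_le_mul_of_nonneg_left hle (nodeConst_pos η).le

end PoleChoice


/-! ### The obstruction to hereditary completeness -/

theorem norm_pw_int_le (f : L2Interval) (n : ℤ) : ‖pw f n‖ ^ 2 ≤ 2 * Real.pi * ‖f‖ ^ 2 := by
  have h := hasSum_norm_sq_pw f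
  exact le_hasSum h n fun m _ => sq_nonneg _

namespace PoleChoice

variable {M : ℤ → ℝ} {ρ d s : ℕ → ℝ} {S : Set ℕ} {lam : ℕ → ℝ} {C₀ : ℝ}

theorem sum_core_norm_sq_le (h : PoleChoice M ρ d s S lam C₀) (f : L2Interval) (T : Finset ℕ) :
    ∑ k ∈ T, ∑ n ∈ coreInts (ρ k) (d k), ‖pw f (n : ℤ)‖ ^ 2 ≤ 2 * Real.pi * ‖f‖ ^ 2 := by
  classical
  rw [← Finset.sum_biUnion]
  · exact sum_le_hasSum _ (fun n _ => sq_nonneg _) (hasSum_norm_sq_pw f)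
  · intro j _ k _ hjk
    refine Finset.disjoint_left.2 fun n hn hn' => hjk ?_
    exact h.zone_unique (h.zone_of_core hn) (h.zone_of_core hn')

/-- Functions in the span of the biorthogonal elements at the poles nearly vanish at the origin
when they are close to the quotient. -/
theorem norm_pw_zero_le (h : PoleChoice M ρ d s S lam C₀) {η ε : ℝ}
    (hη : ∀ T : Finset ℕ, ∑ k ∈ T, d k / ρ k ≤ η)
    (hε : ∀ T : Finset ℕ, (∀ k ∈ T, k ∈ S) → ∑ k ∈ T, d k / ρ k ≤ ε)
    {γ : ℤ → ℂ} (hM : ∀ n, ‖γ n‖ = M n) (hγ0 : γ 0 = 1) {g : L2Interval}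
    (hg : ∀ n : ℤ, pw g n = γ n * h.quotient n) {f : L2Interval} {c : ℕ →₀ ℂ}
    (hc : ∀ k ∈ c.support, k ∈ S)
    (hf : ∀ n : ℤ, pw f n = γ n * c.sum fun k a => a / ((n : ℂ) - lam k)) :
    ‖pw f 0‖ ≤ nodeConst η *
      ((2 * poleConst ^ 2 + 1) * ε + 4 * Real.pi * ‖f - g‖ ^ 2) := by
  classical
  obtain ⟨N, hN⟩ : ∃ N, ∀ k ∈ c.support, k < N :=
    ⟨c.support.sup id + 1, fun k hk => Nat.lt_succ_of_le (Finset.le_sup (f := id) hk)⟩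
  set T := (Finset.range N).filter (· ∈ S) with hTdef
  have hT : ∀ k, k ∈ T ↔ k < N ∧ k ∈ S := fun k => by simp [hTdef]
  have hfrac : ∀ x : ℂ, c.sum (fun k a => a / (x - lam k)) = h.fraction T c x := fun x => by
    rw [fraction]
    exact Finsupp.sum_of_support_subset _ (fun k hk => (hT k).2 ⟨hN k hk, hc k hk⟩) _
      fun k _ => zero_div _
  have hf0 : pw f 0 = h.fraction T c 0 := by
    have := hf 0
    rw [hfrac, hγ0, one_mul] at this
    simpa using this
  rw [hf0]
  refine (h.norm_fraction_zero_le hη hT c).trans (mul_le_mul_of_nonneg_left ?_ (nodeConst_pos η).le)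
  have hTS : ∀ k ∈ T, k ∈ S := fun k hk => ((hT k).1 hk).2
  have hterm : ∀ n : ℤ, (M n * ‖h.fraction T c n‖) ^ 2
      ≤ 2 * (M n * h.quotient n) ^ 2 + 2 * ‖pw (f - g) n‖ ^ 2 := by
    intro n
    have e1 : M n * ‖h.fraction T c n‖ = ‖pw f n‖ := by
      rw [hf, hfrac, norm_mul, hM]
    have e2 : (M n * h.quotient n) ^ 2 = ‖pw g n‖ ^ 2 := by
      rw [hg, norm_mul, hM, Complex.norm_real, Real.norm_eq_abs, mul_pow, mul_pow, sq_abs]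
    rw [e1, e2, pw_sub]
    have h1 : ‖pw f n‖ ≤ ‖pw g n‖ + ‖pw f n - pw g n‖ := by
      have := norm_add_le (pw g n) (pw f n - pw g n)
      rwa [add_sub_cancel] at this
    have h2 : ‖pw f n‖ ^ 2 ≤ (‖pw g n‖ + ‖pw f n - pw g n‖) ^ 2 := by gcongr
    nlinarith [sq_nonneg (‖pw g n‖ - ‖pw f n - pw g n‖)]
  have hsum : ∑ k ∈ T, ∑ n ∈ coreInts (ρ k) (d k), (M n * ‖h.fraction T c n‖) ^ 2
      ≤ 2 * poleConst ^ 2 * ∑ k ∈ T, d k / ρ k + 4 * Real.pi * ‖f - g‖ ^ 2 := by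
    calc _ ≤ ∑ k ∈ T, (2 * (poleConst ^ 2 * (d k / ρ k))
          + 2 * ∑ n ∈ coreInts (ρ k) (d k), ‖pw (f - g) (n : ℤ)‖ ^ 2) := by
          refine Finset.sum_le_sum fun k hk => ?_
          refine (Finset.sum_le_sum fun n _ => hterm n).trans ?_
          rw [Finset.sum_add_distrib, ← Finset.mul_sum, ← Finset.mul_sum]
          have := h.sum_core_quotient_le (hTS k hk)
          gcongr
      _ = 2 * poleConst ^ 2 * ∑ k ∈ T, d k / ρ k
          + 2 * ∑ k ∈ T, ∑ n ∈ coreInts (ρ k) (d k), ‖pw (f - g) (n : ℤ)‖ ^ 2 := by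
          rw [Finset.sum_add_distrib, Finset.mul_sum, Finset.mul_sum]
          congr 1
          exact Finset.sum_congr rfl fun k _ => by ring
      _ ≤ _ := by linarith [h.sum_core_norm_sq_le (f - g) T]
  have h1 := hε T hTS
  have h2 : 2 * poleConst ^ 2 * ∑ k ∈ T, d k / ρ k ≤ 2 * poleConst ^ 2 * ε := by gcongr
  linarith

/-- Evaluation at 0 is continuous and equals 1 at g, while for f in W tending to g the bound on
|f(0)| tends to a number below 1. -/
theorem notMem_closure (h : PoleChoice M ρ d s S lam C₀) {η ε : ℝ}
    (hη : ∀ T : Finset ℕ, ∑ k ∈ T, d k / ρ k ≤ η)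
    (hε : ∀ T : Finset ℕ, (∀ k ∈ T, k ∈ S) → ∑ k ∈ T, d k / ρ k ≤ ε)
    (hsmall : nodeConst η * ((2 * poleConst ^ 2 + 1) * ε) < 1)
    {γ : ℤ → ℂ} (hM : ∀ n, ‖γ n‖ = M n) (hγ0 : γ 0 = 1) {g : L2Interval}
    (hg : ∀ n : ℤ, pw g n = γ n * h.quotient n) {W : Set L2Interval}
    (hW : ∀ f ∈ W, ∃ c : ℕ →₀ ℂ, (∀ k ∈ c.support, k ∈ S) ∧
      ∀ n : ℤ, pw f n = γ n * c.sum fun k a => a / ((n : ℂ) - lam k)) :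
    g ∉ closure W := by
  intro hmem
  have hg0 : pw g 0 = 1 := by
    have := hg 0
    rw [Int.cast_zero, Int.cast_zero, h.quotient_zero, hγ0] at this
    simpa using this
  have key : ∀ f ∈ W, 1 ≤ nodeConst η * ((2 * poleConst ^ 2 + 1) * ε
      + 4 * Real.pi * ‖f - g‖ ^ 2) + √(2 * Real.pi * ‖f - g‖ ^ 2) := by
    intro f hf
    obtain ⟨c, hc, hcf⟩ := hW f hf
    have h1 := h.norm_pw_zero_le hη hε hM hγ0 hg hc hcf
    have h2 : ‖pw (f - g) 0‖ ≤ √(2 * Real.pi * ‖f - g‖ ^ 2) := by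
      have := norm_pw_int_le (f - g) 0
      rw [Int.cast_zero] at this
      exact Real.le_sqrt_of_sq_le this
    rw [pw_sub, hg0] at h2
    have h3 : 1 ≤ ‖pw f 0‖ + ‖pw f 0 - 1‖ := by
      have := norm_sub_le (pw f 0) (pw f 0 - 1)
      rwa [sub_sub_cancel, norm_one] at this
    linarith
  obtain ⟨u, huW, hu⟩ := mem_closure_iff_seq_limit.1 hmem
  have hlim : Tendsto (fun i => nodeConst η * ((2 * poleConst ^ 2 + 1) * ε
      + 4 * Real.pi * ‖u i - g‖ ^ 2) + √(2 * Real.pi * ‖u i - g‖ ^ 2)) atTop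
      (𝓝 (nodeConst η * ((2 * poleConst ^ 2 + 1) * ε))) := by
    have hcont : Continuous fun v : L2Interval => nodeConst η * ((2 * poleConst ^ 2 + 1) * ε
      + 4 * Real.pi * ‖v - g‖ ^ 2) + √(2 * Real.pi * ‖v - g‖ ^ 2) := by fun_prop
    have := (hcont.tendsto g).comp hu
    simpa [Function.comp_def] using this
  exact hsmall.not_ge (ge_of_tendsto' hlim fun i => key _ (huW i))

end PoleChoice

/-- Subtract from g its projection onto the closed span of the chosen `w m`. The difference is
orthogonal to these `w m`, and to the chosen `v l` by `hg` and biorthogonality, so it vanishes by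
completeness of the mixed system. -/
theorem mem_closure_span_of_spansDensely {ι H : Type*} [NormedAddCommGroup H]
    [InnerProductSpace ℂ H] [CompleteSpace H] {v w : ι → H} (hvw : IsBiorthogonal v w) {A : Set ι}
    (hA : SpansDensely (v '' A ∪ w '' Aᶜ)) {g : H} (hg : ∀ l ∈ A, inner ℂ (v l) g = 0) :
    g ∈ closure (Submodule.span ℂ (w '' Aᶜ) : Set H) := by
  set V := (Submodule.span ℂ (w '' Aᶜ)).topologicalClosure with hV
  have hcl : IsClosed (V : Set H) := Submodule.isClosed_topologicalClosure _
  have : CompleteSpace V := hcl.completeSpace_coe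
  have hperp : ∀ l ∈ A, ∀ p ∈ V, inner ℂ (v l) p = 0 := by
    intro l hl p hp
    have hker : V ≤ LinearMap.ker (innerSL ℂ (v l)).toLinearMap := by
      refine Submodule.topologicalClosure_minimal _ (Submodule.span_le.2 ?_)
        (innerSL ℂ (v l)).isClosed_ker
      rintro _ ⟨m, hm, rfl⟩
      refine hvw.2 l m fun h0 => hm (h0 ▸ hl)
    exact hker hp
  have hu : g - V.starProjection g = 0 := by
    refine hA.eq_zero_of_inner_eq_zero ?_
    rintro _ (⟨l, hl, rfl⟩ | ⟨m, hm, rfl⟩)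
    · rw [inner_sub_right, hg l hl, hperp l hl _ (Submodule.starProjection_apply_mem _ _), sub_zero]
    · exact V.sub_starProjection_mem_orthogonal g _
        (Submodule.le_topologicalClosure _ (Submodule.subset_span ⟨m, hm, rfl⟩))
  have : g ∈ V := by
    rw [sub_eq_zero.1 hu]
    exact Submodule.starProjection_apply_mem _ _
  exact this

/-- The values at the integers of the combinations of biorthogonal elements. -/
theorem exists_fraction_of_mem_span {Λ : Set ℂ} {w : Λ → L2Interval} {γ : ℤ → ℂ} {S : Set ℕ}
    {lam : ℕ → ℝ} (hw : ∀ l : Λ, ∃ a : ℂ, ∀ n : ℤ, pw (w l) n = a * (γ n / (n - l)))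
    {B : Set Λ} (hB : ∀ l ∈ B, ∃ k ∈ S, (l : ℂ) = lam k) {f : L2Interval}
    (hf : f ∈ Submodule.span ℂ (w '' B)) :
    ∃ c : ℕ →₀ ℂ, (∀ k ∈ c.support, k ∈ S) ∧
      ∀ n : ℤ, pw f n = γ n * c.sum fun k a => a / ((n : ℂ) - lam k) := by
  classical
  induction hf using Submodule.span_induction with
  | mem f hf =>
    obtain ⟨l, hl, rfl⟩ := hf
    obtain ⟨k, hk, hlk⟩ := hB l hl
    obtain ⟨a, ha⟩ := hw l
    refine ⟨Finsupp.single k a, fun j hj => ?_, fun n => ?_⟩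
    · rw [Finset.mem_singleton.1 (Finsupp.support_single_subset hj)]
      exact hk
    · rw [ha, hlk, Finsupp.sum_single_index (zero_div _)]
      ring
  | zero => exact ⟨0, by simp, fun n => by rw [pw_zero]; simp⟩
  | add f g _ _ hf hg =>
    obtain ⟨c, hc, hcf⟩ := hf
    obtain ⟨c', hc', hcg⟩ := hg
    refine ⟨c + c', fun k hk => ?_, fun n => ?_⟩
    · rcases Finset.mem_union.1 (Finsupp.support_add hk) with h | h
      · exact hc k h
      · exact hc' k h
    · rw [pw_add, hcf, hcg, Finsupp.sum_add_index' (fun _ => zero_div _)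
        (fun _ _ _ => add_div _ _ _),
        mul_add]
  | smul a f _ hf =>
    obtain ⟨c, hc, hcf⟩ := hf
    refine ⟨a • c, fun k hk => hc k (Finsupp.support_smul hk), fun n => ?_⟩
    rw [pw_smul, hcf, Finsupp.sum_smul_index' fun _ => zero_div _, Finsupp.sum, Finsupp.sum,
      mul_left_comm, Finset.mul_sum]
    congr 1
    refine Finset.sum_congr rfl fun k _ => ?_
    rw [smul_eq_mul]
    ring

/-! ### Sums over the integers of an interval -/

theorem sumSq_coreInterval (G : ℂ → ℂ) (ρ d : ℝ) :
    sumSq G (coreInterval ρ d) = coreSum (fun n => ‖G n‖) ρ d := by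
  rw [sumSq, coreSum, ← finsum_mem_coe_finset]
  refine finsum_congr fun n => finsum_congr_Prop ?_ fun _ => rfl
  rw [Finset.mem_coe, mem_coreInts, abs_le, coreInterval, Set.mem_Icc]
  refine propext ⟨fun h => ?_, fun h => ?_⟩ <;> constructor <;> linarith [h.1, h.2]

theorem sumSq_flankSet (G : ℂ → ℂ) {ρ d s : ℝ} :
    sumSq G (flankSet ρ d s) = flankSum (fun n => ‖G n‖) ρ d s := by
  rw [sumSq, flankSum, ← finsum_mem_coe_finset]
  refine finsum_congr fun n => finsum_congr_Prop ?_ fun _ => rfl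
  simp only [flankInts, flankSet, Finset.coe_union, Finset.coe_Icc, Set.mem_union, Set.mem_Icc,
    Int.ceil_le, Int.le_floor]

end

/-! ### Assembly of the main theorem -/

theorem theorem2p1 (Λ : Set ℂ) (G : ℂ → ℂ)
    (hΛ : IsCompleteMinimal (exponentialSystem Λ))
    (hG : IsGeneratingFunction Λ G)
    -- `Λ` and `G` are real; `Λ` is at positive distance from `ℤ` and locally dense;
    -- `G` is `o(e^{π|y|})` along the imaginary axis
    (ha_freq : ∀ l ∈ Λ, l.im = 0)
    (ha_real : ∀ x : ℝ, (G x).im = 0)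
    (hb : ∃ δ : ℝ, 0 < δ ∧ ∀ n : ℤ, ∀ l ∈ Λ, δ ≤ dist (n : ℂ) l)
    (hc : ∃ C : ℝ, 0 < C ∧ ∀ a b : ℝ, C ≤ b - a → ∃ x ∈ Set.Icc a b, (x : ℂ) ∈ Λ)
    (hd : (fun y : ℝ => G (Complex.I * y)) =o[cocompact ℝ] fun y : ℝ => Real.exp (Real.pi * |y|))
    -- the lacunary intervals `I k = [ρ k - d k, ρ k + d k]`
    (ρ d : ℕ → ℝ)
    (hd_nonneg : ∀ k, 0 ≤ d k)
    (h_lac : ∀ k, 2 * ρ k ≤ ρ (k + 1))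
    (h_small : ∀ k, d k ≤ 0.1 * ρ k)
    (hρ_int : ∀ k, ∀ n : ℤ, 1 / 3 ≤ |ρ k - n|)
    (hρ_G : ∀ k, G (ρ k) ≠ 0)
    -- square summability off the intervals, smallness near them, finite logarithmic length
    (h1 : Summable fun n : {n : ℤ // ∀ k, (n : ℝ) ∉ coreInterval (ρ k) (d k)} =>
      ‖G ((n : ℤ) : ℂ)‖ ^ 2)
    (h2 : Summable fun k =>
      flankScale G (ρ k) (d k) * sumSq G (flankSet (ρ k) (d k) (flankScale G (ρ k) (d k))))
    (h3 : ∀ k, flankScale G (ρ k) (d k) ≤ 0.1 * ρ k)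
    (h4 : Summable fun k => d k / ρ k) :
    ¬ IsHereditarilyComplete (exponentialSystem Λ) := by
  classical
  intro hher
  obtain ⟨δ, hδ, hsep⟩ := hb
  obtain ⟨C, hC, hdense⟩ := hc
  set M : ℤ → ℝ := fun n => ‖G n‖ with hMdef
  set s : ℕ → ℝ := fun k => flankScale G (ρ k) (d k) with hsdef
  have hρ : IsLacunary ρ := by
    refine ⟨fun k => ?_, h_lac⟩
    -- The bounds 0 ≤ d ≤ 0.1ρ give ρ ≥ 0, and the distance to the integer 0 makes it positive.
    have e1 := hρ_int k 0
    rw [Int.cast_zero, sub_zero, abs_of_nonneg (by linarith [hd_nonneg k, h_small k])] at e1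
    linarith
  have hmem : ∀ (k : ℕ) (n : ℤ), n ∈ coreInts (ρ k) (d k) ↔ (n : ℝ) ∈ coreInterval (ρ k) (d k) := by
    intro k n
    rw [coreInts, Finset.mem_Icc, Int.ceil_le, Int.le_floor, coreInterval, Set.mem_Icc]
  -- A core containing an integer reaches at least 1/3 away from its centre; shorter cores carry no
  -- mass.
  have hd3 : ∀ k, (coreInts (ρ k) (d k)).Nonempty → 1 / 3 ≤ d k := by
    rintro k ⟨n, hn⟩
    have e1 := mem_coreInts.1 hn
    rw [abs_sub_comm] at e1
    exact (hρ_int k n).trans e1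
  have hs0 : ∀ k, 0 ≤ s k := fun k => Real.sqrt_nonneg _
  have hs : ∀ k, s k ^ 2 = d k * coreSum M (ρ k) (d k) * ρ k := by
    intro k
    simp only [hsdef, flankScale, sumSq_coreInterval]
    have := hd_nonneg k
    have := (hρ.pos k).le
    have := coreSum_nonneg M (ρ k) (d k)
    exact Real.sq_sqrt (by positivity)
  have hg : ∀ k, d k * coreSum M (ρ k) (d k) * ρ k ≤ 0.01 * ρ k ^ 2 := by
    intro k
    rw [← hs k]
    have e1 := pow_le_pow_left₀ (hs0 k) (h3 k) 2
    calc s k ^ 2 ≤ (0.1 * ρ k) ^ 2 := e1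
      _ = 0.01 * ρ k ^ 2 := by ring
  have hflank : Summable fun k => s k * flankSum M (ρ k) (d k) (s k) :=
    h2.congr fun k => by rw [sumSq_flankSet]
  set E : Set ℤ := {n | ∀ k, (n : ℝ) ∉ coreInterval (ρ k) (d k)} with hE
  set A : ℤ → ℝ := E.indicator fun n => M n ^ 2 with hA
  have hAsum : Summable A := summable_subtype_iff_indicator.1 h1
  have hA0 : ∀ n, 0 ≤ A n := Set.indicator_nonneg fun n _ => sq_nonneg _
  have hout : ∀ n, (∀ k, n ∉ coreInts (ρ k) (d k)) → M n ^ 2 ≤ A n := by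
    intro n hn
    rw [hA, Set.indicator_of_mem]
    exact fun k hk => hn k ((hmem k n).2 hk)
  have hsum :=
    summable_div_one_add_abs (fun n => norm_nonneg (G n)) hρ h_small hd3 hg hAsum hA0 hout
  have hΛne : Λ.Nonempty := by
    obtain ⟨x, -, hx⟩ := hdense 0 C (by simp)
    exact ⟨x, hx⟩
  obtain ⟨w, hw⟩ := hΛ.exists_isBiorthogonal
  obtain ⟨γ, hγ0, hγM, hγw, hγsum⟩ := exists_integer_values hΛ hG ha_freq hδ hsep hd hsum hΛne hw
  obtain ⟨C₀, K₁, hchoice⟩ := exists_poleChoice hδ (le_max_right C 1) hsep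
    (fun a b hab => hdense a b ((le_max_left C 1).trans hab)) hρ hd3 hd_nonneg h_small hs0 h3 hs
  have hdρ0 : ∀ k, 0 ≤ d k / ρ k := fun k => div_nonneg (hd_nonneg k) (hρ.pos k).le
  set η := ∑' k, d k / ρ k with hη
  have hηT : ∀ T : Finset ℕ, ∑ k ∈ T, d k / ρ k ≤ η := fun T => h4.sum_le_tsum T fun k _ => hdρ0 k
  -- The constant involves the full sum η and not the truncation K₀, so ε can be fixed first and K₀
  -- then chosen to make the tail of d/ρ at most ε.
  obtain ⟨ε, hε0, hε⟩ : ∃ ε : ℝ, 0 < ε ∧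
      PoleChoice.nodeConst η * ((2 * poleConst ^ 2 + 1) * ε) < 1 := by
    have hq : 0 < PoleChoice.nodeConst η * (2 * poleConst ^ 2 + 1) :=
      mul_pos (PoleChoice.nodeConst_pos η) (by positivity)
    refine ⟨1 / (2 * (PoleChoice.nodeConst η * (2 * poleConst ^ 2 + 1))), by positivity, ?_⟩
    rw [← mul_assoc, mul_one_div, div_lt_one (by positivity)]
    linarith
  obtain ⟨T₀, hT₀⟩ := summable_iff_vanishing_norm.1 h4 ε hε0
  set K₀ := max K₁ (T₀.sup id + 1) with hK₀
  obtain ⟨lam, h, hlam⟩ := hchoice K₀ (le_max_left _ _)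
  set S := heavySet M ρ d K₀ with hS
  have hεT : ∀ T : Finset ℕ, (∀ k ∈ T, k ∈ S) → ∑ k ∈ T, d k / ρ k ≤ ε := by
    intro T hT
    refine (le_abs_self _).trans (hT₀ T (Finset.disjoint_left.2 fun k hk hk' => ?_)).le
    have e1 : K₀ ≤ k := (hT k hk).1
    have e2 : k ≤ T₀.sup id := Finset.le_sup (f := id) hk'
    have e3 : T₀.sup id + 1 ≤ K₀ := le_max_right _ _
    omega
  obtain ⟨g, hg, hgΛ⟩ := h.exists_pw_eq_mul_quotient (fun l hl => hγsum ⟨l, hl⟩) hlam hδ hsep hγM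
    (h.summable_majorant (fun n => norm_nonneg (G n)) hflank hsum)
    (h.summable_mul_quotient_sq hflank h4 (summable_indicator_compl_heavySet M hdρ0 h4 K₀)
      hAsum hA0 hout)
  -- The partition: exponentials at the frequencies that are not poles, biorthogonal elements at the
  -- poles.
  set B : Set Λ := {l | ∀ k ∈ S, (l : ℂ) ≠ lam k} with hB
  refine h.notMem_closure hηT hεT hε hγM hγ0 hg
    (W := (Submodule.span ℂ (w '' Bᶜ) : Set L2Interval)) (fun f hf => ?_)
    (mem_closure_span_of_spansDensely hw (hher.2 w hw B) fun l hl => ?_)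
  · refine exists_fraction_of_mem_span hγw (fun l hl => ?_) hf
    by_contra hcon
    push Not at hcon
    exact hl hcon
  · rw [exponentialSystem, inner_exponential_eq_pw (ha_freq l l.2)]
    exact hgΛ l l.2 hl
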